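/- **Setting.** An instance with $m$ agents and $n$ divisible items is a matrix $P=(p_{i,j})$ of positive weights. A feasible allocation is $X=(x_{i,j})$ with $x_{i,j}\in[0,1]$ and $\sum_i x_{i,j}=1$ for all $j$; the load of agent $i$ is $\ell_i(P,X)=\sum_j x_{i,j}p_{i,j}$. For $\alpha\in\mathbb R$ and $\mathbf w\in\mathbb R_{>0}^m$ the EP-allocation is $x_{i,j}=p_{i,j}^{\alpha}w_i/\sum_{i'}p_{i',j}^{\alpha}w_{i'}$; denote its load vector by $\boldsymbol\ell(P,\alpha,\mathbf w)$. An objective $f:\mathbb R_{>0}^m\to\mathbb R_{>0}$ is well-behaved if it is monotone ($\ell\ge\ell'$ coordinatewise implies $f(\ell)\ge f(\ell')$) and homogeneous ($f(c\,\ell)=c f(\ell)$ for $c>0$). It is superadditive if $f(\ell+\ell')\ge f(\ell)+f(\ell')$, and subadditive if $f(\ell+\ell')\le f(\ell)+f(\ell')$, for all $\ell,\ell'\in\mathbb R_{>0}^m$. Let $\mathrm{OPT}_f(P)$ be the supremum (for maximization), respectively the infimum (for minimization), of $f(\boldsymbol\ell(P,X))$ over the feasible $X$ with all loads positive. Let $\mathcal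 D=\times_{j\in[n]}\mathcal D_j$, where $\mathcal D_j$ is a discrete distribution on $\mathbb R_{>0}^m$ from which the weight vector $(p_{i,j})_{i\in[m]}$ of item $j$ is drawn, independently of the other items, and let $T=\mathbb E_{P\sim\mathcal D}[\mathrm{OPT}_f(P)]$. **Small items assumption** (for $\epsilon$, with parameter $\zeta$). There are feasible allocations $X_P$, one for each $P$ in the support of $\mathcal D$, with all loads positive and optimal for $f$ up to a factor $1-\epsilon$ (that is, $f(\boldsymbol\ell(P,X_P))\ge(1-\epsilon)\mathrm{OPT}_f(P)$) for maximization, respectively $1+\epsilon$ ($f(\boldsymbol\ell(P,X_P))\le(1+\epsilon)\mathrm{OPT}_f(P)$) for minimization, for instance optimal ones, such that every weight that occurs with positive probability satisfies $p_{i,j}\le\frac1\zeta\,\mathbb E_{P'\sim\mathcal D}[\ell_i(P',X_{P'})]$. (If $f=\min_i\ell_i$ is maximized or $f=\max_i\ell_i$ is minimized, optimal allocations with equal loads exist, and with these the condition reads $p_{i,j}\le T/\zeta$.) **Theorem.** For every $\kappa>0$ there are constants $c_1,c_2,c_3>0$ such that for all $m\ge2$ and $0<\epsilon<1$ there are $N\in\mathbb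 N$ with $N\le c_2\,\frac{m}{\log m}\log\frac m\epsilon$ and exponentiation constants $\alpha_{\max},\alpha_{\min}\in\mathbb R$ such that the following holds for every $n$ and every well-behaved $f:\mathbb R_{>0}^m\to\mathbb R_{>0}$. 1. (Maximization.) If $f$ is superadditive, there is a learning algorithm, i.e. a map $A$ from $N$-tuples of instances to parameter vectors in $\mathbb R_{>0}^m$, such that for every $\mathcal D$ as above that satisfies the small items assumption for maximization with $\zeta=c_1\frac{\log m}{\epsilon^2}$, with probability at least $1-m^{-\kappa}$ over independent $P_1,\dots,P_N\sim\mathcal D$, the vector $\mathbf w=A(P_1,\dots,P_N)$ satisfies $$\mathbb E_{P\sim\mathcal D}\big[f(\boldsymbol\ell(P,\alpha_{\max},\mathbf w))\big]\ \ge\ (1-c_3\epsilon)\,T .$$ 2. (Minimization.) If $f$ is subadditive, there is a learning algorithm $A$ of the same kind such that for every $\mathcal D$ as above that satisfies the small items assumption for minimization with $\zeta=c_1\frac{\log m}{\epsilon^2}$, with probability at least $1-m^{-\kappa}$ over independent $P_1,\dots,P_N\sim\mathcal D$, the vector $\mathbf w=A(P_1,\dots,P_N)$ satisfies $$\mathbb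 E_{P\sim\mathcal D}\big[f(\boldsymbol\ell(P,\alpha_{\min},\mathbf w))\big]\ \le\ (1+c_3\epsilon)\,T .$$ In both cases the expectation on the left is finite. -/

import Mathlib

namespace OnlineAllocation

/-- A weight matrix with `m` agents and `n` items, stored by columns: `P j i` is the weight
`p_{i,j}` of item `j` for agent `i`, so that `P j` is the weight vector of item `j`. -/
abbrev Instance (m n : ℕ) : Type := Fin n → Fin m → ℝ

/-- A (fractional) assignment matrix, stored by columns like the weights:
`X j i` is the fraction of item `j` given to agent `i`. -/
abbrev Assignment (m n : ℕ) : Type := Fin n → Fin m → ℝ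

/-- Feasible assignments: fractions in `[0, 1]`, every item fully allocated. -/
def IsFeasible {m n : ℕ} (X : Assignment m n) : Prop :=
  (∀ j i, 0 ≤ X j i ∧ X j i ≤ 1) ∧ ∀ j, ∑ i, X j i = 1

/-- The load `ℓ_i(P, X) = ∑_j x_{i,j} p_{i,j}` of every agent. -/
def load {m n : ℕ} (P : Instance m n) (X : Assignment m n) : Fin m → ℝ :=
  fun i => ∑ j, X j i * P j i

/-- The exponentiated proportional (EP) allocation with exponentiation constant `α` and
parameter vector `w`. -/
noncomputable def epAllocation {m n : ℕ} (α : ℝ) (w : Fin m → ℝ) (P : Instance m n) :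
    Assignment m n :=
  fun j i => (P j i) ^ α * w i / ∑ k, (P j k) ^ α * w k

/-- Well-behaved objectives: positive, monotone and homogeneous functions on the open positive
orthant (values of `f` elsewhere are irrelevant). -/
structure WellBehaved {m : ℕ} (f : (Fin m → ℝ) → ℝ) : Prop where
  pos : ∀ l : Fin m → ℝ, (∀ i, 0 < l i) → 0 < f l
  mono : ∀ l l' : Fin m → ℝ, (∀ i, 0 < l' i) → (∀ i, l' i ≤ l i) → f l' ≤ f l
  homog : ∀ (c : ℝ) (l : Fin m → ℝ), 0 < c → (∀ i, 0 < l i) → f (fun i => c * l i) = c * f l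

/-- Superadditivity on the positive orthant. (The inequality for several summands follows from
the one for two summands.) -/
def Superadditive {m : ℕ} (f : (Fin m → ℝ) → ℝ) : Prop :=
  ∀ l l' : Fin m → ℝ, (∀ i, 0 < l i) → (∀ i, 0 < l' i) → f l + f l' ≤ f (fun i => l i + l' i)

/-- Subadditivity on the positive orthant. -/
def Subadditive {m : ℕ} (f : (Fin m → ℝ) → ℝ) : Prop :=
  ∀ l l' : Fin m → ℝ, (∀ i, 0 < l i) → (∀ i, 0 < l' i) → f (fun i => l i + l' i) ≤ f l + f l'

/-- The objective values attained by the feasible assignments of `P` whose load vector lies in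
the domain of `f`, the open positive orthant. -/
def attainable {m n : ℕ} (f : (Fin m → ℝ) → ℝ) (P : Instance m n) : Set ℝ :=
  {v | ∃ X : Assignment m n, IsFeasible X ∧ (∀ i, 0 < load P X i) ∧ f (load P X) = v}

/-- Optimal value of `P` when `f` is maximized. For positive weights, at least one item and a
well-behaved `f`, the set is nonempty and bounded above. -/
noncomputable def optMax {m n : ℕ} (f : (Fin m → ℝ) → ℝ) (P : Instance m n) : ℝ :=
  sSup (attainable f P)

/-- Optimal value of `P` when `f` is minimized. -/
noncomputable def optMin {m n : ℕ} (f : (Fin m → ℝ) → ℝ) (P : Instance m n) : ℝ :=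
  sInf (attainable f P)

/-- The law `𝒟 = ×_j 𝒟_j` of a random instance: the weight vectors of the items are independent,
that of item `j` has the discrete distribution `D j`. -/
noncomputable def law {m n : ℕ} (D : Fin n → PMF (Fin m → ℝ)) :
    MeasureTheory.Measure (Instance m n) :=
  MeasureTheory.Measure.pi fun j => (D j).toMeasure

/-- The law of `N` independent instances sampled from `𝒟`. -/
noncomputable def sampleLaw {m n : ℕ} (N : ℕ) (D : Fin n → PMF (Fin m → ℝ)) :
    MeasureTheory.Measure (Fin N → Instance m n) :=
  MeasureTheory.Measure.pi fun _ => law D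

/-- All weights that can occur are positive. -/
def PositiveWeights {m n : ℕ} (D : Fin n → PMF (Fin m → ℝ)) : Prop :=
  ∀ j, ∀ p ∈ (D j).support, ∀ i, 0 < p i

/-- `P` is an instance that can occur under `𝒟`. -/
def InSupport {m n : ℕ} (D : Fin n → PMF (Fin m → ℝ)) (P : Instance m n) : Prop :=
  ∀ j, P j ∈ (D j).support

/-- Every weight that can occur is at most a `1/ζ` fraction of the expected load that the
agent has when every instance `P` is allocated according to `X P`. -/
def ItemsSmallFor {m n : ℕ} (D : Fin n → PMF (Fin m → ℝ)) (ζ : ℝ)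
    (X : Instance m n → Assignment m n) : Prop :=
  ∀ j, ∀ p ∈ (D j).support, ∀ i, p i ≤ (∫ P, load P (X P) i ∂(law D)) / ζ

/-- Small items assumption for maximizing `f`: each item is small compared to the expected load
of each agent in an optimal solution. It suffices that the solution is optimal up to a factor
`1 - ε`, as the supremum over the open orthant need not be attained. -/
def SmallItemsMax {m n : ℕ} (f : (Fin m → ℝ) → ℝ) (D : Fin n → PMF (Fin m → ℝ))
    (ε ζ : ℝ) : Prop :=
  ∃ X : Instance m n → Assignment m n,
    (∀ P, InSupport D P → IsFeasible (X P) ∧ (∀ i, 0 < load P (X P) i) ∧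
      (1 - ε) * optMax f P ≤ f (load P (X P))) ∧
    ItemsSmallFor D ζ X

/-- Small items assumption for minimizing `f`. -/
def SmallItemsMin {m n : ℕ} (f : (Fin m → ℝ) → ℝ) (D : Fin n → PMF (Fin m → ℝ))
    (ε ζ : ℝ) : Prop :=
  ∃ X : Instance m n → Assignment m n,
    (∀ P, InSupport D P → IsFeasible (X P) ∧ (∀ i, 0 < load P (X P) i) ∧
      f (load P (X P)) ≤ (1 + ε) * optMin f P) ∧
    ItemsSmallFor D ζ X

/-- `f`-value of the EP-allocation on the instance `P`. -/
noncomputable def epValue {m n : ℕ} (f : (Fin m → ℝ) → ℝ) (α : ℝ) (w : Fin m → ℝ)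
    (P : Instance m n) : ℝ :=
  f (load P (epAllocation α w P))

/-- A learning algorithm: it maps `N` sampled instances to a parameter vector. -/
abbrev Learner (m n N : ℕ) : Type := (Fin N → Instance m n) → Fin m → ℝ

end OnlineAllocation

namespace OnlineAllocation

open MeasureTheory

variable {m n : ℕ}

/-! ### Measures carried by a countable set -/

/-! The problem is reduced to expected loads. A homogeneous superadditive `f` is concave, so at the
vector `L` of expected loads of the near-optimal allocations it is at least `(1 - ε) T`; in the
subadditive case convexity gives at most `(1 + ε) T` (`Superadditive.integral_le`,
`Subadditive.le_integral`). It remains to find an EP-allocation whose expected loads compare well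
with `L`, to show that its random loads stay near their means, and to learn its parameters.

Existence is a smoothed duality argument. Put a price `y i` on a unit of load of agent `i`. If some
allocation has expected loads at least `lam`, then assigning every item to the agent of largest
priced weight earns in expectation at least `∑ y i * lam i`. Replace this maximum by the `ℓ_{γ+1}`
norm: for `γ` of order `m / e` the loss is a factor `1 + O(e)`, and the relative increase in
coordinate `i` is governed by the share of agent `i` in the EP-allocation with exponent `γ` and
parameters `y i ^ γ`. Stationarity of the smoothed worth minus `(1 - e) ∑ y i * lam i` then says
that these EP loads reach almost `lam`. Derivatives are avoided: prices `θ ^ l i / lam i` range over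
a finite grid, and a grid minimum is tested against raising one price by the factor `θ`
(`exists_grid_local_min`, `exists_share_colMean_ge`). For upper bounds on loads the minimum replaces
the maximum, negative exponents approximate it, and the EP exponent is `-γ - 1`
(`exists_share_colMean_le`).

Small items give exponential moment bounds for every load. On a random instance they yield one
random variable `Z` of small mean dominating the relative deviations of all agents at once
(`exists_common_bound`), which monotonicity and homogeneity turn into an error in `f`. On the
samples they yield tails `exp (-N e² z)`, which beat a union bound over a grid of size `(m / ε) ^
O(m)` once `N e² z` is of order `m log (m / ε)`; as `e² z` is of order `log m`, this is the stated
sample size.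

For maximization the learner seeks targets `θ ^ k i` and prices such that the sampled EP loads meet
the targets, and nearly maximizes `f` of the targets. For minimization it minimizes `f` of the
sampled loads over a finite class of parameters. That class can be fixed without knowing the
distribution because, measured in the costs `unitCost f i`, the relevant targets are `f L` divided
by bounded powers of `θ`, and the factor `f L` cancels from the shares. -/

theorem aestronglyMeasurable_of_countable {α : Type*} [MeasurableSpace α]
    [MeasurableSingletonClass α] {μ : Measure α} {s : Set α} (hs : s.Countable)
    (hμ : ∀ᵐ x ∂μ, x ∈ s) (f : α → ℝ) : AEStronglyMeasurable f μ := by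
  classical
  -- Preimages under the indicator are countable or cocountable, according to whether they avoid the
  -- value `0`; hence no assumption on `f` is needed.
  refine ⟨s.indicator f, ?_, ?_⟩
  · apply Measurable.stronglyMeasurable
    intro t _
    have key : ∀ u : Set ℝ, (0:ℝ) ∉ u → MeasurableSet (s.indicator f ⁻¹' u) := by
      intro u h0
      refine (hs.mono ?_).measurableSet
      intro x hx
      by_contra hxs
      simp only [Set.mem_preimage, Set.indicator_of_notMem hxs] at hx
      exact h0 hx
    by_cases h0 : (0:ℝ) ∈ t
    · have := (key tᶜ (by simpa using h0)).compl
      simpa using this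
    · exact key t h0
  · filter_upwards [hμ] with x hx
    simp [hx]

theorem ae_mem_support (p : PMF (Fin m → ℝ)) : ∀ᵐ x ∂p.toMeasure, x ∈ p.support := by
  rw [ae_iff]
  have h : MeasurableSet {a | a ∉ p.support} := (p.support_countable.measurableSet).compl
  rw [PMF.toMeasure_apply_eq_zero_iff _ h]
  exact Set.disjoint_left.2 fun x hx hx' => hx' hx

theorem pmf_aestronglyMeasurable (p : PMF (Fin m → ℝ)) (g : (Fin m → ℝ) → ℝ) :
    AEStronglyMeasurable g p.toMeasure :=
  aestronglyMeasurable_of_countable p.support_countable (ae_mem_support p) g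

instance law_isProbabilityMeasure (D : Fin n → PMF (Fin m → ℝ)) :
    IsProbabilityMeasure (law D) := by
  unfold law; infer_instance

instance sampleLaw_isProbabilityMeasure (N : ℕ) (D : Fin n → PMF (Fin m → ℝ)) :
    IsProbabilityMeasure (sampleLaw N D) := by
  unfold sampleLaw; infer_instance

theorem ae_inSupport (D : Fin n → PMF (Fin m → ℝ)) : ∀ᵐ P ∂(law D), InSupport D P := by
  have h : ∀ j, ∀ᵐ P ∂(law D), P j ∈ (D j).support := fun j =>
    (Measure.tendsto_eval_ae_ae (μ := fun j => (D j).toMeasure) (i := j)).eventually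
      (ae_mem_support (D j))
  filter_upwards [ae_all_iff.2 h] with P hP
  exact hP

theorem ae_sample_inSupport (N : ℕ) (D : Fin n → PMF (Fin m → ℝ)) :
    ∀ᵐ S ∂(sampleLaw N D), ∀ s, InSupport D (S s) := by
  refine ae_all_iff.2 fun s => ?_
  exact (Measure.tendsto_eval_ae_ae (μ := fun _ : Fin N => law D) (i := s)).eventually
      (ae_inSupport D)

theorem countable_inSupport (D : Fin n → PMF (Fin m → ℝ)) :
    {P : Instance m n | InSupport D P}.Countable := by
  have := Set.countable_univ_pi (s := fun j => (D j).support) fun j => (D j).support_countable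
  refine this.mono ?_
  intro P hP j _
  exact hP j

theorem law_aestronglyMeasurable (D : Fin n → PMF (Fin m → ℝ)) (g : Instance m n → ℝ) :
    AEStronglyMeasurable g (law D) :=
  aestronglyMeasurable_of_countable (countable_inSupport D) (ae_inSupport D) g

theorem exists_inSupport (D : Fin n → PMF (Fin m → ℝ)) : ∃ P, InSupport D P :=
  (ae_inSupport D).exists

theorem integrable_law_of_bound {D : Fin n → PMF (Fin m → ℝ)} {g : Instance m n → ℝ} (C : ℝ)
    (h : ∀ P, InSupport D P → |g P| ≤ C) : Integrable g (law D) := by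
  refine Integrable.of_bound (law_aestronglyMeasurable D g) C ?_
  filter_upwards [ae_inSupport D] with P hP
  exact h P hP

theorem integrable_pmf_of_bound {p : PMF (Fin m → ℝ)} {g : (Fin m → ℝ) → ℝ} (C : ℝ)
    (h : ∀ x ∈ p.support, |g x| ≤ C) : Integrable g p.toMeasure := by
  refine Integrable.of_bound (pmf_aestronglyMeasurable p g) C ?_
  filter_upwards [ae_mem_support p] with P hP
  exact h P hP

theorem integral_law_mono {D : Fin n → PMF (Fin m → ℝ)} {g h : Instance m n → ℝ}
    (hg : Integrable g (law D)) (hh : Integrable h (law D))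
    (hle : ∀ P, InSupport D P → g P ≤ h P) : ∫ P, g P ∂(law D) ≤ ∫ P, h P ∂(law D) :=
  integral_mono_ae hg hh (by filter_upwards [ae_inSupport D] with P hP using hle P hP)

/-! ### Expected column sums -/

/-- The expectation of `∑ j, g (P j)` for `P` drawn from the law of `D`. -/
noncomputable def colMean (D : Fin n → PMF (Fin m → ℝ)) (g : (Fin m → ℝ) → ℝ) : ℝ :=
  ∑ j, ∫ p, g p ∂(D j).toMeasure

/-- `g` takes values in `[0, b]` on all columns that can occur. -/
def ColBounded (D : Fin n → PMF (Fin m → ℝ)) (g : (Fin m → ℝ) → ℝ) (b : ℝ) : Prop :=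
  ∀ j, ∀ p ∈ (D j).support, 0 ≤ g p ∧ g p ≤ b

theorem ColBounded.integrable {D : Fin n → PMF (Fin m → ℝ)} {g : (Fin m → ℝ) → ℝ} {b : ℝ}
    (h : ColBounded D g b) (j : Fin n) : Integrable g (D j).toMeasure :=
  integrable_pmf_of_bound b fun x hx => by
    rw [abs_of_nonneg (h j x hx).1]; exact (h j x hx).2

theorem colMean_congr {D : Fin n → PMF (Fin m → ℝ)} {g h : (Fin m → ℝ) → ℝ}
    (hle : ∀ j, ∀ p ∈ (D j).support, g p = h p) : colMean D g = colMean D h :=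
  Finset.sum_congr rfl fun j _ => integral_congr_ae
    (by filter_upwards [ae_mem_support (D j)] with p hp using hle j p hp)

theorem ColBounded.colMean_nonneg {D : Fin n → PMF (Fin m → ℝ)} {g : (Fin m → ℝ) → ℝ} {b : ℝ}
    (h : ColBounded D g b) : 0 ≤ colMean D g :=
  Finset.sum_nonneg fun j _ => integral_nonneg_of_ae
    (by filter_upwards [ae_mem_support (D j)] with p hp using (h j p hp).1)

theorem colMean_const_mul (D : Fin n → PMF (Fin m → ℝ)) (g : (Fin m → ℝ) → ℝ) (c : ℝ) :
    colMean D (fun p => c * g p) = c * colMean D g := by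
  simp only [colMean, integral_const_mul, Finset.mul_sum]

theorem measurePreserving_column (D : Fin n → PMF (Fin m → ℝ)) (j : Fin n) :
    MeasurePreserving (fun P : Instance m n => P j) (law D) (D j).toMeasure :=
  measurePreserving_eval (fun j => (D j).toMeasure) j

theorem integrable_colSum {D : Fin n → PMF (Fin m → ℝ)} {g : (Fin m → ℝ) → ℝ}
    (hg : ∀ j, Integrable g (D j).toMeasure) :
    Integrable (fun P : Instance m n => ∑ j, g (P j)) (law D) :=
  integrable_finsetSum _ fun j _ => (measurePreserving_column D j).integrable_comp_of_integrable (hg j)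

theorem integral_colSum {D : Fin n → PMF (Fin m → ℝ)} {g : (Fin m → ℝ) → ℝ}
    (hg : ∀ j, Integrable g (D j).toMeasure) :
    ∫ P, ∑ j, g (P j) ∂(law D) = colMean D g := by
  have hi : ∀ j ∈ Finset.univ, Integrable (fun P : Instance m n => g (P j)) (law D) := fun j _ =>
    (measurePreserving_column D j).integrable_comp_of_integrable (hg j)
  rw [integral_finsetSum _ hi]
  refine Finset.sum_congr rfl fun j _ => ?_
  rw [← (measurePreserving_column D j).map_eq, integral_map]
  · exact (measurePreserving_column D j).measurable.aemeasurable
  · rw [(measurePreserving_column D j).map_eq]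
    exact (hg j).aestronglyMeasurable

/-! ### Exponential moments -/

theorem exp_le_one_add_add_sq {x : ℝ} (hx : |x| ≤ 1) : Real.exp x ≤ 1 + x + x ^ 2 := by
  have := (abs_le.1 (Real.abs_exp_sub_one_sub_id_le hx)).2
  linarith

theorem integral_exp_colSum (D : Fin n → PMF (Fin m → ℝ)) (g : (Fin m → ℝ) → ℝ) (t : ℝ) :
    ∫ P, Real.exp (t * ∑ j, g (P j)) ∂(law D)
      = ∏ j, ∫ p, Real.exp (t * g p) ∂(D j).toMeasure := by
  have h := integral_fintype_prod_eq_prod (𝕜 := ℝ) (μ := fun j => (D j).toMeasure)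
    (fun (_ : Fin n) (p : Fin m → ℝ) => Real.exp (t * g p))
  rw [← h, law]
  congr 1
  ext P
  rw [Finset.mul_sum, Real.exp_sum]

/-- For values in `[0, b]` one has `g² ≤ b g`, so the quadratic term of the exponential is
controlled by the mean itself and no dependence on `n` enters. -/
theorem ColBounded.integral_exp_le {D : Fin n → PMF (Fin m → ℝ)} {g : (Fin m → ℝ) → ℝ} {b : ℝ}
    (h : ColBounded D g b) {t : ℝ} (ht : |t| * b ≤ 1) :
    ∫ P, Real.exp (t * ∑ j, g (P j)) ∂(law D)
      ≤ Real.exp (t * colMean D g + t ^ 2 * b * colMean D g) := by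
  rw [integral_exp_colSum]
  have h1 : ∀ j, ∫ p, Real.exp (t * g p) ∂(D j).toMeasure
      ≤ Real.exp ((t + t ^ 2 * b) * ∫ p, g p ∂(D j).toMeasure) := by
    intro j
    have hi := h.integrable j
    have habs : ∀ p ∈ (D j).support, |t * g p| ≤ 1 := by
      intro p hp
      obtain ⟨h0, hb⟩ := h j p hp
      rw [abs_mul, abs_of_nonneg h0]
      exact (mul_le_mul_of_nonneg_left hb (abs_nonneg t)).trans ht
    have h2 : ∫ p, Real.exp (t * g p) ∂(D j).toMeasure
        ≤ ∫ p, (1 + (t + t ^ 2 * b) * g p) ∂(D j).toMeasure := by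
      refine integral_mono_ae ?_ ((integrable_const _).add (hi.const_mul _)) ?_
      · refine integrable_pmf_of_bound (Real.exp 1) fun p hp => ?_
        rw [abs_of_pos (Real.exp_pos _)]
        exact Real.exp_le_exp.2 ((le_abs_self _).trans (habs p hp))
      · filter_upwards [ae_mem_support (D j)] with p hp
        obtain ⟨h0, hb⟩ := h j p hp
        have h3 := exp_le_one_add_add_sq (habs p hp)
        have h4 : (t * g p) ^ 2 ≤ t ^ 2 * b * g p := by
          have : g p * g p ≤ b * g p := mul_le_mul_of_nonneg_right hb h0
          nlinarith [mul_le_mul_of_nonneg_left this (sq_nonneg t)]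
        linarith
    rw [integral_add (integrable_const _) (hi.const_mul _), integral_const_mul] at h2
    simp only [integral_const, probReal_univ, smul_eq_mul, one_mul] at h2
    refine h2.trans ?_
    rw [add_comm]
    exact Real.add_one_le_exp _
  calc _ ≤ ∏ j, Real.exp ((t + t ^ 2 * b) * ∫ p, g p ∂(D j).toMeasure) :=
        Finset.prod_le_prod (fun j _ => integral_nonneg fun p => (Real.exp_pos _).le)
          fun j _ => h1 j
    _ = _ := by
        rw [← Real.exp_sum, ← Finset.mul_sum]
        congr 1
        rw [colMean]; ring

theorem ColBounded.colSum_bounds {D : Fin n → PMF (Fin m → ℝ)} {g : (Fin m → ℝ) → ℝ} {b : ℝ}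
    (h : ColBounded D g b) {P : Instance m n} (hP : InSupport D P) :
    0 ≤ ∑ j, g (P j) ∧ ∑ j, g (P j) ≤ n * b := by
  refine ⟨Finset.sum_nonneg fun j _ => (h j _ (hP j)).1, ?_⟩
  refine (Finset.sum_le_sum fun j _ => (h j _ (hP j)).2).trans ?_
  simp

theorem ColBounded.integrable_exp {D : Fin n → PMF (Fin m → ℝ)} {g : (Fin m → ℝ) → ℝ} {b : ℝ}
    (h : ColBounded D g b) (t c : ℝ) :
    Integrable (fun P : Instance m n => Real.exp (t * ∑ j, g (P j) + c)) (law D) := by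
  refine integrable_law_of_bound (Real.exp (|t| * (n * b) + c)) fun P hP => ?_
  rw [abs_of_pos (Real.exp_pos _)]
  obtain ⟨h0, hb⟩ := h.colSum_bounds hP
  refine Real.exp_le_exp.2 (add_le_add_left ?_ c)
  calc t * ∑ j, g (P j) ≤ |t| * ∑ j, g (P j) := mul_le_mul_of_nonneg_right (le_abs_self t) h0
    _ ≤ _ := mul_le_mul_of_nonneg_left hb (abs_nonneg t)

/-- Lower deviations of a column sum. -/
theorem ColBounded.integral_exp_lower {D : Fin n → PMF (Fin m → ℝ)} {g : (Fin m → ℝ) → ℝ}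
    {b A t : ℝ} (h : ColBounded D g b) (ht : 0 ≤ t) (htb : t * b ≤ 1) (hA : A ≤ colMean D g) :
    ∫ P, Real.exp (t * (A - ∑ j, g (P j))) ∂(law D) ≤ Real.exp (t ^ 2 * b * A) := by
  have h1 := h.integral_exp_le (t := -t) (by rwa [abs_neg, abs_of_nonneg ht])
  have h2 : ∀ P : Instance m n, Real.exp (t * (A - ∑ j, g (P j)))
      = Real.exp (t * A) * Real.exp (-t * ∑ j, g (P j)) := by
    intro P; rw [← Real.exp_add]; congr 1; ring
  simp only [h2]
  rw [integral_const_mul]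
  calc _ ≤ Real.exp (t * A) * Real.exp (-t * colMean D g + (-t) ^ 2 * b * colMean D g) :=
        mul_le_mul_of_nonneg_left h1 (Real.exp_pos _).le
    -- Written this way, the surplus of the mean over `A` only helps, so a mere lower bound on the
    -- mean suffices.
    _ = Real.exp (t ^ 2 * b * A - t * (1 - t * b) * (colMean D g - A)) := by
        rw [← Real.exp_add]; congr 1; ring
    _ ≤ _ := by
        refine Real.exp_le_exp.2 (sub_le_self _ ?_)
        exact mul_nonneg (mul_nonneg ht (by linarith)) (by linarith)

/-- Upper deviations of a column sum. -/
theorem ColBounded.integral_exp_upper {D : Fin n → PMF (Fin m → ℝ)} {g : (Fin m → ℝ) → ℝ}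
    {b A t : ℝ} (h : ColBounded D g b) (hb : 0 ≤ b) (ht : 0 ≤ t) (htb : t * b ≤ 1)
    (hA : colMean D g ≤ A) :
    ∫ P, Real.exp (t * (∑ j, g (P j) - A)) ∂(law D) ≤ Real.exp (t ^ 2 * b * A) := by
  have h1 := h.integral_exp_le (t := t) (by rwa [abs_of_nonneg ht])
  have h2 : ∀ P : Instance m n, Real.exp (t * (∑ j, g (P j) - A))
      = Real.exp (-t * A) * Real.exp (t * ∑ j, g (P j)) := by
    intro P; rw [← Real.exp_add]; congr 1; ring
  simp only [h2]
  rw [integral_const_mul]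
  calc _ ≤ Real.exp (-t * A) * Real.exp (t * colMean D g + t ^ 2 * b * colMean D g) :=
        mul_le_mul_of_nonneg_left h1 (Real.exp_pos _).le
    _ = Real.exp (t ^ 2 * b * A - t * (1 + t * b) * (A - colMean D g)) := by
        rw [← Real.exp_add]; congr 1; ring
    _ ≤ _ := by
        refine Real.exp_le_exp.2 (sub_le_self _ ?_)
        exact mul_nonneg (mul_nonneg ht (by positivity)) (by linarith)

/-! ### Tail bounds for independent samples -/

/-- The sum of `g` over all columns of all sampled instances. -/
def total {N : ℕ} (S : Fin N → Instance m n) (g : (Fin m → ℝ) → ℝ) : ℝ :=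
  ∑ s, ∑ j, g (S s j)

theorem integral_exp_sampleSum (N : ℕ) (D : Fin n → PMF (Fin m → ℝ)) (G : Instance m n → ℝ) :
    ∫ S, Real.exp (∑ s, G (S s)) ∂(sampleLaw N D) = (∫ P, Real.exp (G P) ∂(law D)) ^ N := by
  have h := integral_fintype_prod_eq_prod (𝕜 := ℝ) (μ := fun _ : Fin N => law D)
    (fun (_ : Fin N) (P : Instance m n) => Real.exp (G P))
  simp only [Finset.prod_const, Finset.card_univ, Fintype.card_fin] at h
  rw [← h, sampleLaw]
  congr 1
  ext S
  rw [Real.exp_sum]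

theorem countable_sample_inSupport (N : ℕ) (D : Fin n → PMF (Fin m → ℝ)) :
    {S : Fin N → Instance m n | ∀ s, InSupport D (S s)}.Countable := by
  have := Set.countable_univ_pi (s := fun _ : Fin N => {P : Instance m n | InSupport D P})
    fun _ => countable_inSupport D
  refine this.mono ?_
  intro P hP j _
  exact hP j

/-- Markov's inequality for exponentials of sums over the samples. -/
theorem measure_sampleSum_nonneg_le {N : ℕ} {D : Fin n → PMF (Fin m → ℝ)}
    {G : Instance m n → ℝ} {C r : ℝ} (hC : ∀ P, InSupport D P → G P ≤ C)
    (hr : ∫ P, Real.exp (G P) ∂(law D) ≤ Real.exp r) :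
    (sampleLaw N D).real {S | 0 ≤ ∑ s, G (S s)} ≤ Real.exp (N * r) := by
  have hint : Integrable (fun S : Fin N → Instance m n => Real.exp (∑ s, G (S s)))
      (sampleLaw N D) := by
    refine Integrable.of_bound (aestronglyMeasurable_of_countable
      (countable_sample_inSupport N D) (ae_sample_inSupport N D) _) (Real.exp (N * C)) ?_
    filter_upwards [ae_sample_inSupport N D] with S hS
    rw [Real.norm_eq_abs, abs_of_pos (Real.exp_pos _)]
    refine Real.exp_le_exp.2 ((Finset.sum_le_sum fun s _ => hC _ (hS s)).trans ?_)
    simp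
  have h1 := mul_meas_ge_le_integral_of_nonneg (μ := sampleLaw N D)
    (f := fun S : Fin N → Instance m n => Real.exp (∑ s, G (S s)))
    (Filter.Eventually.of_forall fun S => (Real.exp_pos _).le) hint 1
  rw [one_mul, integral_exp_sampleSum] at h1
  have h2 : {S : Fin N → Instance m n | 0 ≤ ∑ s, G (S s)}
      = {S | 1 ≤ Real.exp (∑ s, G (S s))} := by
    ext S; simp [Real.one_le_exp_iff]
  rw [h2]
  refine h1.trans ?_
  calc _ ≤ (Real.exp r) ^ N := pow_le_pow_left₀ (integral_nonneg fun P => (Real.exp_pos _).le) hr N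
    _ = _ := by rw [← Real.exp_nat_mul]

theorem total_const_sub {N : ℕ} (S : Fin N → Instance m n) (g : (Fin m → ℝ) → ℝ) (t a : ℝ) :
    ∑ s, t * (a - ∑ j, g (S s j)) = t * (N * a - total S g) := by
  rw [← Finset.mul_sum, Finset.sum_sub_distrib]
  simp [total]

/-- Tilt by `t = τ ζ / V`, for which `t` times the item bound is exactly `τ`. A deviation of `2 τ V`
per sample gains `2 τ² ζ` in the exponent, and the exponential moment gives back at most half. The
scale `V` is separate from the mean, which may be much smaller. -/
theorem ColBounded.total_lower_tail {N : ℕ} {D : Fin n → PMF (Fin m → ℝ)}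
    {g : (Fin m → ℝ) → ℝ} {A V ζ τ : ℝ} (hζ : 0 < ζ) (hV : 0 < V)
    (h : ColBounded D g (V / ζ)) (hτ : 0 < τ) (hτ1 : τ ≤ 1) (hA : A ≤ colMean D g) (hAV : A ≤ V) :
    (sampleLaw N D).real {S | total S g ≤ N * (A - 2 * τ * V)} ≤ Real.exp (-(N * (τ ^ 2 * ζ))) := by
  set t := τ * ζ / V with ht
  have htpos : 0 < t := by positivity
  have htb : t * (V / ζ) = τ := by rw [ht]; field_simp
  have htV : t * V = τ * ζ := by rw [ht]; field_simp
  have key : ∫ P, Real.exp (t * (A - 2 * τ * V - ∑ j, g (P j))) ∂(law D)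
      ≤ Real.exp (-(τ ^ 2 * ζ)) := by
    have h1 := h.integral_exp_lower htpos.le (by rw [htb]; exact hτ1) hA
    have h2 : ∀ P : Instance m n, Real.exp (t * (A - 2 * τ * V - ∑ j, g (P j)))
        = Real.exp (-2 * τ ^ 2 * ζ) * Real.exp (t * (A - ∑ j, g (P j))) := by
      intro P; rw [← Real.exp_add]; congr 1; linear_combination (-2 * τ) * htV
    simp only [h2]
    rw [integral_const_mul]
    refine (mul_le_mul_of_nonneg_left h1 (Real.exp_pos _).le).trans ?_
    rw [← Real.exp_add]
    refine Real.exp_le_exp.2 ?_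
    have h3 : t ^ 2 * (V / ζ) * A ≤ τ ^ 2 * ζ := by
      calc t ^ 2 * (V / ζ) * A = t * τ * A := by rw [← htb]; ring
        _ ≤ t * τ * V := mul_le_mul_of_nonneg_left hAV (by positivity)
        _ = τ * (t * V) := by ring
        _ = _ := by rw [htV]; ring
    linarith
  have := measure_sampleSum_nonneg_le (N := N) (C := t * (A - 2 * τ * V)) (fun P hP => ?_) key
  · simp only [total_const_sub] at this
    rw [mul_neg] at this
    convert this using 3
    ext S
    rw [mul_nonneg_iff_of_pos_left htpos, sub_nonneg]
  · have := (h.colSum_bounds hP).1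
    exact mul_le_mul_of_nonneg_left (by linarith) htpos.le

theorem ColBounded.total_upper_tail {N : ℕ} {D : Fin n → PMF (Fin m → ℝ)}
    {g : (Fin m → ℝ) → ℝ} {A V ζ τ : ℝ} (hζ : 0 < ζ) (hV : 0 < V)
    (h : ColBounded D g (V / ζ)) (hτ : 0 < τ) (hτ1 : τ ≤ 1) (hA : colMean D g ≤ A) (hAV : A ≤ V) :
    (sampleLaw N D).real {S | N * (A + 2 * τ * V) ≤ total S g} ≤ Real.exp (-(N * (τ ^ 2 * ζ))) := by
  set t := τ * ζ / V with ht
  have htpos : 0 < t := by positivity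
  have htb : t * (V / ζ) = τ := by rw [ht]; field_simp
  have htV : t * V = τ * ζ := by rw [ht]; field_simp
  have key : ∫ P, Real.exp (-t * (A + 2 * τ * V - ∑ j, g (P j))) ∂(law D)
      ≤ Real.exp (-(τ ^ 2 * ζ)) := by
    have h1 := h.integral_exp_upper (by positivity) htpos.le (by rw [htb]; exact hτ1) hA
    have h2 : ∀ P : Instance m n, Real.exp (-t * (A + 2 * τ * V - ∑ j, g (P j)))
        = Real.exp (-2 * τ ^ 2 * ζ) * Real.exp (t * (∑ j, g (P j) - A)) := by
      intro P; rw [← Real.exp_add]; congr 1; linear_combination (-2 * τ) * htV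
    simp only [h2]
    rw [integral_const_mul]
    refine (mul_le_mul_of_nonneg_left h1 (Real.exp_pos _).le).trans ?_
    rw [← Real.exp_add]
    refine Real.exp_le_exp.2 ?_
    have h3 : t ^ 2 * (V / ζ) * A ≤ τ ^ 2 * ζ := by
      calc t ^ 2 * (V / ζ) * A = t * τ * A := by rw [← htb]; ring
        _ ≤ t * τ * V := mul_le_mul_of_nonneg_left hAV (by positivity)
        _ = τ * (t * V) := by ring
        _ = _ := by rw [htV]; ring
    linarith
  have := measure_sampleSum_nonneg_le (N := N) (C := t * (n * (V / ζ) - (A + 2 * τ * V)))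
    (fun P hP => ?_) key
  · simp only [total_const_sub] at this
    rw [mul_neg] at this
    convert this using 3
    ext S
    rw [neg_mul, ← mul_neg, mul_nonneg_iff_of_pos_left htpos, neg_sub, sub_nonneg]
  · have := (h.colSum_bounds hP).2
    nlinarith [mul_le_mul_of_nonneg_left this htpos.le]

/-! ### Power sums as potential functions -/

/-- The `ℓ_β` (quasi-)norm of a positive vector, for `β ≠ 0`. -/
noncomputable def pot (β : ℝ) (z : Fin m → ℝ) : ℝ := (∑ i, z i ^ β) ^ (1 / β)

theorem sum_rpow_pos {z : Fin m → ℝ} (hz : ∀ i, 0 < z i) (β : ℝ) (i : Fin m) :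
    0 < ∑ k, z k ^ β :=
  Finset.sum_pos (fun k _ => Real.rpow_pos_of_pos (hz k) β) ⟨i, Finset.mem_univ i⟩

theorem pot_nonneg {z : Fin m → ℝ} (hz : ∀ i, 0 < z i) (β : ℝ) : 0 ≤ pot β z :=
  Real.rpow_nonneg (Finset.sum_nonneg fun k _ => (Real.rpow_pos_of_pos (hz k) β).le) _

theorem rpow_rpow_one_div {x β : ℝ} (hx : 0 < x) (hβ : β ≠ 0) : (x ^ β) ^ (1 / β) = x := by
  rw [← Real.rpow_mul hx.le, mul_one_div_cancel hβ, Real.rpow_one]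

/-- Positive exponents overestimate the maximum and negative ones underestimate the minimum: the
directions in which weak duality survives smoothing. -/
theorem le_pot {z : Fin m → ℝ} (hz : ∀ i, 0 < z i) {β : ℝ} (hβ : 0 < β) (i : Fin m) :
    z i ≤ pot β z := by
  rw [← rpow_rpow_one_div (hz i) hβ.ne', pot]
  refine Real.rpow_le_rpow (Real.rpow_pos_of_pos (hz i) _).le ?_ (by positivity)
  exact Finset.single_le_sum (f := fun k => z k ^ β)
    (fun k _ => (Real.rpow_pos_of_pos (hz k) β).le) (Finset.mem_univ i)

theorem pot_le_of_neg {z : Fin m → ℝ} (hz : ∀ i, 0 < z i) {β : ℝ} (hβ : β < 0) (i : Fin m) :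
    pot β z ≤ z i := by
  rw [← rpow_rpow_one_div (hz i) hβ.ne, pot]
  refine Real.rpow_le_rpow_of_nonpos (Real.rpow_pos_of_pos (hz i) _) ?_
    (one_div_nonpos.2 hβ.le)
  exact Finset.single_le_sum (f := fun k => z k ^ β)
    (fun k _ => (Real.rpow_pos_of_pos (hz k) β).le) (Finset.mem_univ i)

/-- Factor `x ^ β = x * x ^ (β - 1)` and bound each coordinate in the second factor by the sum. This
crude bound serves for integrability and for the potential at the origin of the price grid. -/
theorem pot_le_sum {z : Fin m → ℝ} (hz : ∀ i, 0 < z i) {β : ℝ} (hβ : 1 ≤ β) :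
    pot β z ≤ ∑ i, z i := by
  have hs : 0 ≤ ∑ i, z i := Finset.sum_nonneg fun i _ => (hz i).le
  rcases hs.eq_or_lt with h0 | hs
  · have : ∀ i : Fin m, False := fun i => by
      have := Finset.single_le_sum (f := z) (fun k _ => (hz k).le) (Finset.mem_univ i)
      linarith [hz i]
    have : IsEmpty (Fin m) := ⟨this⟩
    simp [pot, (by linarith : β ≠ 0)]
  · rw [← rpow_rpow_one_div hs (by linarith : β ≠ 0), pot]
    refine Real.rpow_le_rpow (Finset.sum_nonneg fun k _ => (Real.rpow_pos_of_pos (hz k) β).le) ?_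
      (by positivity)
    have h1 : ∀ x : ℝ, 0 < x → x ^ β = x * x ^ (β - 1) := fun x hx => by
      rw [Real.rpow_sub_one hx.ne']; field_simp
    rw [h1 _ hs, Finset.sum_mul]
    refine Finset.sum_le_sum fun i _ => ?_
    rw [h1 _ (hz i)]
    refine mul_le_mul_of_nonneg_left (Real.rpow_le_rpow (hz i).le ?_ (by linarith)) (hz i).le
    exact Finset.single_le_sum (f := z) (fun k _ => (hz k).le) (Finset.mem_univ i)

/-- Power mean inequality for adjacent exponents. -/
theorem sum_rpow_rpow_le {u : Fin m → ℝ} (hu : ∀ i, 0 < u i) {γ : ℝ} (hγ : 0 < γ) :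
    (∑ i, u i ^ γ) ^ ((γ + 1) / γ) ≤ (m : ℝ) ^ (1 / γ) * ∑ i, u i ^ (γ + 1) := by
  have hp : 1 ≤ (γ + 1) / γ := by rw [le_div_iff₀ hγ]; linarith
  have h := Real.rpow_sum_le_const_mul_sum_rpow_of_nonneg (Finset.univ : Finset (Fin m))
    (f := fun i => u i ^ γ) hp (fun i _ => (Real.rpow_pos_of_pos (hu i) γ).le)
  have h1 : (γ + 1) / γ - 1 = 1 / γ := by field_simp; ring
  rw [h1] at h
  simp only [Finset.card_univ, Fintype.card_fin] at h
  refine h.trans (le_of_eq ?_)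
  congr 1
  refine Finset.sum_congr rfl fun i _ => ?_
  rw [← Real.rpow_mul (hu i).le]
  congr 1; field_simp

theorem sum_update_rpow {z : Fin m → ℝ} (hz : ∀ i, 0 < z i) (i : Fin m) {θ : ℝ} (hθ : 0 < θ)
    (β : ℝ) : ∑ k, Function.update z i (θ * z i) k ^ β
      = (∑ k, z k ^ β) * (1 + z i ^ β * (θ ^ β - 1) / ∑ k, z k ^ β) := by
  have hS := sum_rpow_pos hz β i
  rw [mul_add, mul_one, mul_div_cancel₀ _ hS.ne',
    ← Finset.add_sum_erase _ _ (Finset.mem_univ i), ← Finset.add_sum_erase _ (fun k => z k ^ β) (Finset.mem_univ i)]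
  rw [Function.update_self, Real.mul_rpow hθ.le (hz i).le]
  have : ∑ x ∈ Finset.univ.erase i, Function.update z i (θ * z i) x ^ β
      = ∑ x ∈ Finset.univ.erase i, z x ^ β := by
    refine Finset.sum_congr rfl fun k hk => ?_
    rw [Function.update_of_ne (Finset.ne_of_mem_erase hk)]
  rw [this]; ring

/-- Raising one coordinate by a factor `1 + η` raises the `ℓ_{γ+1}` norm by about
`η z_i x_i`, where `x` is the proportional allocation with exponent `γ`. -/
theorem pot_update_sub_le {z : Fin m → ℝ} (hz : ∀ i, 0 < z i) {γ η e ρ : ℝ} (hγ : 0 < γ)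
    (hη : 0 < η) (he : (γ + 1) * η ≤ e) (he1 : e ≤ 1) (hρ : (m : ℝ) ^ (1 / (γ + 1)) ≤ ρ)
    (i : Fin m) :
    pot (γ + 1) (Function.update z i ((1 + η) * z i)) - pot (γ + 1) z
      ≤ η * (1 + e) * ρ * (z i * (z i ^ γ / ∑ k, z k ^ γ)) := by
  set β := γ + 1 with hβ
  have hβ0 : 0 < β := by linarith
  have hS := sum_rpow_pos hz β i
  have hT := sum_rpow_pos hz γ i
  set S := ∑ k, z k ^ β with hSdef
  set T := ∑ k, z k ^ γ with hTdef
  have hzi := Real.rpow_pos_of_pos (hz i) β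
  have hg1 : 0 ≤ (1 + η) ^ β - 1 := by
    have := Real.one_le_rpow (by linarith : (1:ℝ) ≤ 1 + η) hβ0.le
    linarith
  -- A finite step replaces the derivative; `β η ≤ e ≤ 1` keeps the second-order term within a
  -- factor `1 + e`.
  have hg2 : (1 + η) ^ β - 1 ≤ β * (η * (1 + e)) := by
    have h1 : (1 + η) ^ β ≤ Real.exp (β * η) := by
      rw [mul_comm, Real.exp_mul]
      exact Real.rpow_le_rpow (by linarith) (by linarith [Real.add_one_le_exp η]) hβ0.le
    have h2 : Real.exp (β * η) ≤ 1 + β * η + (β * η) ^ 2 :=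
      exp_le_one_add_add_sq (by rw [abs_of_pos (by positivity)]; linarith)
    nlinarith [mul_le_mul_of_nonneg_left he (by positivity : 0 ≤ β * η)]
  set x := z i ^ β * ((1 + η) ^ β - 1) / S with hx
  have hx0 : 0 ≤ x := by positivity
  have h1 : pot β (Function.update z i ((1 + η) * z i)) ≤ S ^ (1 / β) * (1 + 1 / β * x) := by
    rw [pot, sum_update_rpow hz i (by linarith), Real.mul_rpow hS.le (by positivity)]
    refine mul_le_mul_of_nonneg_left ?_ (Real.rpow_nonneg hS.le _)
    refine rpow_one_add_le_one_add_mul_self (by linarith) (by positivity) ?_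
    rw [div_le_one hβ0]; linarith
  -- The increment naturally carries `S ^ (-γ / β)`; the power mean inequality trades this for `1 /
  -- T`, the normalization of the shares, at the price `m ^ (1 / β)`.
  have hT2 : T ≤ ρ * S ^ (γ / β) := by
    have h := sum_rpow_rpow_le hz hγ
    have h2 := Real.rpow_le_rpow (Real.rpow_nonneg hT.le _) h (by positivity : 0 ≤ γ / β)
    rw [← Real.rpow_mul hT.le, ← hβ, show β / γ * (γ / β) = 1 by field_simp, Real.rpow_one,
      Real.mul_rpow (by positivity) hS.le, ← Real.rpow_mul (by positivity),
      show 1 / γ * (γ / β) = 1 / β by field_simp] at h2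
    exact h2.trans (mul_le_mul_of_nonneg_right hρ (Real.rpow_nonneg hS.le _))
  have hSS : S ^ (1 / β) * S ^ (γ / β) = S := by
    rw [← Real.rpow_add hS, ← add_div, add_comm, ← hβ, div_self hβ0.ne', Real.rpow_one]
  have hzz : z i ^ β = z i * z i ^ γ := by
    rw [hβ, Real.rpow_add_one (hz i).ne']; ring
  calc _ ≤ S ^ (1 / β) * (1 / β * x) := by
        have : pot β z = S ^ (1 / β) := rfl
        rw [this]; linarith
    _ = S ^ (1 / β) / S * z i ^ β * (((1 + η) ^ β - 1) / β) := by rw [hx]; field_simp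
    _ ≤ S ^ (1 / β) / S * z i ^ β * (η * (1 + e)) := by
        refine mul_le_mul_of_nonneg_left ?_ (by positivity)
        rw [div_le_iff₀ hβ0]; linarith
    _ ≤ ρ / T * z i ^ β * (η * (1 + e)) := by
        have he0 : 0 < e := lt_of_lt_of_le (by positivity) he
        refine mul_le_mul_of_nonneg_right (mul_le_mul_of_nonneg_right ?_ hzi.le) (by positivity)
        rw [div_le_div_iff₀ hS hT]
        calc S ^ (1 / β) * T ≤ S ^ (1 / β) * (ρ * S ^ (γ / β)) :=
              mul_le_mul_of_nonneg_left hT2 (Real.rpow_nonneg hS.le _)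
          _ = ρ * S := by rw [mul_left_comm, hSS]
    _ = _ := by rw [hzz]; ring

/-- The analogue of `pot_update_sub_le` for negative exponents. -/
theorem le_pot_update_sub {z : Fin m → ℝ} (hz : ∀ i, 0 < z i) {γ η e ρ : ℝ} (hγ1 : 1 ≤ γ)
    (hη : 0 < η) (he : γ * η ≤ e) (hρ : (m : ℝ) ^ (1 / γ) ≤ ρ) (i : Fin m) :
    η * (z i * (z i ^ (-γ - 1) / ∑ k, z k ^ (-γ - 1))) ≤
      (1 + e) * ρ * (pot (-γ) (Function.update z i ((1 + η) * z i)) - pot (-γ) z) := by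
  have hγ : 0 < γ := by linarith
  have hS := sum_rpow_pos hz (-γ) i
  have hT := sum_rpow_pos hz (-γ - 1) i
  set S := ∑ k, z k ^ (-γ) with hSdef
  set T := ∑ k, z k ^ (-γ - 1) with hTdef
  have hzi := Real.rpow_pos_of_pos (hz i) (-γ)
  have he0 : 0 < e := lt_of_lt_of_le (by positivity) he
  have hmpos : 0 < (m : ℝ) := by exact_mod_cast i.pos
  have hρ0 : 0 < ρ := lt_of_lt_of_le (Real.rpow_pos_of_pos hmpos _) hρ
  set g := (1 + η) ^ (-γ) with hg
  have hgpos : 0 < g := Real.rpow_pos_of_pos (by linarith) _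
  have hg1 : γ * η / (1 + e) ≤ 1 - g := by
    have h1 : 1 + γ * η ≤ (1 + η) ^ γ := one_add_mul_self_le_rpow_one_add (by linarith) hγ1
    have h2 : g ≤ (1 + γ * η)⁻¹ := by
      rw [hg, Real.rpow_neg (by linarith)]
      exact inv_anti₀ (by positivity) h1
    have h3 : γ * η / (1 + e) ≤ γ * η / (1 + γ * η) := by gcongr
    have h4 : γ * η / (1 + γ * η) = 1 - (1 + γ * η)⁻¹ := by
      have : 1 + γ * η ≠ 0 := by positivity
      field_simp; ring
    linarith
  set x := z i ^ (-γ) * (1 - g) / S with hx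
  have hg2 : g ≤ 1 := by
    have : 0 ≤ γ * η / (1 + e) := by positivity
    linarith
  have hx0 : 0 ≤ x := by have : 0 ≤ 1 - g := by linarith
                         positivity
  have hx1 : x < 1 := by
    rw [hx, div_lt_one hS]
    have : z i ^ (-γ) ≤ S := Finset.single_le_sum (f := fun k => z k ^ (-γ))
      (fun k _ => (Real.rpow_pos_of_pos (hz k) _).le) (Finset.mem_univ i)
    nlinarith
  -- Bernoulli bounds `(1 - x) ^ (1 / γ)` by `1 - x / γ`, and `(1 + u) (1 - u) ≤ 1` inverts the
  -- estimate.
  have hb : 1 + 1 / γ * x ≤ (1 - x) ^ (1 / (-γ)) := by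
    have h1 := rpow_one_add_le_one_add_mul_self (s := -x) (by linarith) (p := 1 / γ)
      (by positivity) (by rw [div_le_one hγ]; exact hγ1)
    rw [← sub_eq_add_neg] at h1
    have h2 : 0 < (1 - x) ^ (1 / γ) := Real.rpow_pos_of_pos (by linarith) _
    rw [div_neg, Real.rpow_neg (by linarith), ← one_div, le_div_iff₀ h2]
    have h3 : 0 ≤ 1 / γ * x := by positivity
    calc (1 + 1 / γ * x) * (1 - x) ^ (1 / γ) ≤ (1 + 1 / γ * x) * (1 + 1 / γ * -x) :=
          mul_le_mul_of_nonneg_left h1 (by linarith)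
      _ ≤ 1 := by nlinarith
  have h1 : S ^ (1 / (-γ)) * (1 + 1 / γ * x) ≤
      pot (-γ) (Function.update z i ((1 + η) * z i)) := by
    rw [pot, sum_update_rpow hz i (by linarith)]
    have h2 : 1 + z i ^ (-γ) * ((1 + η) ^ (-γ) - 1) / ∑ k, z k ^ (-γ) = 1 - x := by
      rw [hx]; ring
    rw [h2, Real.mul_rpow hS.le (by linarith)]
    exact mul_le_mul_of_nonneg_left hb (Real.rpow_nonneg hS.le _)
  have hT2 : S ≤ ρ * T * S ^ (1 / (-γ)) := by
    -- The negative exponents become positive ones for the reciprocals.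
    have h := sum_rpow_rpow_le (u := fun k => (z k)⁻¹) (fun k => inv_pos.2 (hz k)) hγ
    simp only [fun k (c : ℝ) => (Real.rpow_neg_eq_inv_rpow (z k) c).symm] at h
    rw [show -(γ + 1) = -γ - 1 by ring] at h
    have h3 : S ^ ((γ + 1) / γ) * S ^ (1 / (-γ)) = S := by
      rw [← Real.rpow_add hS]
      conv_rhs => rw [← Real.rpow_one S]
      congr 1; field_simp; ring
    calc S = S ^ ((γ + 1) / γ) * S ^ (1 / (-γ)) := h3.symm
      _ ≤ _ := mul_le_mul_of_nonneg_right
        (h.trans (mul_le_mul_of_nonneg_right hρ hT.le)) (Real.rpow_nonneg hS.le _)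
  have hzz : z i * z i ^ (-γ - 1) = z i ^ (-γ) := by
    rw [Real.rpow_sub_one (hz i).ne', mul_div_cancel₀ _ (hz i).ne']
  have hpz : pot (-γ) z = S ^ (1 / (-γ)) := rfl
  have hfin : S ^ (1 / (-γ)) * (1 / γ * x) ≤
      pot (-γ) (Function.update z i ((1 + η) * z i)) - pot (-γ) z := by rw [hpz]; linarith
  calc η * (z i * (z i ^ (-γ - 1) / T)) = η * z i ^ (-γ) / T := by rw [← hzz]; ring
    _ ≤ η * z i ^ (-γ) * (ρ * S ^ (1 / (-γ)) / S) := by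
        rw [div_eq_mul_inv]
        refine mul_le_mul_of_nonneg_left ?_ (by positivity)
        rw [inv_eq_one_div, div_le_div_iff₀ hT hS]
        linarith
    _ = (1 + e) * ρ * (S ^ (1 / (-γ)) * (1 / γ * (z i ^ (-γ) * (γ * η / (1 + e)) / S))) := by
        field_simp
    _ ≤ (1 + e) * ρ * (S ^ (1 / (-γ)) * (1 / γ * x)) := by
        rw [hx]
        have := Real.rpow_nonneg hS.le (1 / (-γ))
        gcongr
    _ ≤ _ := mul_le_mul_of_nonneg_left hfin (by positivity)

/-! ### Proportional shares of single items -/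

/-- The fraction of an item with weight vector `p` that agent `i` receives in the EP-allocation. -/
noncomputable def share (α : ℝ) (w p : Fin m → ℝ) (i : Fin m) : ℝ :=
  p i ^ α * w i / ∑ k, p k ^ α * w k

theorem share_denom_pos {α : ℝ} {w p : Fin m → ℝ} (hw : ∀ i, 0 < w i) (hp : ∀ i, 0 < p i)
    (i : Fin m) : 0 < ∑ k, p k ^ α * w k :=
  Finset.sum_pos (fun k _ => mul_pos (Real.rpow_pos_of_pos (hp k) _) (hw k)) ⟨i, Finset.mem_univ i⟩

theorem share_pos {α : ℝ} {w p : Fin m → ℝ} (hw : ∀ i, 0 < w i) (hp : ∀ i, 0 < p i)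
    (i : Fin m) : 0 < share α w p i :=
  div_pos (mul_pos (Real.rpow_pos_of_pos (hp i) _) (hw i)) (share_denom_pos hw hp i)

theorem sum_share {α : ℝ} {w p : Fin m → ℝ} (hw : ∀ i, 0 < w i) (hp : ∀ i, 0 < p i)
    (hm : 0 < m) : ∑ i, share α w p i = 1 := by
  simp only [share]
  rw [← Finset.sum_div, div_self (share_denom_pos hw hp ⟨0, hm⟩).ne']

theorem share_le_one {α : ℝ} {w p : Fin m → ℝ} (hw : ∀ i, 0 < w i) (hp : ∀ i, 0 < p i)
    (i : Fin m) : share α w p i ≤ 1 := by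
  rw [← sum_share (α := α) hw hp i.pos]
  exact Finset.single_le_sum (f := fun i => share α w p i)
    (fun k _ => (share_pos hw hp k).le) (Finset.mem_univ i)

/-- Scale invariance is what frees the minimization learner from knowing the value `f L`. -/
theorem share_const_mul {α : ℝ} {w p : Fin m → ℝ} {c : ℝ} (hc : c ≠ 0) (i : Fin m) :
    share α (fun k => c * w k) p i = share α w p i := by
  simp only [share]
  have h : ∀ k, p k ^ α * (c * w k) = c * (p k ^ α * w k) := fun k => by ring
  simp only [h, ← Finset.mul_sum]
  rw [mul_div_mul_left _ _ hc]

theorem load_epAllocation (α : ℝ) (w : Fin m → ℝ) (P : Instance m n) (i : Fin m) :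
    load P (epAllocation α w P) i = ∑ j, share α w (P j) i * P j i := rfl

theorem epAllocation_isFeasible {α : ℝ} {w : Fin m → ℝ} {P : Instance m n} (hm : 0 < m)
    (hw : ∀ i, 0 < w i) (hP : ∀ j i, 0 < P j i) : IsFeasible (epAllocation α w P) :=
  ⟨fun j i => ⟨(share_pos hw (hP j) i).le, share_le_one hw (hP j) i⟩,
    fun j => sum_share hw (hP j) hm⟩

/-- All weights of agent `i` that can occur are at most `B i`. -/
def WeightsLE (D : Fin n → PMF (Fin m → ℝ)) (B : Fin m → ℝ) : Prop :=
  ∀ j, ∀ p ∈ (D j).support, ∀ i, p i ≤ B i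

theorem load_bounds {D : Fin n → PMF (Fin m → ℝ)} {B : Fin m → ℝ} (hpos : PositiveWeights D)
    (hB : WeightsLE D B) {P : Instance m n} (hP : InSupport D P) {X : Assignment m n}
    (hX : IsFeasible X) (i : Fin m) : 0 ≤ load P X i ∧ load P X i ≤ n * B i := by
  refine ⟨Finset.sum_nonneg fun j _ => mul_nonneg (hX.1 j i).1 (hpos j _ (hP j) i).le, ?_⟩
  calc load P X i ≤ ∑ _j : Fin n, B i := by
        refine Finset.sum_le_sum fun j _ => ?_
        have h := hpos j _ (hP j) i
        exact (mul_le_of_le_one_left h.le (hX.1 j i).2).trans (hB j _ (hP j) i)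
    _ = _ := by simp

theorem integrable_load {D : Fin n → PMF (Fin m → ℝ)} {B : Fin m → ℝ} (hpos : PositiveWeights D)
    (hB : WeightsLE D B) {X : Instance m n → Assignment m n}
    (hX : ∀ P, InSupport D P → IsFeasible (X P)) (i : Fin m) :
    Integrable (fun P => load P (X P) i) (law D) :=
  integrable_law_of_bound (n * B i) fun P hP => by
    obtain ⟨h0, h1⟩ := load_bounds hpos hB hP (hX P hP) i
    rwa [abs_of_nonneg h0]

theorem colBounded_weight {D : Fin n → PMF (Fin m → ℝ)} {B : Fin m → ℝ} (hpos : PositiveWeights D)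
    (hB : WeightsLE D B) (i : Fin m) : ColBounded D (fun p => p i) (B i) :=
  fun j p hp => ⟨(hpos j p hp i).le, hB j p hp i⟩

theorem colBounded_share {D : Fin n → PMF (Fin m → ℝ)} {B : Fin m → ℝ} (hpos : PositiveWeights D)
    (hB : WeightsLE D B) {α : ℝ} {w : Fin m → ℝ} (hw : ∀ i, 0 < w i) (i : Fin m) :
    ColBounded D (fun p => share α w p i * p i) (B i) := fun j p hp =>
  ⟨mul_nonneg (share_pos hw (hpos j p hp) i).le (hpos j p hp i).le,
    (mul_le_of_le_one_left (hpos j p hp i).le (share_le_one hw (hpos j p hp) i)).trans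
      (hB j p hp i)⟩

/-! ### Prices and EP-allocations with prescribed expected loads -/

/-- Weights normalised by target loads `lam` and multiplied by prices `θ ^ l i`. -/
noncomputable def priced (θ : ℝ) (lam : Fin m → ℝ) (l : Fin m → ℕ) (p : Fin m → ℝ) : Fin m → ℝ :=
  fun k => θ ^ l k * (p k / lam k)

theorem priced_pos {θ : ℝ} {lam : Fin m → ℝ} {l : Fin m → ℕ} {p : Fin m → ℝ} (hθ : 0 < θ)
    (hlam : ∀ i, 0 < lam i) (hp : ∀ i, 0 < p i) (i : Fin m) : 0 < priced θ lam l p i :=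
  mul_pos (pow_pos hθ _) (div_pos (hp i) (hlam i))

theorem priced_update (θ : ℝ) (lam : Fin m → ℝ) (l : Fin m → ℕ) (p : Fin m → ℝ) (i : Fin m) :
    priced θ lam (Function.update l i (l i + 1)) p
      = Function.update (priced θ lam l p) i (θ * priced θ lam l p i) := by
  ext k
  rcases eq_or_ne k i with rfl | h
  · simp only [priced, Function.update_self]; ring
  · simp only [priced, Function.update_of_ne h]

/-- Links the two halves of the argument: the normalized powers in the increment of the potential
are EP shares, with the prices absorbed into the parameters. -/
theorem priced_rpow_div_sum {θ : ℝ} {lam : Fin m → ℝ} {l : Fin m → ℕ} {p : Fin m → ℝ} (hθ : 0 < θ)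
    (hlam : ∀ i, 0 < lam i) (hp : ∀ i, 0 < p i) (α : ℝ) (i : Fin m) :
    priced θ lam l p i ^ α / ∑ k, priced θ lam l p k ^ α
      = share α (fun k => (θ ^ l k / lam k) ^ α) p i := by
  have h : ∀ k, priced θ lam l p k ^ α = p k ^ α * (θ ^ l k / lam k) ^ α := fun k => by
    rw [← Real.mul_rpow (hp k).le (div_pos (pow_pos hθ _) (hlam k)).le, priced]
    congr 1; ring
  simp only [share, h]

theorem sum_update_pow (θ : ℝ) (l : Fin m → ℕ) (i : Fin m) :
    ∑ k, θ ^ Function.update l i (l i + 1) k = ∑ k, θ ^ l k + (θ - 1) * θ ^ l i := by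
  rw [← Finset.add_sum_erase _ _ (Finset.mem_univ i),
    ← Finset.add_sum_erase _ (fun k => θ ^ l k) (Finset.mem_univ i)]
  have : ∑ x ∈ Finset.univ.erase i, θ ^ Function.update l i (l i + 1) x
      = ∑ x ∈ Finset.univ.erase i, θ ^ l x :=
    Finset.sum_congr rfl fun k hk => by
      rw [Function.update_of_ne (Finset.ne_of_mem_erase hk)]
  rw [this, Function.update_self]; ring

/-- A function on a grid that is at least `e ∑ θ ^ l i`, but smaller than `e θ ^ K` at the origin,
has a point inside the grid at which no upward step decreases it. -/
theorem exists_grid_local_min {Ψ : (Fin m → ℕ) → ℝ} {θ e : ℝ} {K : ℕ} (hθ : 0 < θ) (he : 0 < e)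
    (hlow : ∀ l, e * ∑ i, θ ^ l i ≤ Ψ l) (h0 : Ψ (fun _ => 0) < e * θ ^ K) :
    ∃ l : Fin m → ℕ, (∀ i, l i ≤ K) ∧ ∀ i, Ψ l ≤ Ψ (Function.update l i (l i + 1)) := by
  obtain ⟨l0, -, hl0⟩ := Finset.exists_min_image (Finset.univ : Finset (Fin m → Fin (K + 1)))
    (fun l => Ψ fun i => l i) ⟨fun _ => 0, Finset.mem_univ _⟩
  have hle : ∀ i, (l0 i : ℕ) ≤ K := fun i => Nat.lt_succ_iff.1 (l0 i).2
  -- A coordinate equal to `K` would make the value at least `e θ ^ K`, more than at the origin.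
  -- Hence the minimum is off the upper boundary and each upward step stays in the grid.
  have hlt : ∀ i, (l0 i : ℕ) < K := by
    intro i
    refine lt_of_le_of_ne (hle i) fun h => ?_
    have h1 := hl0 (fun _ => 0) (Finset.mem_univ _)
    simp only [Fin.val_zero] at h1
    have h2 := hlow fun i => l0 i
    have h3 : θ ^ K ≤ ∑ i, θ ^ (l0 i : ℕ) := by
      have := Finset.single_le_sum (f := fun i => θ ^ (l0 i : ℕ))
        (fun k _ => (pow_pos hθ _).le) (Finset.mem_univ i)
      simpa [h] using this
    have := mul_le_mul_of_nonneg_left h3 he.le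
    linarith
  refine ⟨fun i => l0 i, hle, fun i => ?_⟩
  have h1 := hl0 (Function.update l0 i ⟨l0 i + 1, by have := hlt i; omega⟩) (Finset.mem_univ _)
  have h2 : (fun k => ((Function.update l0 i ⟨l0 i + 1, by have := hlt i; omega⟩ : Fin m → Fin (K + 1)) k : ℕ))
      = Function.update (fun i => (l0 i : ℕ)) i (l0 i + 1) := by
    ext k
    rcases eq_or_ne k i with rfl | h
    · simp
    · simp [Function.update_of_ne h]
  simp only [h2] at h1
  exact h1

theorem colBounded_pot {D : Fin n → PMF (Fin m → ℝ)} {B lam : Fin m → ℝ}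
    (hpos : PositiveWeights D) (hB : WeightsLE D B) (hlam : ∀ i, 0 < lam i) {θ β : ℝ} (hθ : 0 < θ)
    (hm : 0 < m) (hβ : 1 ≤ β ∨ β < 0) (l : Fin m → ℕ) :
    ColBounded D (fun p => pot β (priced θ lam l p)) (∑ k, priced θ lam l B k) := by
  intro j p hp
  have hz := priced_pos (l := l) hθ hlam (hpos j p hp)
  refine ⟨pot_nonneg hz _, ?_⟩
  have h1 : pot β (priced θ lam l p) ≤ ∑ k, priced θ lam l p k := by
    rcases hβ with h | h
    · exact pot_le_sum hz h
    · exact (pot_le_of_neg hz h ⟨0, hm⟩).trans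
        (Finset.single_le_sum (f := fun k => priced θ lam l p k) (fun k _ => (hz k).le)
          (Finset.mem_univ _))
  refine h1.trans (Finset.sum_le_sum fun k _ => ?_)
  refine mul_le_mul_of_nonneg_left ?_ (pow_pos hθ _).le
  exact div_le_div_of_nonneg_right (hB j p hp k) (hlam k).le

theorem integral_sum_priced_load {D : Fin n → PMF (Fin m → ℝ)} {B : Fin m → ℝ}
    (hpos : PositiveWeights D) (hB : WeightsLE D B) {X : Instance m n → Assignment m n}
    (hX : ∀ P, InSupport D P → IsFeasible (X P)) (c : Fin m → ℝ) :
    Integrable (fun P => ∑ i, c i * load P (X P) i) (law D) ∧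
    ∫ P, ∑ i, c i * load P (X P) i ∂(law D) = ∑ i, c i * ∫ P, load P (X P) i ∂(law D) := by
  have h : ∀ i ∈ Finset.univ, Integrable (fun P => c i * load P (X P) i) (law D) :=
    fun i _ => (integrable_load hpos hB hX i).const_mul _
  refine ⟨integrable_finsetSum _ h, ?_⟩
  rw [integral_finsetSum _ h]
  simp only [integral_const_mul]

theorem sum_priced_load (θ : ℝ) (lam : Fin m → ℝ) (l : Fin m → ℕ) (P : Instance m n)
    (X : Assignment m n) : ∑ i, θ ^ l i / lam i * load P X i
      = ∑ j, ∑ i, X j i * priced θ lam l (P j) i := by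
  rw [Finset.sum_comm]
  refine Finset.sum_congr rfl fun i _ => ?_
  rw [load, Finset.mul_sum]
  refine Finset.sum_congr rfl fun j _ => ?_
  simp only [priced]; ring

/-- Weak duality: at prices `θ ^ l i / lam i` the allocation `X` earns at least the left side in
expectation, while an item never earns more than its largest priced weight. -/
theorem sum_pow_le_colMean_pot {D : Fin n → PMF (Fin m → ℝ)} {B lam : Fin m → ℝ}
    (hpos : PositiveWeights D) (hB : WeightsLE D B) (hlam : ∀ i, 0 < lam i) {θ β : ℝ} (hθ : 0 < θ)
    (hm : 0 < m) (hβ : 1 ≤ β) {X : Instance m n → Assignment m n}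
    (hX : ∀ P, InSupport D P → IsFeasible (X P))
    (hL : ∀ i, lam i ≤ ∫ P, load P (X P) i ∂(law D)) (l : Fin m → ℕ) :
    ∑ i, θ ^ l i ≤ colMean D (fun p => pot β (priced θ lam l p)) := by
  have hb := colBounded_pot hpos hB hlam hθ hm (Or.inl hβ) l
  obtain ⟨hi, he⟩ := integral_sum_priced_load hpos hB hX fun i => θ ^ l i / lam i
  calc ∑ i, θ ^ l i ≤ ∑ i, θ ^ l i / lam i * ∫ P, load P (X P) i ∂(law D) := by
        refine Finset.sum_le_sum fun i _ => ?_
        rw [div_mul_eq_mul_div, le_div_iff₀ (hlam i)]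
        exact mul_le_mul_of_nonneg_left (hL i) (pow_pos hθ _).le
    _ = ∫ P, ∑ i, θ ^ l i / lam i * load P (X P) i ∂(law D) := he.symm
    _ ≤ ∫ P, ∑ j, pot β (priced θ lam l (P j)) ∂(law D) := by
        refine integral_law_mono hi (integrable_colSum hb.integrable) fun P hP => ?_
        rw [sum_priced_load]
        refine Finset.sum_le_sum fun j _ => ?_
        have hz := priced_pos (l := l) hθ hlam (hpos j _ (hP j))
        calc ∑ i, X P j i * priced θ lam l (P j) i
            ≤ ∑ i, X P j i * pot β (priced θ lam l (P j)) :=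
              Finset.sum_le_sum fun i _ =>
                mul_le_mul_of_nonneg_left (le_pot hz (by linarith) i) ((hX P hP).1 j i).1
          _ = _ := by rw [← Finset.sum_mul, (hX P hP).2 j, one_mul]
    _ = _ := integral_colSum hb.integrable

theorem colMean_pot_le_sum_pow {D : Fin n → PMF (Fin m → ℝ)} {B lam : Fin m → ℝ}
    (hpos : PositiveWeights D) (hB : WeightsLE D B) (hlam : ∀ i, 0 < lam i) {θ β : ℝ} (hθ : 0 < θ)
    (hm : 0 < m) (hβ : β < 0) {X : Instance m n → Assignment m n}
    (hX : ∀ P, InSupport D P → IsFeasible (X P))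
    (hL : ∀ i, ∫ P, load P (X P) i ∂(law D) ≤ lam i) (l : Fin m → ℕ) :
    colMean D (fun p => pot β (priced θ lam l p)) ≤ ∑ i, θ ^ l i := by
  have hb := colBounded_pot hpos hB hlam hθ hm (Or.inr hβ) l
  obtain ⟨hi, he⟩ := integral_sum_priced_load hpos hB hX fun i => θ ^ l i / lam i
  calc _ = ∫ P, ∑ j, pot β (priced θ lam l (P j)) ∂(law D) := (integral_colSum hb.integrable).symm
    _ ≤ ∫ P, ∑ i, θ ^ l i / lam i * load P (X P) i ∂(law D) := by
        refine integral_law_mono (integrable_colSum hb.integrable) hi fun P hP => ?_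
        rw [sum_priced_load]
        refine Finset.sum_le_sum fun j _ => ?_
        have hz := priced_pos (l := l) hθ hlam (hpos j _ (hP j))
        calc pot β (priced θ lam l (P j)) = ∑ i, X P j i * pot β (priced θ lam l (P j)) := by
              rw [← Finset.sum_mul, (hX P hP).2 j, one_mul]
          _ ≤ ∑ i, X P j i * priced θ lam l (P j) i :=
              Finset.sum_le_sum fun i _ =>
                mul_le_mul_of_nonneg_left (pot_le_of_neg hz hβ i) ((hX P hP).1 j i).1
    _ = ∑ i, θ ^ l i / lam i * ∫ P, load P (X P) i ∂(law D) := he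
    _ ≤ _ := by
        refine Finset.sum_le_sum fun i _ => ?_
        rw [div_mul_eq_mul_div, div_le_iff₀ (hlam i)]
        exact mul_le_mul_of_nonneg_left (hL i) (pow_pos hθ _).le

theorem colMean_sub {D : Fin n → PMF (Fin m → ℝ)} {g h : (Fin m → ℝ) → ℝ} {b c : ℝ}
    (hg : ColBounded D g b) (hh : ColBounded D h c) :
    colMean D (fun p => g p - h p) = colMean D g - colMean D h := by
  simp only [colMean]
  rw [← Finset.sum_sub_distrib]
  exact Finset.sum_congr rfl fun j _ => integral_sub (hg.integrable j) (hh.integrable j)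

theorem colMean_mono {D : Fin n → PMF (Fin m → ℝ)} {g h : (Fin m → ℝ) → ℝ}
    (hg : ∀ j, Integrable g (D j).toMeasure) (hh : ∀ j, Integrable h (D j).toMeasure)
    (hle : ∀ j, ∀ p ∈ (D j).support, g p ≤ h p) : colMean D g ≤ colMean D h :=
  Finset.sum_le_sum fun j _ => integral_mono_ae (hg j) (hh j)
    (by filter_upwards [ae_mem_support (D j)] with p hp using hle j p hp)

theorem colMean_sum {ι : Type*} {D : Fin n → PMF (Fin m → ℝ)} {g : ι → (Fin m → ℝ) → ℝ}
    (s : Finset ι) (hg : ∀ k ∈ s, ∀ j, Integrable (g k) (D j).toMeasure) :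
    colMean D (fun p => ∑ k ∈ s, g k p) = ∑ k ∈ s, colMean D (g k) := by
  simp only [colMean]
  rw [Finset.sum_comm]
  exact Finset.sum_congr rfl fun j _ => integral_finsetSum _ fun k hk => hg k hk j

/-- Expected loads that some allocation attains are attained up to a constant factor close to one
by an EP-allocation with prices on a bounded geometric grid. -/
theorem exists_share_colMean_ge {D : Fin n → PMF (Fin m → ℝ)} {B lam : Fin m → ℝ}
    (hpos : PositiveWeights D) (hB : WeightsLE D B) (hlam : ∀ i, 0 < lam i) (hm : 0 < m)
    {X : Instance m n → Assignment m n} (hX : ∀ P, InSupport D P → IsFeasible (X P))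
    (hL : ∀ i, lam i ≤ ∫ P, load P (X P) i ∂(law D)) {γ η e ρ R : ℝ} {K : ℕ}
    (hU : ∀ i, colMean D (fun p => p i) ≤ R * lam i) (hγ : 0 < γ)
    (hη : 0 < η) (he : (γ + 1) * η ≤ e) (he1 : e ≤ 1) (hρ : (m : ℝ) ^ (1 / (γ + 1)) ≤ ρ)
    (hK : m * R < e * (1 + η) ^ K) :
    ∃ l : Fin m → ℕ, (∀ i, l i ≤ K) ∧ ∀ i, (1 - e) * lam i ≤ (1 + e) * ρ *
      colMean D (fun p => share γ (fun k => ((1 + η) ^ l k / lam k) ^ γ) p i * p i) := by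
  have he0 : 0 < e := lt_of_lt_of_le (by positivity) he
  have hθ : 0 < 1 + η := by linarith
  have hβ : 1 ≤ γ + 1 := by linarith
  -- Only the fraction `1 - e` of the price sum is subtracted; the `e` left over by weak duality
  -- makes the potential coercive.
  obtain ⟨l, hlK, hl⟩ := exists_grid_local_min (m := m)
    (Ψ := fun l => colMean D (fun p => pot (γ + 1) (priced (1 + η) lam l p))
      - (1 - e) * ∑ i, (1 + η) ^ l i) (K := K) hθ he0
    (fun l => by
      have := sum_pow_le_colMean_pot hpos hB hlam hθ hm hβ hX hL l
      linarith)
    (by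
      have h1 : colMean D (fun p => pot (γ + 1) (priced (1 + η) lam (fun _ => 0) p)) ≤ m * R := by
        calc _ ≤ colMean D (fun p => ∑ i, (lam i)⁻¹ * p i) := by
              refine colMean_mono (colBounded_pot hpos hB hlam hθ hm (Or.inl hβ) _).integrable
                (fun j => integrable_finsetSum _ fun i _ =>
                  ((colBounded_weight hpos hB i).integrable j).const_mul _) fun j p hp => ?_
              refine (pot_le_sum (priced_pos hθ hlam (hpos j p hp)) hβ).trans (le_of_eq ?_)
              refine Finset.sum_congr rfl fun i _ => ?_
              simp only [priced, pow_zero]; ring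
          _ = ∑ i, (lam i)⁻¹ * colMean D (fun p => p i) := by
              rw [colMean_sum _ fun i _ j => ((colBounded_weight hpos hB i).integrable j).const_mul _]
              simp only [colMean_const_mul]
          _ ≤ ∑ _i : Fin m, R := by
              refine Finset.sum_le_sum fun i _ => ?_
              rw [inv_mul_le_iff₀ (hlam i), mul_comm]
              exact hU i
          _ = m * R := by simp
      have h2 : 0 ≤ (1 - e) * ∑ _i : Fin m, (1 + η) ^ 0 :=
        mul_nonneg (by linarith) (Finset.sum_nonneg fun i _ => (pow_pos hθ _).le)
      linarith)
  refine ⟨l, hlK, fun i => ?_⟩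
  have hli := hl i
  simp only [sum_update_pow] at hli
  set w : Fin m → ℝ := fun k => ((1 + η) ^ l k / lam k) ^ γ with hw
  have hwpos : ∀ k, 0 < w k := fun k =>
    Real.rpow_pos_of_pos (div_pos (pow_pos hθ _) (hlam k)) _
  have hdiff : colMean D (fun p => pot (γ + 1) (priced (1 + η) lam (Function.update l i (l i + 1)) p))
      - colMean D (fun p => pot (γ + 1) (priced (1 + η) lam l p))
      ≤ (η * (1 + e) * ρ * ((1 + η) ^ l i / lam i)) * colMean D (fun p => share γ w p i * p i) := by
    have hb1 := colBounded_pot hpos hB hlam hθ hm (Or.inl hβ) (Function.update l i (l i + 1))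
    have hb2 := colBounded_pot hpos hB hlam hθ hm (Or.inl hβ) l
    rw [← colMean_sub hb1 hb2, ← colMean_const_mul]
    refine colMean_mono (fun j => (hb1.integrable j).sub (hb2.integrable j))
      (fun j => ((colBounded_share hpos hB hwpos i).integrable j).const_mul _) fun j p hp => ?_
    have h := pot_update_sub_le (priced_pos (l := l) hθ hlam (hpos j p hp)) hγ hη he he1 hρ i
    rw [priced_rpow_div_sum hθ hlam (hpos j p hp)] at h
    rw [priced_update]
    refine h.trans (le_of_eq ?_)
    simp only [priced, hw]; ring
  -- First-order condition: raising price `i` one step increases the smoothed worth by at least the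
  -- increase of the subtracted price sum.
  have hgain : (1 - e) * (η * (1 + η) ^ l i) ≤
      (η * (1 + e) * ρ * ((1 + η) ^ l i / lam i)) * colMean D (fun p => share γ w p i * p i) := by
    refine le_trans ?_ hdiff
    have : (1 + η - 1) = η := by ring
    rw [this, mul_add] at hli
    linarith
  have hpow : 0 < η * (1 + η) ^ l i := mul_pos hη (pow_pos hθ _)
  have h3 : (η * (1 + e) * ρ * ((1 + η) ^ l i / lam i)) * colMean D (fun p => share γ w p i * p i)
      = ((1 + e) * ρ * colMean D (fun p => share γ w p i * p i) / lam i) * (η * (1 + η) ^ l i) := by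
    ring
  rw [h3] at hgain
  have h4 := le_of_mul_le_mul_right hgain hpow
  rwa [le_div_iff₀ (hlam i)] at h4

/-- The analogue of `exists_share_colMean_ge` for upper bounds on the expected loads. -/
theorem exists_share_colMean_le {D : Fin n → PMF (Fin m → ℝ)} {B lam : Fin m → ℝ}
    (hpos : PositiveWeights D) (hB : WeightsLE D B) (hlam : ∀ i, 0 < lam i) (hm : 0 < m)
    {X : Instance m n → Assignment m n} (hX : ∀ P, InSupport D P → IsFeasible (X P))
    (hL : ∀ i, ∫ P, load P (X P) i ∂(law D) ≤ lam i) {γ η e ρ : ℝ} {K : ℕ} (hγ : 1 ≤ γ)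
    (hη : 0 < η) (he : γ * η ≤ e) (hρ : (m : ℝ) ^ (1 / γ) ≤ ρ)
    (hK : (1 + e) * m < e * (1 + η) ^ K) :
    ∃ l : Fin m → ℕ, (∀ i, l i ≤ K) ∧ ∀ i,
      colMean D (fun p => share (-γ - 1) (fun k => ((1 + η) ^ l k / lam k) ^ (-γ - 1)) p i * p i)
        ≤ (1 + e) * ρ * (1 + e) * lam i := by
  have he0 : 0 < e := lt_of_lt_of_le (by positivity) he
  have hθ : 0 < 1 + η := by linarith
  have hβ : -γ < 0 := by linarith
  have hρ0 : 0 < ρ := lt_of_lt_of_le (Real.rpow_pos_of_pos (by exact_mod_cast hm) _) hρ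
  -- Signs are reversed. The potential enters negatively and is nonnegative, so the value at the
  -- origin is at most `(1 + e) m` without any bound on the total weights.
  obtain ⟨l, hlK, hl⟩ := exists_grid_local_min (m := m)
    (Ψ := fun l => (1 + e) * ∑ i, (1 + η) ^ l i
      - colMean D (fun p => pot (-γ) (priced (1 + η) lam l p))) (K := K) hθ he0
    (fun l => by
      have := colMean_pot_le_sum_pow hpos hB hlam hθ hm hβ hX hL l
      linarith)
    (by
      have := (colBounded_pot hpos hB hlam hθ hm (Or.inr hβ) (fun _ => 0)).colMean_nonneg
      simp only [pow_zero, Finset.sum_const, Finset.card_univ, Fintype.card_fin, nsmul_eq_mul,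
        mul_one]
      linarith)
  refine ⟨l, hlK, fun i => ?_⟩
  have hli := hl i
  simp only [sum_update_pow] at hli
  set w : Fin m → ℝ := fun k => ((1 + η) ^ l k / lam k) ^ (-γ - 1) with hw
  have hwpos : ∀ k, 0 < w k := fun k =>
    Real.rpow_pos_of_pos (div_pos (pow_pos hθ _) (hlam k)) _
  have hdiff : η * ((1 + η) ^ l i / lam i) * colMean D (fun p => share (-γ - 1) w p i * p i) ≤
      (1 + e) * ρ * (colMean D
        (fun p => pot (-γ) (priced (1 + η) lam (Function.update l i (l i + 1)) p))
      - colMean D (fun p => pot (-γ) (priced (1 + η) lam l p))) := by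
    have hb1 := colBounded_pot hpos hB hlam hθ hm (Or.inr hβ) (Function.update l i (l i + 1))
    have hb2 := colBounded_pot hpos hB hlam hθ hm (Or.inr hβ) l
    rw [← colMean_sub hb1 hb2, ← colMean_const_mul, ← colMean_const_mul]
    refine colMean_mono (fun j => ((colBounded_share hpos hB hwpos i).integrable j).const_mul _)
      (fun j => ((hb1.integrable j).sub (hb2.integrable j)).const_mul _) fun j p hp => ?_
    have h := le_pot_update_sub (priced_pos (l := l) hθ hlam (hpos j p hp)) hγ hη he hρ i
    rw [priced_rpow_div_sum hθ hlam (hpos j p hp)] at h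
    rw [priced_update]
    refine le_trans (le_of_eq ?_) h
    simp only [priced, hw]; ring
  have hgain : η * ((1 + η) ^ l i / lam i) * colMean D (fun p => share (-γ - 1) w p i * p i) ≤
      (1 + e) * ρ * ((1 + e) * (η * (1 + η) ^ l i)) := by
    refine hdiff.trans (mul_le_mul_of_nonneg_left ?_ (by positivity))
    have : (1 + η - 1) = η := by ring
    rw [this, mul_add] at hli
    linarith
  have hpow : 0 < η * (1 + η) ^ l i := mul_pos hη (pow_pos hθ _)
  have h3 : η * ((1 + η) ^ l i / lam i) * colMean D (fun p => share (-γ - 1) w p i * p i)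
      = (colMean D (fun p => share (-γ - 1) w p i * p i) / lam i) * (η * (1 + η) ^ l i) := by
    ring
  rw [h3, ← mul_assoc ((1 + e) * ρ)] at hgain
  have h4 := le_of_mul_le_mul_right hgain hpow
  rwa [div_le_iff₀ (hlam i)] at h4

/-! ### Expected maximal deviations -/

/-- The tangent of the logarithm at `K`, evaluated at `exp y`. It makes the log-sum-exp bound linear
in the exponentials, so that expectations can be taken directly. -/
theorem le_log_add_exp_div (y : ℝ) {K : ℝ} (hK : 0 < K) :
    y ≤ Real.log K - 1 + Real.exp y / K := by
  have h := Real.add_one_le_exp (y - Real.log K)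
  rw [Real.exp_sub, Real.exp_log hK] at h
  linarith

/-- Finitely many random variables with small exponential moments have a common upper bound with
small expectation. -/
theorem exists_common_bound {μ : Measure (Instance m n)} [IsProbabilityMeasure μ]
    {Y : Fin m → Instance m n → ℝ} {τ ζ : ℝ} (hτ : 0 < τ) (hζ : 0 < ζ)
    (hlog : Real.log (m + 1) ≤ τ ^ 2 * ζ)
    (hint : ∀ i, Integrable (fun P => Real.exp (τ * ζ * Y i P)) μ)
    (hY : ∀ i, ∫ P, Real.exp (τ * ζ * Y i P) ∂μ ≤ Real.exp (τ ^ 2 * ζ)) :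
    ∃ Z : Instance m n → ℝ, Integrable Z μ ∧ ∫ P, Z P ∂μ ≤ 2 * τ ∧ (∀ P, 0 ≤ Z P) ∧
      ∀ P i, Y i P ≤ Z P := by
  set lam := τ * ζ with hlam
  have hlam0 : 0 < lam := by positivity
  set a := τ ^ 2 * ζ with ha
  have ha0 : 0 < a := by positivity
  -- `K` bounds the expectation of `1 + ∑ exp`, so the tangent terms cancel and `log K = log (m + 1)
  -- + a ≤ 2 a` remains. The extra `1` makes the common bound nonnegative.
  set K := (m + 1) * Real.exp a with hK
  have hK0 : 0 < K := by positivity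
  have hs : Integrable (fun P => ∑ i, Real.exp (lam * Y i P)) μ :=
    integrable_finsetSum _ fun i _ => hint i
  have hbd : ∀ P, ∀ y, Real.exp y ≤ 1 + ∑ i, Real.exp (lam * Y i P) →
      y / lam ≤ 1 / lam * (Real.log K - 1 + (1 + ∑ i, Real.exp (lam * Y i P)) / K) := by
    intro P y hy
    rw [div_eq_inv_mul, one_div]
    refine mul_le_mul_of_nonneg_left ((le_log_add_exp_div y hK0).trans ?_) (by positivity)
    gcongr
  refine ⟨fun P => 1 / lam * (Real.log K - 1 + (1 + ∑ i, Real.exp (lam * Y i P)) / K),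
    ((integrable_const _).add (((integrable_const _).add hs).div_const _)).const_mul _, ?_, ?_, ?_⟩
  · have hs1 : Integrable (fun P => 1 + ∑ i, Real.exp (lam * Y i P)) μ :=
      (integrable_const _).add hs
    rw [integral_const_mul, integral_add (integrable_const _) (hs1.div_const _), integral_div,
      integral_add (integrable_const _) hs, integral_finsetSum _ fun i _ => hint i]
    simp only [integral_const, probReal_univ, smul_eq_mul, one_mul]
    have h1 : (1 + ∑ i, ∫ P, Real.exp (lam * Y i P) ∂μ) / K ≤ 1 := by
      rw [div_le_one hK0]
      have h2 : ∑ i, ∫ P, Real.exp (lam * Y i P) ∂μ ≤ m * Real.exp a := by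
        refine (Finset.sum_le_sum fun i _ => hY i).trans ?_
        simp
      have := Real.one_le_exp ha0.le
      rw [hK]; linarith
    have h3 : Real.log K = Real.log (m + 1) + a := by
      rw [hK, Real.log_mul (by positivity) (Real.exp_pos _).ne', Real.log_exp]
    rw [one_div, inv_mul_le_iff₀ hlam0]
    have : lam * (2 * τ) = 2 * a := by rw [hlam, ha]; ring
    linarith
  · intro P
    have := hbd P 0 (by
      rw [Real.exp_zero]
      have : 0 ≤ ∑ i, Real.exp (lam * Y i P) := Finset.sum_nonneg fun i _ => (Real.exp_pos _).le
      linarith)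
    simpa using this
  · intro P i
    have := hbd P (lam * Y i P) (by
      have := Finset.single_le_sum (f := fun i => Real.exp (lam * Y i P))
        (fun k _ => (Real.exp_pos _).le) (Finset.mem_univ i)
      linarith)
    rwa [mul_div_cancel_left₀ _ hlam0.ne'] at this

/-- Deviations are measured relative to `V i`, so that one scalar serves all agents and can be
pulled out of `f` by homogeneity. -/
theorem exists_lower_deviation {D : Fin n → PMF (Fin m → ℝ)} {g : Fin m → (Fin m → ℝ) → ℝ}
    {A V : Fin m → ℝ} {τ ζ : ℝ} (hτ : 0 < τ) (hτ1 : τ ≤ 1) (hζ : 0 < ζ)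
    (hlog : Real.log (m + 1) ≤ τ ^ 2 * ζ) (hV : ∀ i, 0 < V i)
    (hg : ∀ i, ColBounded D (g i) (V i / ζ)) (hA : ∀ i, A i ≤ colMean D (g i))
    (hAV : ∀ i, A i ≤ V i) :
    ∃ Z : Instance m n → ℝ, Integrable Z (law D) ∧ ∫ P, Z P ∂(law D) ≤ 2 * τ ∧ (∀ P, 0 ≤ Z P) ∧
      ∀ P i, A i - ∑ j, g i (P j) ≤ Z P * V i := by
  have hform : ∀ i (P : Instance m n), τ * ζ * ((A i - ∑ j, g i (P j)) / V i)
      = τ * ζ / V i * (A i - ∑ j, g i (P j)) := fun i P => by ring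
  obtain ⟨Z, h1, h2, h3, h4⟩ := exists_common_bound (μ := law D)
    (Y := fun i P => (A i - ∑ j, g i (P j)) / V i) hτ hζ hlog
    (fun i => by
      have := (hg i).integrable_exp (-(τ * ζ / V i)) (τ * ζ / V i * A i)
      refine this.congr (Filter.Eventually.of_forall fun P => ?_)
      simp only [hform]; congr 1; ring)
    (fun i => by
      simp only [hform]
      have hVi := hV i
      have htb : τ * ζ / V i * (V i / ζ) = τ := by field_simp
      refine ((hg i).integral_exp_lower (by positivity) (by rw [htb]; exact hτ1)
        (hA i)).trans (Real.exp_le_exp.2 ?_)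
      calc (τ * ζ / V i) ^ 2 * (V i / ζ) * A i
          = (τ * ζ / V i * (V i / ζ)) * (τ * ζ / V i) * A i := by ring
        _ = τ * (τ * ζ / V i) * A i := by rw [htb]
        _ ≤ τ * (τ * ζ / V i) * V i := mul_le_mul_of_nonneg_left (hAV i) (by positivity)
        _ = τ ^ 2 * ζ := by field_simp)
  exact ⟨Z, h1, h2, h3, fun P i => (div_le_iff₀ (hV i)).1 (h4 P i)⟩

theorem exists_upper_deviation {D : Fin n → PMF (Fin m → ℝ)} {g : Fin m → (Fin m → ℝ) → ℝ}
    {A V : Fin m → ℝ} {τ ζ : ℝ} (hτ : 0 < τ) (hτ1 : τ ≤ 1) (hζ : 0 < ζ)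
    (hlog : Real.log (m + 1) ≤ τ ^ 2 * ζ) (hV : ∀ i, 0 < V i)
    (hg : ∀ i, ColBounded D (g i) (V i / ζ)) (hA : ∀ i, colMean D (g i) ≤ A i)
    (hAV : ∀ i, A i ≤ V i) :
    ∃ Z : Instance m n → ℝ, Integrable Z (law D) ∧ ∫ P, Z P ∂(law D) ≤ 2 * τ ∧ (∀ P, 0 ≤ Z P) ∧
      ∀ P i, ∑ j, g i (P j) - A i ≤ Z P * V i := by
  have hform : ∀ i (P : Instance m n), τ * ζ * ((∑ j, g i (P j) - A i) / V i)
      = τ * ζ / V i * (∑ j, g i (P j) - A i) := fun i P => by ring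
  obtain ⟨Z, h1, h2, h3, h4⟩ := exists_common_bound (μ := law D)
    (Y := fun i P => (∑ j, g i (P j) - A i) / V i) hτ hζ hlog
    (fun i => by
      have := (hg i).integrable_exp (τ * ζ / V i) (-(τ * ζ / V i * A i))
      refine this.congr (Filter.Eventually.of_forall fun P => ?_)
      simp only [hform]; congr 1; ring)
    (fun i => by
      simp only [hform]
      have hVi := hV i
      have htb : τ * ζ / V i * (V i / ζ) = τ := by field_simp
      refine ((hg i).integral_exp_upper (by positivity) (by positivity) (by rw [htb]; exact hτ1)
        (hA i)).trans (Real.exp_le_exp.2 ?_)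
      calc (τ * ζ / V i) ^ 2 * (V i / ζ) * A i
          = (τ * ζ / V i * (V i / ζ)) * (τ * ζ / V i) * A i := by ring
        _ = τ * (τ * ζ / V i) * A i := by rw [htb]
        _ ≤ τ * (τ * ζ / V i) * V i := mul_le_mul_of_nonneg_left (hAV i) (by positivity)
        _ = τ ^ 2 * ζ := by field_simp)
  exact ⟨Z, h1, h2, h3, fun P i => (div_le_iff₀ (hV i)).1 (h4 P i)⟩

/-! ### Jensen's inequality for superadditive and subadditive objectives -/

/-- Since the law is purely atomic, Jensen's inequality reduces to finite positive combinations and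
a limit. -/
theorem law_hasSum {D : Fin n → PMF (Fin m → ℝ)} {g : Instance m n → ℝ}
    (hg : Integrable g (law D)) :
    HasSum (fun P : {P : Instance m n // InSupport D P} => (law D).real {P.1} * g P.1)
      (∫ P, g P ∂(law D)) := by
  have : Countable {P : Instance m n // InSupport D P} := (countable_inSupport D).to_subtype
  have h := hasSum_integral_iUnion (μ := law D) (f := g)
    (s := fun P : {P : Instance m n // InSupport D P} => ({P.1} : Set (Instance m n)))
    (fun P => measurableSet_singleton _)
    (fun P Q hPQ => Set.disjoint_singleton.2 fun h => hPQ (Subtype.ext h)) hg.integrableOn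
  have hU : (⋃ P : {P : Instance m n // InSupport D P}, ({P.1} : Set (Instance m n)))
      = {P | InSupport D P} := by
    ext P; simp
  have hr : (law D).restrict {P | InSupport D P} = law D :=
    Measure.restrict_eq_self_of_ae_mem (s := {P | InSupport D P}) (ae_inSupport D)
  rw [hU, hr] at h
  simpa [integral_singleton, measureReal_def] using h

theorem law_singleton_pos {D : Fin n → PMF (Fin m → ℝ)} {P : Instance m n} (hP : InSupport D P) :
    0 < (law D).real {P} := by
  rw [law, measureReal_def, Measure.pi_singleton, ENNReal.toReal_prod]
  refine Finset.prod_pos fun j _ => ENNReal.toReal_pos ?_ (measure_ne_top _ _)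
  rw [PMF.toMeasure_apply_singleton _ _ (measurableSet_singleton _)]
  exact (PMF.mem_support_iff _ _).1 (hP j)

section Jensen

variable {f : (Fin m → ℝ) → ℝ} {ι : Type*}

theorem Superadditive.sum_le (hf : WellBehaved f) (hs : Superadditive f) {p : ι → ℝ}
    (hp : ∀ a, 0 < p a) {G : ι → Fin m → ℝ} (hG : ∀ a i, 0 < G a i) {F : Finset ι}
    (hF : F.Nonempty) : ∑ a ∈ F, p a * f (G a) ≤ f fun i => ∑ a ∈ F, p a * G a i := by
  induction hF using Finset.Nonempty.cons_induction with
  | singleton a => simpa using (hf.homog _ _ (hp a) (hG a)).ge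
  | cons a F ha hF ih =>
    simp only [Finset.sum_cons]
    rw [← hf.homog _ _ (hp a) (hG a)]
    exact (add_le_add_right ih _).trans (hs _ _ (fun i => mul_pos (hp a) (hG a i))
      fun i => Finset.sum_pos (fun b _ => mul_pos (hp b) (hG b i)) hF)

theorem Subadditive.le_sum (hf : WellBehaved f) (hs : Subadditive f) {p : ι → ℝ}
    (hp : ∀ a, 0 < p a) {G : ι → Fin m → ℝ} (hG : ∀ a i, 0 < G a i) {F : Finset ι}
    (hF : F.Nonempty) : f (fun i => ∑ a ∈ F, p a * G a i) ≤ ∑ a ∈ F, p a * f (G a) := by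
  induction hF using Finset.Nonempty.cons_induction with
  | singleton a => simpa using (hf.homog _ _ (hp a) (hG a)).le
  | cons a F ha hF ih =>
    simp only [Finset.sum_cons]
    rw [← hf.homog _ _ (hp a) (hG a)]
    exact (hs _ _ (fun i => mul_pos (hp a) (hG a i))
      fun i => Finset.sum_pos (fun b _ => mul_pos (hp b) (hG b i)) hF).trans
        (add_le_add_right ih _)

/-- Partial sums lie below `L`, so monotonicity alone passes to the limit; no continuity of `f` is
needed. -/
theorem Superadditive.hasSum_le (hf : WellBehaved f) (hs : Superadditive f) {p : ι → ℝ}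
    (hp : ∀ a, 0 < p a) {G : ι → Fin m → ℝ} (hG : ∀ a i, 0 < G a i) {L : Fin m → ℝ} {T : ℝ}
    (hLpos : ∀ i, 0 < L i) (hL : ∀ i, HasSum (fun a => p a * G a i) (L i))
    (hT : HasSum (fun a => p a * f (G a)) T) : T ≤ f L := by
  refine hasSum_le_of_sum_le hT fun F => ?_
  rcases F.eq_empty_or_nonempty with rfl | hF
  · simpa using (hf.pos L hLpos).le
  · refine (hs.sum_le hf hp hG hF).trans (hf.mono _ _ (fun i =>
      Finset.sum_pos (fun b _ => mul_pos (hp b) (hG b i)) hF) fun i => ?_)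
    exact sum_le_hasSum F (fun b _ => (mul_pos (hp b) (hG b i)).le) (hL i)

/-- Here monotonicity points the wrong way for partial sums. A large finite sum exceeds `(1 - δ) L`,
and the missing `δ L` is added back by subadditivity at cost `δ f L`. -/
theorem Subadditive.le_hasSum [Nonempty ι] (hf : WellBehaved f) (hs : Subadditive f) {p : ι → ℝ}
    (hp : ∀ a, 0 < p a) {G : ι → Fin m → ℝ} (hG : ∀ a i, 0 < G a i) {L : Fin m → ℝ} {T : ℝ}
    (hLpos : ∀ i, 0 < L i) (hL : ∀ i, HasSum (fun a => p a * G a i) (L i))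
    (hT : HasSum (fun a => p a * f (G a)) T) : f L ≤ T := by
  have key : ∀ δ : ℝ, 0 < δ → f L ≤ T + δ * f L := by
    intro δ hδ
    have h1 : ∀ᶠ F : Finset ι in Filter.atTop, ∀ i, (1 - δ) * L i < ∑ a ∈ F, p a * G a i :=
      Filter.eventually_all.2 fun i => (hL i).eventually_const_lt (by nlinarith [hLpos i])
    obtain ⟨F, hF1, hF2⟩ := (h1.and (Filter.eventually_ge_atTop {Classical.arbitrary ι})).exists
    have hF : F.Nonempty := (Finset.singleton_nonempty _).mono hF2
    have hpos : ∀ i, 0 < ∑ a ∈ F, p a * G a i := fun i =>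
      Finset.sum_pos (fun b _ => mul_pos (hp b) (hG b i)) hF
    have hδL : ∀ i, 0 < δ * L i := fun i => mul_pos hδ (hLpos i)
    calc f L ≤ f fun i => (∑ a ∈ F, p a * G a i) + δ * L i :=
          hf.mono _ _ hLpos fun i => by linarith [hF1 i]
      _ ≤ f (fun i => ∑ a ∈ F, p a * G a i) + f fun i => δ * L i := hs _ _ hpos hδL
      _ ≤ T + δ * f L := by
          refine add_le_add ((hs.le_sum hf hp hG hF).trans ?_) (hf.homog _ _ hδ hLpos).le
          exact sum_le_hasSum F (fun b _ => (mul_pos (hp b) (hf.pos _ (hG b))).le) hT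
  have hfL := hf.pos L hLpos
  refine le_of_forall_pos_le_add fun δ hδ => ?_
  have := key (δ / f L) (by positivity)
  rwa [div_mul_cancel₀ _ hfL.ne'] at this

theorem Superadditive.integral_le (hf : WellBehaved f) (hs : Superadditive f)
    {D : Fin n → PMF (Fin m → ℝ)} {G : Instance m n → Fin m → ℝ}
    (hG : ∀ P, InSupport D P → ∀ i, 0 < G P i) (hGi : ∀ i, Integrable (fun P => G P i) (law D))
    (hLpos : ∀ i, 0 < ∫ P, G P i ∂(law D)) (hfi : Integrable (fun P => f (G P)) (law D)) :
    ∫ P, f (G P) ∂(law D) ≤ f fun i => ∫ P, G P i ∂(law D) :=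
  hs.hasSum_le hf (fun P : {P : Instance m n // InSupport D P} => law_singleton_pos P.2)
    (G := fun P => G P.1) (fun P => hG P.1 P.2) hLpos (fun i => law_hasSum (hGi i)) (law_hasSum hfi)

theorem Subadditive.le_integral (hf : WellBehaved f) (hs : Subadditive f)
    {D : Fin n → PMF (Fin m → ℝ)} {G : Instance m n → Fin m → ℝ}
    (hG : ∀ P, InSupport D P → ∀ i, 0 < G P i) (hGi : ∀ i, Integrable (fun P => G P i) (law D))
    (hLpos : ∀ i, 0 < ∫ P, G P i ∂(law D)) (hfi : Integrable (fun P => f (G P)) (law D)) :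
    f (fun i => ∫ P, G P i ∂(law D)) ≤ ∫ P, f (G P) ∂(law D) := by
  obtain ⟨P0, hP0⟩ := exists_inSupport D
  have : Nonempty {P : Instance m n // InSupport D P} := ⟨⟨P0, hP0⟩⟩
  exact hs.le_hasSum hf (fun P : {P : Instance m n // InSupport D P} => law_singleton_pos P.2)
    (G := fun P => G P.1) (fun P => hG P.1 P.2) hLpos (fun i => law_hasSum (hGi i)) (law_hasSum hfi)

end Jensen

/-! ### Consequences of the small items assumption -/

theorem items_pos_of_load_pos {P : Instance m n} {X : Assignment m n} (i : Fin m)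
    (h : 0 < load P X i) : 0 < n := by
  rcases Nat.eq_zero_or_pos n with rfl | hn
  · simp [load] at h
  · exact hn

theorem ItemsSmallFor.integral_pos {D : Fin n → PMF (Fin m → ℝ)} {ζ : ℝ}
    {X : Instance m n → Assignment m n} (h : ItemsSmallFor D ζ X) (hpos : PositiveWeights D)
    (hn : 0 < n) (hζ : 0 < ζ) (i : Fin m) : 0 < ∫ P, load P (X P) i ∂(law D) := by
  obtain ⟨p, hp⟩ := (D ⟨0, hn⟩).support_nonempty
  have h1 := (hpos _ p hp i).trans_le (h _ p hp i)
  by_contra hc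
  exact absurd h1 (not_lt.2 (div_nonpos_of_nonpos_of_nonneg (not_lt.1 hc) hζ.le))

theorem load_pos {P : Instance m n} {X : Assignment m n} (hn : 0 < n) (i : Fin m)
    (hP : ∀ j, 0 < P j i) (hX : ∀ j, 0 < X j i) : 0 < load P X i :=
  Finset.sum_pos (fun j _ => mul_pos (hX j) (hP j)) ⟨⟨0, hn⟩, Finset.mem_univ _⟩

theorem integral_load_le_colMean {D : Fin n → PMF (Fin m → ℝ)} {B : Fin m → ℝ}
    (hpos : PositiveWeights D) (hB : WeightsLE D B) {X : Instance m n → Assignment m n}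
    (hX : ∀ P, InSupport D P → IsFeasible (X P)) (i : Fin m) :
    ∫ P, load P (X P) i ∂(law D) ≤ colMean D fun p => p i := by
  have hw := (colBounded_weight hpos hB i).integrable
  rw [← integral_colSum hw]
  refine integral_law_mono (integrable_load hpos hB hX i) (integrable_colSum hw) fun P hP => ?_
  exact Finset.sum_le_sum fun j _ =>
    mul_le_of_le_one_left (hpos j _ (hP j) i).le ((hX P hP).1 j i).2

theorem integrable_objective {f : (Fin m → ℝ) → ℝ} (hf : WellBehaved f)
    {D : Fin n → PMF (Fin m → ℝ)} {B : Fin m → ℝ}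
    (hpos : PositiveWeights D) (hB : WeightsLE D B) {X : Instance m n → Assignment m n}
    (hX : ∀ P, InSupport D P → IsFeasible (X P))
    (hl : ∀ P, InSupport D P → ∀ i, 0 < load P (X P) i) :
    Integrable (fun P => f (load P (X P))) (law D) := by
  refine integrable_law_of_bound (f fun i => n * B i) fun P hP => ?_
  rw [abs_of_pos (hf.pos _ (hl P hP))]
  exact hf.mono _ _ (hl P hP) fun i => (load_bounds hpos hB hP (hX P hP) i).2

theorem epAllocation_load_pos {D : Fin n → PMF (Fin m → ℝ)} (hpos : PositiveWeights D)
    (hn : 0 < n) {α : ℝ} {w : Fin m → ℝ} (hw : ∀ i, 0 < w i) {P : Instance m n}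
    (hP : InSupport D P) (i : Fin m) : 0 < load P (epAllocation α w P) i :=
  load_pos hn i (fun j => hpos j _ (hP j) i) fun j => share_pos hw (hpos j _ (hP j)) i

theorem integrable_epValue {f : (Fin m → ℝ) → ℝ} (hf : WellBehaved f)
    {D : Fin n → PMF (Fin m → ℝ)} {B : Fin m → ℝ} (hpos : PositiveWeights D) (hB : WeightsLE D B)
    (hm : 0 < m) (hn : 0 < n) (α : ℝ) {w : Fin m → ℝ} (hw : ∀ i, 0 < w i) :
    Integrable (epValue f α w) (law D) :=
  integrable_objective hf hpos hB (X := fun P => epAllocation α w P)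
    (fun _ hP => epAllocation_isFeasible hm hw fun j => hpos j _ (hP j))
    fun _ hP i => epAllocation_load_pos hpos hn hw hP i

/-! ### Maximization: capped loads -/

/-- The contribution of an item to the load of agent `i`, with weights capped at `c`. -/
noncomputable def cappedLoad (α : ℝ) (w : Fin m → ℝ) (c : ℝ) (i : Fin m) (p : Fin m → ℝ) : ℝ :=
  share α w p i * min (p i) c

theorem colBounded_cappedLoad {D : Fin n → PMF (Fin m → ℝ)} (hpos : PositiveWeights D)
    {α : ℝ} {w : Fin m → ℝ} (hw : ∀ i, 0 < w i) {c : ℝ} (hc : 0 ≤ c) (i : Fin m) :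
    ColBounded D (cappedLoad α w c i) c := fun j p hp => by
  have h1 := share_pos (α := α) hw (hpos j p hp) i
  have h2 := share_le_one (α := α) hw (hpos j p hp) i
  have h3 : 0 ≤ min (p i) c := le_min (hpos j p hp i).le hc
  exact ⟨mul_nonneg h1.le h3, (mul_le_of_le_one_left h3 h2).trans (min_le_right _ _)⟩

/-- If the capped expected loads nearly reach `lam`, so does the expected objective. -/
theorem Superadditive.le_integral_epValue {f : (Fin m → ℝ) → ℝ} (hf : WellBehaved f)
    {D : Fin n → PMF (Fin m → ℝ)} {B : Fin m → ℝ} (hpos : PositiveWeights D) (hB : WeightsLE D B)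
    (hm : 0 < m) (hn : 0 < n) {α : ℝ} {w : Fin m → ℝ} (hw : ∀ i, 0 < w i) {lam : Fin m → ℝ}
    (hlam : ∀ i, 0 < lam i) {z e a : ℝ} (hz : 0 < z) (he : 0 < e) (he1 : e ≤ 1)
    (ha : 0 ≤ a) (hlog : Real.log (m + 1) ≤ e ^ 2 * z)
    (hmean : ∀ i, (1 - a) * lam i ≤ colMean D (cappedLoad α w (lam i / z) i)) :
    (1 - a - 2 * e) * f lam ≤ ∫ P, epValue f α w P ∂(law D) := by
  obtain ⟨Z, hZi, hZ, -, hdev⟩ := exists_lower_deviation he he1 hz hlog hlam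
    (fun i => colBounded_cappedLoad hpos hw (div_pos (hlam i) hz).le i) hmean
    (fun i => by nlinarith [hlam i])
  have hfl := hf.pos lam hlam
  have hint : Integrable (fun P => (1 - a - Z P) * f lam) (law D) :=
    ((integrable_const _).sub hZi).mul_const _
  calc (1 - a - 2 * e) * f lam ≤ ∫ P, (1 - a - Z P) * f lam ∂(law D) := by
        rw [integral_mul_const, integral_sub (integrable_const _) hZi]
        simp only [integral_const, probReal_univ, smul_eq_mul, one_mul]
        exact mul_le_mul_of_nonneg_right (by linarith) hfl.le
    _ ≤ _ := by
        refine integral_law_mono hint (integrable_epValue hf hpos hB hm hn α hw) fun P hP => ?_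
        have hlp := fun i => epAllocation_load_pos hpos hn (α := α) hw hP i
        -- Homogeneity needs a positive factor; when `Z P` is too large, positivity of `f` already
        -- gives the bound.
        rcases le_or_gt (1 - a - Z P) 0 with h | h
        · exact (mul_nonpos_of_nonpos_of_nonneg h hfl.le).trans (hf.pos _ hlp).le
        · rw [← hf.homog _ _ h hlam]
          refine hf.mono _ _ (fun i => mul_pos h (hlam i)) fun i => ?_
          have h1 := hdev P i
          have h2 : ∑ j, cappedLoad α w (lam i / z) i (P j) ≤ load P (epAllocation α w P) i := by
            refine Finset.sum_le_sum fun j _ => ?_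
            exact mul_le_mul_of_nonneg_left (min_le_left _ _)
              (share_pos hw (hpos j _ (hP j)) i).le
          linarith

theorem optMax_nonneg {f : (Fin m → ℝ) → ℝ} (hf : WellBehaved f) (P : Instance m n) :
    0 ≤ optMax f P :=
  Real.sSup_nonneg fun _ ⟨_, _, hl, hv⟩ => hv ▸ (hf.pos _ hl).le

/-- The expected optimum is at most the value of the expected loads of near-optimal solutions. -/
theorem Superadditive.integral_optMax_le {f : (Fin m → ℝ) → ℝ} (hf : WellBehaved f)
    (hs : Superadditive f) {D : Fin n → PMF (Fin m → ℝ)} {B : Fin m → ℝ}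
    (hpos : PositiveWeights D) (hB : WeightsLE D B) {ε : ℝ} {X : Instance m n → Assignment m n}
    (hX : ∀ P, InSupport D P → IsFeasible (X P) ∧ (∀ i, 0 < load P (X P) i) ∧
      (1 - ε) * optMax f P ≤ f (load P (X P)))
    (hL : ∀ i, 0 < ∫ P, load P (X P) i ∂(law D)) :
    (1 - ε) * ∫ P, optMax f P ∂(law D) ≤ f fun i => ∫ P, load P (X P) i ∂(law D) := by
  have hfi := integrable_objective hf hpos hB (fun P hP => (hX P hP).1) fun P hP => (hX P hP).2.1
  by_cases hi : Integrable (optMax f) (law D)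
  · rw [← integral_const_mul]
    exact (integral_law_mono (hi.const_mul _) hfi fun P hP => (hX P hP).2.2).trans
      (hs.integral_le hf (fun P hP => (hX P hP).2.1)
        (fun i => integrable_load hpos hB (fun P hP => (hX P hP).1) i) hL hfi)
  -- Without integrability the integral is zero by convention, and the claim is positivity of `f`.
  · rw [integral_undef hi, mul_zero]
    exact (hf.pos _ hL).le

/-- Mixing an allocation with the uniform one. -/
noncomputable def mixed (e : ℝ) (X : Assignment m n) : Assignment m n :=
  fun j i => (1 - e) * X j i + e / m

theorem IsFeasible.mixed {e : ℝ} (he : 0 ≤ e) (he1 : e ≤ 1) (hm : 0 < m) {X : Assignment m n}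
    (hX : IsFeasible X) : IsFeasible (mixed e X) := by
  have hm' : (0:ℝ) < m := by exact_mod_cast hm
  have hm1 : (1:ℝ) ≤ m := by exact_mod_cast hm
  constructor
  · intro j i
    obtain ⟨h0, h1⟩ := hX.1 j i
    have h2 : e / m ≤ e := div_le_self he hm1
    have h3 : (1 - e) * X j i ≤ 1 - e := mul_le_of_le_one_right (by linarith) h1
    refine ⟨add_nonneg (mul_nonneg (by linarith) h0) (by positivity), ?_⟩
    change (1 - e) * X j i + e / m ≤ 1
    linarith
  · intro j
    simp only [OnlineAllocation.mixed]
    rw [Finset.sum_add_distrib, ← Finset.mul_sum, hX.2 j]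
    simp only [Finset.sum_const, Finset.card_univ, Fintype.card_fin, nsmul_eq_mul]
    field_simp; ring

/-- For a loss of `1 - e`, mixing lifts every expected load to at least `e / m` times the total
expected weight of the agent. The samples estimate that weight, so the range of targets becomes
bounded. -/
theorem integral_load_mixed {D : Fin n → PMF (Fin m → ℝ)} {B : Fin m → ℝ}
    (hpos : PositiveWeights D) (hB : WeightsLE D B) {X : Instance m n → Assignment m n}
    (hX : ∀ P, InSupport D P → IsFeasible (X P)) (e : ℝ) (i : Fin m) :
    ∫ P, load P (mixed e (X P)) i ∂(law D) = (1 - e) * ∫ P, load P (X P) i ∂(law D)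
      + e / m * colMean D fun p => p i := by
  have hw := (colBounded_weight hpos hB i).integrable
  rw [← integral_colSum hw, ← integral_const_mul, ← integral_const_mul,
    ← integral_add ((integrable_load hpos hB hX i).const_mul _) ((integrable_colSum hw).const_mul _)]
  congr 1
  ext P
  simp only [load, mixed, Finset.mul_sum, ← Finset.sum_add_distrib]
  exact Finset.sum_congr rfl fun j _ => by ring

/-- Price vectors of the learner for maximization: target loads `θ ^ k i` and prices `θ ^ l i`. -/
noncomputable def gridWeights (γ θ : ℝ) (k : Fin m → ℤ) (l : Fin m → ℕ) : Fin m → ℝ :=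
  fun i => (θ ^ l i / θ ^ k i) ^ γ

theorem gridWeights_pos {γ θ : ℝ} (hθ : 0 < θ) (k : Fin m → ℤ) (l : Fin m → ℕ) (i : Fin m) :
    0 < gridWeights γ θ k l i :=
  Real.rpow_pos_of_pos (div_pos (pow_pos hθ _) (zpow_pos hθ _)) _

/-- Some grid point has nearly optimal targets that its EP-allocation nearly meets. -/
theorem exists_grid_target {D : Fin n → PMF (Fin m → ℝ)} (hpos : PositiveWeights D) (hm : 0 < m)
    (hn : 0 < n) {X : Instance m n → Assignment m n} (hX : ∀ P, InSupport D P → IsFeasible (X P))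
    {z : ℝ} (hz : 0 < z) (hsmall : ItemsSmallFor D (4 * z) X) {γ η e : ℝ} {K : ℕ} (hγ : 0 < γ)
    (hη : 0 < η) (he : (γ + 1) * η ≤ e) (he1 : e ≤ 1 / 100)
    (hρ : (m : ℝ) ^ (1 / (γ + 1)) ≤ 1 + 2 * e)
    (hK : 32 * (m : ℝ) ^ 2 / e ^ 2 ≤ (1 + η) ^ K) :
    ∃ (k : Fin m → ℤ) (l : Fin m → ℕ), (∀ i, l i ≤ K) ∧
      (∀ i, e * (colMean D fun p => p i) ≤ 2 * m * (1 + η) ^ k i) ∧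
      (∀ i, (1 + η) ^ k i ≤ colMean D fun p => p i) ∧
      (∀ i, (1 - 2 * e) * ∫ P, load P (X P) i ∂(law D) ≤ (1 + η) ^ k i) ∧
      ∀ i, (1 - 5 * e) * (1 + η) ^ k i ≤ colMean D
        (cappedLoad γ (gridWeights γ (1 + η) k l) ((1 + η) ^ k i / z) i) := by
  have he0 : 0 < e := lt_of_lt_of_le (by positivity) he
  have hηe : η ≤ e := by nlinarith
  have hθ : 0 < 1 + η := by linarith
  have hm' : (0:ℝ) < m := by exact_mod_cast hm
  set L : Fin m → ℝ := fun i => ∫ P, load P (X P) i ∂(law D) with hLdef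
  set U : Fin m → ℝ := fun i => colMean D fun p => p i with hUdef
  have hL : ∀ i, 0 < L i := hsmall.integral_pos hpos hn (by linarith)
  have hB : WeightsLE D fun i => L i / (4 * z) := hsmall
  have hLU : ∀ i, L i ≤ U i := integral_load_le_colMean hpos hB hX
  have hXm : ∀ P, InSupport D P → IsFeasible (mixed e (X P)) := fun P hP =>
    (hX P hP).mixed he0.le (by linarith) hm
  set L' : Fin m → ℝ := fun i => ∫ P, load P (mixed e (X P)) i ∂(law D) with hL'def
  have hL'eq : ∀ i, L' i = (1 - e) * L i + e / m * U i := integral_load_mixed hpos hB hX e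
  have hUpos : ∀ i, 0 < U i := fun i => (hL i).trans_le (hLU i)
  have hL'1 : ∀ i, (1 - e) * L i ≤ L' i := fun i => by
    have := hUpos i
    have : 0 ≤ e / m * U i := by positivity
    rw [hL'eq]; linarith
  have hL'2 : ∀ i, e / m * U i ≤ L' i := fun i => by
    have : 0 ≤ (1 - e) * L i := mul_nonneg (by linarith) (hL i).le
    rw [hL'eq]; linarith
  have hL'3 : ∀ i, L' i ≤ U i := integral_load_le_colMean hpos hB hXm
  have hL'pos : ∀ i, 0 < L' i := fun i =>
    lt_of_lt_of_le (mul_pos (by linarith) (hL i)) (hL'1 i)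
  -- Targets are rounded down to powers of `1 + η`, hence remain attainable.
  choose k hk using fun i => exists_mem_Ico_zpow (hL'pos i) (by linarith : 1 < 1 + η)
  have hlam : ∀ i, 0 < (1 + η) ^ k i := fun i => zpow_pos hθ _
  have hkL : ∀ i, L' i ≤ (1 + η) * (1 + η) ^ k i := fun i => by
    have := (hk i).2.le
    rwa [zpow_add_one₀ hθ.ne', mul_comm] at this
  have hUk : ∀ i, e * U i ≤ 2 * m * (1 + η) ^ k i := fun i => by
    have h1 := (hL'2 i).trans (hkL i)
    rw [div_mul_eq_mul_div, div_le_iff₀ hm'] at h1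
    refine h1.trans ?_
    have := mul_pos hm' (hlam i)
    nlinarith
  have hLk : ∀ i, (1 - 2 * e) * L i ≤ (1 + η) ^ k i := fun i => by
    have h1 := (hL'1 i).trans (hkL i)
    have h2 : (1 - 2 * e) * (1 + η) ≤ 1 - e := by nlinarith
    have h3 : (1 - 2 * e) * L i * (1 + η) ≤ (1 + η) ^ k i * (1 + η) := by
      have := mul_le_mul_of_nonneg_right h2 (hL i).le
      linarith
    exact le_of_mul_le_mul_right h3 hθ
  have hm2 : 0 < (m:ℝ) ^ 2 / e ^ 2 := by positivity
  obtain ⟨l, hlK, hl⟩ := exists_share_colMean_ge hpos hB hlam hm hXm (fun i => (hk i).1)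
    (R := 2 * m / e) (K := K) (fun i => by
      rw [div_mul_eq_mul_div, le_div_iff₀ he0]
      linarith [hUk i]) hγ hη he (by linarith) hρ (by
      have h1 : (m:ℝ) * (2 * m / e) = e * (2 * (m ^ 2 / e ^ 2)) := by field_simp
      rw [h1]
      refine mul_lt_mul_of_pos_left (lt_of_lt_of_le ?_ hK) he0
      rw [mul_div_assoc]; linarith)
  refine ⟨k, l, hlK, hUk, fun i => (hk i).1.trans (hL'3 i), hLk, fun i => ?_⟩
  -- The cap is inactive at this grid point: the factor `4` in the small items assumption covers the
  -- gap between the target and the original expected load.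
  have hcap : colMean D (cappedLoad γ (gridWeights γ (1 + η) k l) ((1 + η) ^ k i / z) i)
      = colMean D fun p => share γ (fun r => ((1 + η) ^ l r / (1 + η) ^ k r) ^ γ) p i * p i := by
    refine colMean_congr fun j p hp => ?_
    have h1 : p i ≤ (1 + η) ^ k i / z := by
      refine (hsmall j p hp i).trans ?_
      rw [div_le_div_iff₀ (by linarith) hz]
      have := hLk i
      have h4 : L i ≤ 4 * (1 + η) ^ k i := by nlinarith [hL i]
      nlinarith
    rw [cappedLoad, min_eq_left h1]; rfl
  rw [hcap]
  have h2 := hl i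
  set M := colMean D fun p => share γ (fun r => ((1 + η) ^ l r / (1 + η) ^ k r) ^ γ) p i * p i
  have h3 : (1 - 5 * e) * ((1 + e) * (1 + 2 * e)) ≤ 1 - e := by nlinarith [mul_pos he0 he0, mul_pos (mul_pos he0 he0) he0]
  have h4 := mul_le_mul_of_nonneg_right h3 (hlam i).le
  have h5 : 0 < (1 + e) * (1 + 2 * e) := by positivity
  refine le_of_mul_le_mul_left (?_ : (1 + e) * (1 + 2 * e) * _ ≤ (1 + e) * (1 + 2 * e) * M) h5
  linarith

/-! ### The learner for maximization -/

theorem one_sub_card_mul_le {α ι : Type*} [MeasurableSpace α] {μ : Measure α}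
    [IsProbabilityMeasure μ] [Fintype ι] {G : Set α} {B : ι → Set α} {r : ℝ}
    (hGB : ∀ x, (∀ i, x ∉ B i) → x ∈ G) (hB : ∀ i, μ.real (B i) ≤ r) :
    1 - Fintype.card ι * r ≤ μ.real G := by
  have h1 : (Set.univ : Set α) ⊆ G ∪ ⋃ i, B i := fun x _ => by
    by_cases h : ∀ i, x ∉ B i
    · exact Or.inl (hGB x h)
    · push Not at h
      exact Or.inr (Set.mem_iUnion.2 h)
  have h2 : μ.real Set.univ ≤ μ.real G + ∑ i, μ.real (B i) :=
    (measureReal_mono h1).trans ((measureReal_union_le _ _).trans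
      (add_le_add_right (measureReal_iUnion_fintype_le _) _))
  have h3 : ∑ i, μ.real (B i) ≤ Fintype.card ι * r := by
    refine (Finset.sum_le_sum fun i _ => hB i).trans ?_
    simp
  rw [probReal_univ] at h2
  linarith

theorem exists_near_max {α : Type*} {s : Set α} {v : α → ℝ} (hne : s.Nonempty)
    (hv : ∀ a ∈ s, 0 < v a) {C : ℝ} (hC : ∀ a ∈ s, v a ≤ C) {e : ℝ} (he : 0 < e) :
    ∃ a ∈ s, ∀ b ∈ s, (1 - e) * v b ≤ v a := by
  obtain ⟨a0, ha0⟩ := hne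
  have hbdd : BddAbove (v '' s) := ⟨C, by rintro _ ⟨a, ha, rfl⟩; exact hC a ha⟩
  have hpos : 0 < sSup (v '' s) := (hv a0 ha0).trans_le (le_csSup hbdd ⟨a0, ha0, rfl⟩)
  obtain ⟨_, ⟨a, ha, rfl⟩, hlt⟩ := exists_lt_of_lt_csSup (Set.Nonempty.image v ⟨a0, ha0⟩)
    (show (1 - e) * sSup (v '' s) < sSup (v '' s) by nlinarith)
  refine ⟨a, ha, fun b hb => ?_⟩
  have h1 := le_csSup hbdd ⟨b, hb, rfl⟩
  rcases le_or_gt (1 - e) 0 with h | h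
  · exact (mul_nonpos_of_nonpos_of_nonneg h (hv b hb).le).trans (hv a ha).le
  · exact (mul_le_mul_of_nonneg_left h1 h.le).trans hlt.le

/-- Grid points whose targets are in the range suggested by the samples and are nearly met by the
capped loads of the samples. -/
def IsCandidate {N : ℕ} (γ θ e z : ℝ) (K : ℕ) (S : Fin N → Instance m n)
    (c : (Fin m → ℤ) × (Fin m → ℕ)) : Prop :=
  (∀ i, c.2 i ≤ K) ∧
    (∀ i, e * total S (fun p => p i) ≤ 4 * m * (N * θ ^ c.1 i) ∧
      N * θ ^ c.1 i ≤ 2 * total S fun p => p i) ∧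
    ∀ i, N * ((1 - 7 * e) * θ ^ c.1 i) ≤
      total S (cappedLoad γ (gridWeights γ θ c.1 c.2) (θ ^ c.1 i / z) i)

/-- The upper range condition bounds `f` on the candidates, so a near-maximizer exists without
finiteness of the candidate set. -/
theorem exists_gridLearner {f : (Fin m → ℝ) → ℝ} (hf : WellBehaved f) {N : ℕ} (hN : 0 < N)
    {γ θ e : ℝ} (z : ℝ) (K : ℕ) (hθ : 0 < θ) (he : 0 < e) :
    ∃ A : Learner m n N, (∀ S i, 0 < A S i) ∧ ∀ S c, IsCandidate γ θ e z K S c →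
      ∃ c', IsCandidate γ θ e z K S c' ∧ A S = gridWeights γ θ c'.1 c'.2 ∧
        (1 - e) * f (fun i => θ ^ c.1 i) ≤ f fun i => θ ^ c'.1 i := by
  have hN' : (0:ℝ) < N := by exact_mod_cast hN
  have key : ∀ S : Fin N → Instance m n, ∃ w : Fin m → ℝ, (∀ i, 0 < w i) ∧
      ∀ c, IsCandidate γ θ e z K S c → ∃ c', IsCandidate γ θ e z K S c' ∧
        w = gridWeights γ θ c'.1 c'.2 ∧
        (1 - e) * f (fun i => θ ^ c.1 i) ≤ f fun i => θ ^ c'.1 i := by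
    intro S
    by_cases hne : {c | IsCandidate γ θ e z K S c}.Nonempty
    · obtain ⟨c', hc', hmax⟩ := exists_near_max hne (v := fun c => f fun i => θ ^ c.1 i)
        (fun c _ => hf.pos _ fun i => zpow_pos hθ _)
        (C := f fun i => 2 / N * total S fun p => p i)
        (fun c hc => hf.mono _ _ (fun i => zpow_pos hθ _) fun i => by
          rw [div_mul_eq_mul_div, le_div_iff₀ hN', mul_comm]
          exact (hc.2.1 i).2) he
      exact ⟨gridWeights γ θ c'.1 c'.2, gridWeights_pos hθ _ _, fun c hc =>
        ⟨c', hc', rfl, hmax c hc⟩⟩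
    · exact ⟨fun _ => 1, fun _ => one_pos, fun c hc => absurd ⟨c, hc⟩ hne⟩
  choose A hA using key
  exact ⟨A, fun S => (hA S).1, fun S => (hA S).2⟩

/-- Capping weights at target over `z` makes items small relative to every grid target, including
targets far below `L`; hence the concentration bound applies uniformly to whatever the learner may
choose. -/
theorem Superadditive.exists_learner {f : (Fin m → ℝ) → ℝ} (hf : WellBehaved f)
    (hs : Superadditive f) (n : ℕ) (hm : 2 ≤ m) {N : ℕ} (hN : 0 < N)
    {γ η e z ε : ℝ} {K : ℕ} (hz : 0 < z) (hγ : 0 < γ)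
    (hη : 0 < η) (he : (γ + 1) * η ≤ e) (he1 : e ≤ 1 / 100)
    (hρ : (m : ℝ) ^ (1 / (γ + 1)) ≤ 1 + 2 * e)
    (hK : 32 * (m : ℝ) ^ 2 / e ^ 2 ≤ (1 + η) ^ K) (hlog : Real.log (m + 1) ≤ e ^ 2 * z) :
    ∃ A : Learner m n N, (∀ S i, 0 < A S i) ∧
      ∀ D : Fin n → PMF (Fin m → ℝ), PositiveWeights D → SmallItemsMax f D ε (4 * z) →
        1 - 4 * m * ((K : ℝ) + 1) ^ (2 * m) * Real.exp (-(N * (e ^ 2 * z))) ≤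
          (sampleLaw N D).real {S | Integrable (epValue f γ (A S)) (law D) ∧
            (1 - 14 * e) * ((1 - ε) * ∫ P, optMax f P ∂(law D)) ≤
              ∫ P, epValue f γ (A S) P ∂(law D)} := by
  have he0 : 0 < e := lt_of_lt_of_le (by positivity) he
  have hηe : η ≤ e := by nlinarith
  have hθ : 0 < 1 + η := by linarith
  have hm0 : 0 < m := by omega
  have hm' : (2:ℝ) ≤ m := by exact_mod_cast hm
  have hN' : (0:ℝ) < N := by exact_mod_cast hN
  obtain ⟨A, hApos, hA⟩ := exists_gridLearner (n := n) hf hN (γ := γ) z K hθ he0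
  refine ⟨A, hApos, fun D hpos ⟨X, hX, hsmall⟩ => ?_⟩
  obtain ⟨P0, hP0⟩ := exists_inSupport D
  have hn : 0 < n := items_pos_of_load_pos ⟨0, hm0⟩ ((hX P0 hP0).2.1 _)
  have hXf : ∀ P, InSupport D P → IsFeasible (X P) := fun P hP => (hX P hP).1
  have hL := hsmall.integral_pos hpos hn (by linarith)
  have hB : WeightsLE D fun i => (∫ P, load P (X P) i ∂(law D)) / (4 * z) := hsmall
  obtain ⟨k, l, hlK, hkU, hkU', hkL, hkl⟩ :=
    exists_grid_target hpos hm0 hn hXf hz hsmall hγ hη he he1 hρ hK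
  set L : Fin m → ℝ := fun i => ∫ P, load P (X P) i ∂(law D) with hLdef
  set U : Fin m → ℝ := fun i => colMean D fun p => p i with hUdef
  have hLU : ∀ i, L i ≤ U i := integral_load_le_colMean hpos hB hXf
  have hU : ∀ i, 0 < U i := fun i => (hL i).trans_le (hLU i)
  have hUb : ∀ i, ColBounded D (fun p => p i) (U i / z) := fun i j p hp =>
    ⟨(hpos j p hp i).le, (hsmall j p hp i).trans (by
      have h1 := hLU i
      have h2 := hL i
      rw [div_le_div_iff₀ (by linarith) hz]
      have : L i * z ≤ U i * z := mul_le_mul_of_nonneg_right h1 hz.le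
      have : 0 < U i * z := mul_pos (hU i) hz
      change L i * z ≤ _
      linarith)⟩
  have heU : ∀ i, 0 < e * U i / (8 * m) := fun i => by
    have := hU i
    positivity
  -- The base point depends on the distribution but not on the samples, and only the analysis uses
  -- it: it fixes the class for the union bound.
  choose k0 hk0 using fun i => exists_mem_Ico_zpow (heU i) (by linarith : 1 < 1 + η)
  -- the deterministic class of grid points the learner can end up with
  let ck : (Fin m → Fin (K + 1) × Fin (K + 1)) → Fin m → ℤ := fun c i => k0 i + ((c i).1 : ℕ)
  let cl : (Fin m → Fin (K + 1) × Fin (K + 1)) → Fin m → ℕ := fun c i => (c i).2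
  let cap : (Fin m → ℤ) → (Fin m → ℕ) → Fin m → (Fin m → ℝ) → ℝ := fun k l i =>
    cappedLoad γ (gridWeights γ (1 + η) k l) ((1 + η) ^ k i / z) i
  have hcap : ∀ k l i, ColBounded D (cap k l i) ((1 + η) ^ k i / z) := fun k l i =>
    colBounded_cappedLoad hpos (gridWeights_pos hθ k l) (div_pos (zpow_pos hθ _) hz).le i
  -- The test threshold `1 - 7 e` lies `2 e` below the guaranteed `1 - 5 e` of the good grid point
  -- and `2 e` above `1 - 9 e`. So outside these events the good point passes, and a point of true
  -- mean below `1 - 9 e` fails. Totals are needed only up to a factor two.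
  let Bad : (Fin m ⊕ Fin m) ⊕ ((Fin m → Fin (K + 1) × Fin (K + 1)) × Fin m) ⊕ Fin m →
      Set (Fin N → Instance m n) := fun b => match b with
    | Sum.inl (Sum.inl i) => {S | total S (fun p => p i) ≤ N * (U i - 2 * (1 / 4) * U i)}
    | Sum.inl (Sum.inr i) => {S | N * (U i + 2 * (1 / 4) * U i) ≤ total S fun p => p i}
    | Sum.inr (Sum.inl (c, i)) => {S | colMean D (cap (ck c) (cl c) i)
          ≤ (1 - 9 * e) * (1 + η) ^ ck c i ∧
        N * ((1 - 9 * e) * (1 + η) ^ ck c i + 2 * e * (1 + η) ^ ck c i)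
          ≤ total S (cap (ck c) (cl c) i)}
    | Sum.inr (Sum.inr i) => {S | total S (cap k l i)
          ≤ N * ((1 - 5 * e) * (1 + η) ^ k i - 2 * e * (1 + η) ^ k i)}
  have hBad : ∀ b, (sampleLaw N D).real (Bad b) ≤ Real.exp (-(N * (e ^ 2 * z))) := by
    have hquarter : Real.exp (-(N * ((1 / 4) ^ 2 * z))) ≤ Real.exp (-(N * (e ^ 2 * z))) := by
      refine Real.exp_le_exp.2 (neg_le_neg (mul_le_mul_of_nonneg_left ?_ hN'.le))
      exact mul_le_mul_of_nonneg_right (by nlinarith) hz.le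
    rintro ((i | i) | ⟨c, i⟩ | i)
    · exact ((hUb i).total_lower_tail hz (hU i) (by norm_num) (by norm_num) le_rfl le_rfl).trans
        hquarter
    · exact ((hUb i).total_upper_tail hz (hU i) (by norm_num) (by norm_num) le_rfl le_rfl).trans
        hquarter
    · by_cases h : colMean D (cap (ck c) (cl c) i) ≤ (1 - 9 * e) * (1 + η) ^ ck c i
      · refine le_trans (measureReal_mono fun S hS => hS.2) ((hcap (ck c) (cl c) i).total_upper_tail
          hz (zpow_pos hθ _) he0 (by linarith) h ?_)
        have : 0 < (1 + η) ^ ck c i := zpow_pos hθ _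
        nlinarith
      · have : Bad (Sum.inr (Sum.inl (c, i))) = ∅ :=
          Set.eq_empty_of_forall_notMem fun S hS => h hS.1
        rw [this, measureReal_empty]
        exact (Real.exp_pos _).le
    · refine (hcap k l i).total_lower_tail hz (zpow_pos hθ _) he0 (by linarith) (hkl i) ?_
      have : 0 < (1 + η) ^ k i := zpow_pos hθ _
      nlinarith
  have hcard : (Fintype.card ((Fin m ⊕ Fin m) ⊕ ((Fin m → Fin (K + 1) × Fin (K + 1)) × Fin m) ⊕ Fin m)
      : ℝ) ≤ 4 * m * ((K : ℝ) + 1) ^ (2 * m) := by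
    have h1 : (1:ℝ) ≤ ((K : ℝ) + 1) ^ (2 * m) := one_le_pow₀ (by linarith [Nat.cast_nonneg (α := ℝ) K])
    simp only [Fintype.card_sum, Fintype.card_prod, Fintype.card_fin, Fintype.card_fun]
    push_cast
    rw [← pow_two, ← pow_mul]
    nlinarith
  have hgood := one_sub_card_mul_le (μ := sampleLaw N D) (G := {S |
      Integrable (epValue f γ (A S)) (law D) ∧
            (1 - 14 * e) * ((1 - ε) * ∫ P, optMax f P ∂(law D)) ≤
              ∫ P, epValue f γ (A S) P ∂(law D)}) (B := Bad) (fun S hS => ?_) hBad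
  · refine le_trans ?_ hgood
    have := mul_le_mul_of_nonneg_right hcard (Real.exp_pos (-(N * (e ^ 2 * z)))).le
    linarith
  have hS1 : ∀ i, N * U i < 2 * total S fun p => p i := fun i => by
    have := not_le.1 (show ¬ total S (fun p => p i) ≤ N * (U i - 2 * (1 / 4) * U i) from
      hS (Sum.inl (Sum.inl i)))
    linarith
  have hS2 : ∀ i, total S (fun p => p i) < 2 * (N * U i) := fun i => by
    have h1 := not_le.1 (show ¬ N * (U i + 2 * (1 / 4) * U i) ≤ total S (fun p => p i) from
      hS (Sum.inl (Sum.inr i)))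
    have h2 : 0 < N * U i := mul_pos hN' (hU i)
    linarith
  have hcand : IsCandidate γ (1 + η) e z K S (k, l) := by
    refine ⟨hlK, fun i => ⟨?_, ?_⟩, fun i => ?_⟩
    · have h1 := mul_le_mul_of_nonneg_left (hkU i) hN'.le
      have h2 := mul_le_mul_of_nonneg_left (hS2 i).le he0.le
      have : e * (2 * (N * U i)) = 2 * (N * (e * U i)) := by ring
      change e * _ ≤ 4 * m * (N * (1 + η) ^ k i)
      linarith
    · exact (mul_le_mul_of_nonneg_left (hkU' i) hN'.le).trans (hS1 i).le
    · have h1 := (not_le.1 (show ¬ total S (cap k l i) ≤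
        N * ((1 - 5 * e) * (1 + η) ^ k i - 2 * e * (1 + η) ^ k i) from
        hS (Sum.inr (Sum.inr i)))).le
      refine le_trans (le_of_eq ?_) h1
      ring
  obtain ⟨⟨k', l'⟩, ⟨hl', hr', ht'⟩, hAS, hbest⟩ := hA S _ hcand
  simp only at hl' hr' ht' hAS hbest
  -- Chosen targets lie between `e U / (8 m)` and `4 U`, a ratio `32 m / e`; `hK` covers it together
  -- with the rounding in `k0`.
  have hrange : ∀ i, ∃ a : Fin (K + 1), k' i = k0 i + (a : ℕ) := by
    intro i
    have hp' : 0 < (1 + η) ^ k' i := zpow_pos hθ _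
    have h1 : e * U i ≤ 8 * m * (1 + η) ^ k' i := by
      have h2 := mul_le_mul_of_nonneg_left (hS1 i).le he0.le
      have h3 := (hr' i).1
      have h4 : N * (e * U i) ≤ N * (8 * m * (1 + η) ^ k' i) := by linarith
      exact le_of_mul_le_mul_left h4 hN'
    have h2 : (1 + η) ^ k' i ≤ 4 * U i := by
      have h3 := (hr' i).2
      have h4 : N * (1 + η) ^ k' i ≤ N * (4 * U i) := by linarith [hS2 i]
      exact le_of_mul_le_mul_left h4 hN'
    have h3 : (1 + η) ^ k0 i ≤ (1 + η) ^ k' i := by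
      refine (hk0 i).1.trans ?_
      rw [div_le_iff₀ (by linarith)]
      linarith
    have h4 : k0 i ≤ k' i := (zpow_le_zpow_iff_right₀ (by linarith)).1 h3
    have h5 : k' i ≤ k0 i + K := by
      refine (zpow_le_zpow_iff_right₀ (by linarith : 1 < 1 + η)).1 ?_
      rw [zpow_add₀ hθ.ne', zpow_natCast]
      have h6 : e * U i ≤ 8 * m * ((1 + η) ^ k0 i * (1 + η)) := by
        have := (hk0 i).2.le
        rw [zpow_add_one₀ hθ.ne', div_le_iff₀ (by linarith)] at this
        linarith
      have hp0 : 0 < (1 + η) ^ k0 i := zpow_pos hθ _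
      have h7 : e * (1 + η) ^ k' i ≤ e * ((1 + η) ^ k0 i * (32 * m ^ 2 / e ^ 2)) := by
        have h8 : e * ((1 + η) ^ k0 i * (32 * m ^ 2 / e ^ 2)) = (1 + η) ^ k0 i * (32 * m ^ 2 / e) := by
          field_simp
        have h9 : 32 * (m:ℝ) * (1 + η) ≤ 32 * m ^ 2 / e := by
          rw [le_div_iff₀ he0]
          have : (1 + η) * e ≤ 1 := by nlinarith
          have h11 : 32 * (m:ℝ) * ((1 + η) * e) ≤ 32 * m * m :=
            mul_le_mul_of_nonneg_left (by linarith) (by linarith)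
          nlinarith
        rw [h8]
        calc e * (1 + η) ^ k' i ≤ e * (4 * U i) := mul_le_mul_of_nonneg_left h2 he0.le
          _ ≤ (1 + η) ^ k0 i * (32 * m * (1 + η)) := by linarith
          _ ≤ _ := mul_le_mul_of_nonneg_left h9 hp0.le
      exact (le_of_mul_le_mul_left h7 he0).trans (mul_le_mul_of_nonneg_left hK hp0.le)
    exact ⟨⟨(k' i - k0 i).toNat, by omega⟩, by simp only; omega⟩
  choose a ha using hrange
  let c : Fin m → Fin (K + 1) × Fin (K + 1) := fun i => (a i, ⟨l' i, Nat.lt_succ_iff.2 (hl' i)⟩)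
  have hck : ck c = k' := funext fun i => (ha i).symm
  have hcl : cl c = l' := rfl
  have hmean : ∀ i, (1 - 9 * e) * (1 + η) ^ k' i ≤ colMean D (cap k' l' i) := by
    intro i
    by_contra hcon
    refine hS (Sum.inr (Sum.inl (c, i))) ?_
    change _ ∧ _
    rw [hck, hcl]
    refine ⟨(not_le.1 hcon).le, le_trans (le_of_eq ?_) (ht' i)⟩
    ring
  have hval := Superadditive.le_integral_epValue hf hpos hB hm0 hn (gridWeights_pos hθ k' l')
    (fun i => zpow_pos hθ (k' i)) hz he0 (by linarith) (by linarith : 0 ≤ 9 * e) hlog hmean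
  change Integrable (epValue f γ (A S)) _ ∧ _ ≤ ∫ P, epValue f γ (A S) P ∂(law D)
  rw [hAS]
  refine ⟨integrable_epValue hf hpos hB hm0 hn γ (gridWeights_pos hθ k' l'), le_trans ?_ hval⟩
  have h2 := hs.integral_optMax_le hf hpos hB hX hL
  have h3 : (1 - 2 * e) * f L ≤ f fun i => (1 + η) ^ k i := by
    rw [← hf.homog _ _ (by linarith) hL]
    exact hf.mono _ _ (fun i => mul_pos (by linarith) (hL i)) hkL
  have hfL := hf.pos L hL
  -- Losses: `9 e` by the test, `2 e` by random deviations, `e` by near-maximization, `2 e` by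
  -- mixing and rounding the targets.
  have h5 : (1 - 14 * e) * f L ≤ (1 - 9 * e - 2 * e) * ((1 - e) * ((1 - 2 * e) * f L)) := by
    have : (1 - 14 * e) ≤ (1 - 9 * e - 2 * e) * ((1 - e) * (1 - 2 * e)) := by
      nlinarith [mul_pos he0 he0, mul_pos (mul_pos he0 he0) he0]
    have := mul_le_mul_of_nonneg_right this hfL.le
    linarith
  calc _ ≤ (1 - 14 * e) * f L := mul_le_mul_of_nonneg_left h2 (by linarith)
    _ ≤ _ := h5
    _ ≤ _ := mul_le_mul_of_nonneg_left ((mul_le_mul_of_nonneg_left h3 (by linarith)).trans hbest)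
        (by linarith)

/-! ### Minimization: unit costs of the agents -/

/-- The `i`-th unit vector shifted into the open orthant. -/
noncomputable def bump (i : Fin m) (δ : ℝ) : Fin m → ℝ := fun k => (if k = i then 1 else 0) + δ

theorem bump_pos (i : Fin m) {δ : ℝ} (hδ : 0 < δ) (k : Fin m) : 0 < bump i δ k := by
  unfold bump; split_ifs <;> linarith

/-- The limit value of the objective at the `i`-th unit vector. -/
noncomputable def unitCost (f : (Fin m → ℝ) → ℝ) (i : Fin m) : ℝ :=
  sInf ((fun δ => f (bump i δ)) '' Set.Ioi 0)

section UnitCost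

variable {f : (Fin m → ℝ) → ℝ}

theorem unitCost_le (hf : WellBehaved f) (i : Fin m) {δ : ℝ} (hδ : 0 < δ) :
    unitCost f i ≤ f (bump i δ) :=
  csInf_le ⟨0, by rintro _ ⟨δ, hδ, rfl⟩; exact (hf.pos _ (bump_pos i hδ)).le⟩ ⟨δ, hδ, rfl⟩

theorem exists_bump_le (i : Fin m) (h : 0 < unitCost f i) :
    ∃ δ, 0 < δ ∧ f (bump i δ) ≤ 2 * unitCost f i := by
  obtain ⟨_, ⟨δ, hδ, rfl⟩, hlt⟩ := exists_lt_of_csInf_lt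
    (s := (fun δ => f (bump i δ)) '' Set.Ioi 0) ⟨_, ⟨1, Set.mem_Ioi.2 one_pos, rfl⟩⟩
    (show unitCost f i < 2 * unitCost f i by linarith)
  exact ⟨δ, hδ, hlt.le⟩

/-- The vector `l` dominates its `i`-th component alone, except for the shift needed to stay in the
open orthant; by subadditivity that shift costs arbitrarily little. -/
theorem mul_unitCost_le (hf : WellBehaved f) (hs : Subadditive f) {l : Fin m → ℝ}
    (hl : ∀ i, 0 < l i) (i : Fin m) : l i * unitCost f i ≤ f l := by
  set one : Fin m → ℝ := fun _ => 1 with hone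
  have h1 : 0 < f one := hf.pos _ fun _ => one_pos
  refine le_of_forall_pos_le_add fun η hη => ?_
  set δ := η / f one with hδ
  have hδ0 : 0 < δ := by positivity
  have hd : 0 < δ / l i := div_pos hδ0 (hl i)
  calc l i * unitCost f i ≤ l i * f (bump i (δ / l i)) :=
        mul_le_mul_of_nonneg_left (unitCost_le hf i hd) (hl i).le
    _ = f fun k => l i * bump i (δ / l i) k := (hf.homog _ _ (hl i) (bump_pos i hd)).symm
    _ ≤ f fun k => l k + δ * one k := by
        refine hf.mono _ _ (fun k => mul_pos (hl i) (bump_pos i hd k)) fun k => ?_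
        have h2 : l i * bump i (δ / l i) k = l i * (if k = i then 1 else 0) + δ := by
          rw [bump, mul_add, mul_div_cancel₀ _ (hl i).ne']
        rw [h2, hone]
        split_ifs with h
        · subst h; linarith
        · have := hl k; linarith
    _ ≤ f l + f fun k => δ * one k := hs _ _ hl fun k => by simpa [hone] using hδ0
    _ = f l + η := by
        rw [hf.homog _ _ hδ0 fun _ => one_pos, hδ, div_mul_cancel₀ _ h1.ne']

theorem Subadditive.add_sum_le (hf : WellBehaved f) (hs : Subadditive f) {ι : Type*}
    (F : Finset ι) {l : Fin m → ℝ} (hl : ∀ i, 0 < l i) {c : ι → ℝ} (hc : ∀ a, 0 < c a)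
    {v : ι → Fin m → ℝ} (hv : ∀ a i, 0 < v a i) :
    f (fun k => l k + ∑ a ∈ F, c a * v a k) ≤ f l + ∑ a ∈ F, c a * f (v a) := by
  classical
  induction F using Finset.induction_on with
  | empty => simp
  | insert a F ha ih =>
    have h : (fun k => l k + ∑ b ∈ insert a F, c b * v b k)
        = fun k => (l k + ∑ b ∈ F, c b * v b k) + c a * v a k := by
      ext k; rw [Finset.sum_insert ha]; ring
    rw [h, Finset.sum_insert ha]
    have h1 := hs (fun k => l k + ∑ b ∈ F, c b * v b k) (fun k => c a * v a k)
      (fun k => add_pos_of_pos_of_nonneg (hl k)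
        (Finset.sum_nonneg fun b _ => (mul_pos (hc b) (hv b k)).le))
      (fun k => mul_pos (hc a) (hv a k))
    rw [hf.homog _ _ (hc a) (hv a)] at h1
    linarith

theorem attainable_bddBelow (hf : WellBehaved f) (P : Instance m n) :
    BddBelow (attainable f P) :=
  ⟨0, by rintro _ ⟨X, -, hl, rfl⟩; exact (hf.pos _ hl).le⟩

theorem optMin_nonneg (hf : WellBehaved f) (P : Instance m n) : 0 ≤ optMin f P :=
  Real.sInf_nonneg fun _ ⟨_, _, hl, hv⟩ => hv ▸ (hf.pos _ hl).le

theorem optMin_le (hf : WellBehaved f) {P : Instance m n} {X : Assignment m n}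
    (hX : IsFeasible X) (hl : ∀ i, 0 < load P X i) : optMin f P ≤ f (load P X) :=
  csInf_le (attainable_bddBelow hf P) ⟨X, hX, hl, rfl⟩

/-- Assigning almost everything to agent `i` shows that no agent can be free of cost if the
optimum is positive. -/
theorem unitCost_pos (hf : WellBehaved f) (hn : 0 < n) {P : Instance m n} (hP : ∀ j i, 0 < P j i)
    (hopt : 0 < optMin f P) (i : Fin m) : 0 < unitCost f i := by
  set C := ∑ j, ∑ k, P j k with hC
  have hC0 : 0 < C := Finset.sum_pos (fun j _ => Finset.sum_pos (fun k _ => hP j k)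
    ⟨i, Finset.mem_univ _⟩) ⟨⟨0, hn⟩, Finset.mem_univ _⟩
  suffices h : optMin f P / C ≤ unitCost f i from (div_pos hopt hC0).trans_le h
  refine le_csInf ⟨_, ⟨1, Set.mem_Ioi.2 one_pos, rfl⟩⟩ ?_
  rintro _ ⟨δ, hδ, rfl⟩
  have hδ' : 0 < δ := hδ
  have hs : 0 < 1 + m * δ := by positivity
  have hsum : ∑ k, bump i δ k = 1 + m * δ := by
    simp [bump, Finset.sum_add_distrib]
  have hfeas : IsFeasible (n := n) fun _ k => bump i δ k / (1 + m * δ) := by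
    refine ⟨fun j k => ⟨(div_pos (bump_pos i hδ' k) hs).le, ?_⟩, fun j => ?_⟩
    · rw [div_le_one hs, ← hsum]
      exact Finset.single_le_sum (f := bump i δ) (fun k _ => (bump_pos i hδ' k).le)
        (Finset.mem_univ k)
    · rw [← Finset.sum_div, hsum, div_self hs.ne']
  have hl : ∀ k, 0 < load P (fun _ k => bump i δ k / (1 + m * δ)) k := fun k =>
    load_pos hn k (fun j => hP j k) fun j => div_pos (bump_pos i hδ' k) hs
  rw [div_le_iff₀ hC0, mul_comm]
  refine (optMin_le hf hfeas hl).trans ?_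
  rw [← hf.homog _ _ hC0 (bump_pos i hδ')]
  refine hf.mono _ _ hl fun k => ?_
  rw [load, hC, Finset.sum_mul]
  refine Finset.sum_le_sum fun j _ => ?_
  rw [mul_comm]
  refine mul_le_mul (Finset.single_le_sum (f := fun k => P j k) (fun k _ => (hP j k).le)
    (Finset.mem_univ k)) (div_le_self (bump_pos i hδ' k).le ?_)
    (div_pos (bump_pos i hδ' k) hs).le (Finset.sum_nonneg fun k _ => (hP j k).le)
  have : 0 ≤ m * δ := by positivity
  linarith

/-- Every load vector is dominated by one of comparable value whose entries, measured in unit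
costs, lie on a bounded geometric grid. -/
theorem exists_grid_inflation (hf : WellBehaved f) (hs : Subadditive f) (hm : 0 < m)
    (hc : ∀ i, 0 < unitCost f i) {L : Fin m → ℝ} (hL : ∀ i, 0 < L i) {η e : ℝ} {K : ℕ}
    (hη : 0 < η) (hηe : η ≤ e) (he1 : e ≤ 1 / 100) (hK : (m : ℝ) / e ≤ (1 + η) ^ K) :
    ∃ k : Fin m → ℕ, (∀ i, k i ≤ K) ∧ (∀ i, L i ≤ f L / (unitCost f i * (1 + η) ^ k i)) ∧
      f (fun i => f L / (unitCost f i * (1 + η) ^ k i)) ≤ (1 + 4 * e) * f L := by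
  have he0 : 0 < e := by linarith
  have hθ : 0 < 1 + η := by linarith
  have hm' : (0:ℝ) < m := by exact_mod_cast hm
  have hm1 : (1:ℝ) ≤ m := by exact_mod_cast hm
  set V := f L with hV
  have hV0 : 0 < V := hf.pos L hL
  -- Raising each entry to at least `c i` costs at most `2 e V` in total and confines `V / (lam i *
  -- unitCost f i)` to `[1, m / e]`.
  set c : Fin m → ℝ := fun i => e / m * (V / unitCost f i) with hcdef
  have hcpos : ∀ i, 0 < c i := fun i => by
    have := hc i
    positivity
  set lam : Fin m → ℝ := fun i => max (L i) (c i) with hlamdef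
  have hlam : ∀ i, 0 < lam i := fun i => lt_max_of_lt_left (hL i)
  have hflam : f lam ≤ (1 + 2 * e) * V := by
    choose δ hδ hδ2 using fun i => exists_bump_le (f := f) i (hc i)
    have h1 := hs.add_sum_le hf Finset.univ hL hcpos (v := fun i => bump i (δ i))
      fun i => bump_pos i (hδ i)
    have h2 : f lam ≤ f fun k => L k + ∑ a, c a * bump a (δ a) k := by
      refine hf.mono _ _ hlam fun k => ?_
      have h3 : c k * bump k (δ k) k ≤ ∑ a, c a * bump a (δ a) k :=
        Finset.single_le_sum (f := fun a => c a * bump a (δ a) k)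
          (fun a _ => (mul_pos (hcpos a) (bump_pos a (hδ a) k)).le) (Finset.mem_univ k)
      have h4 : c k ≤ c k * bump k (δ k) k := by
        have : 1 ≤ bump k (δ k) k := by
          simp only [bump, if_true]; linarith [hδ k]
        exact le_mul_of_one_le_right (hcpos k).le this
      refine max_le ?_ ?_
      · linarith [hcpos k]
      · linarith [hL k]
    have h5 : ∑ a, c a * f (bump a (δ a)) ≤ 2 * e * V := by
      calc ∑ a, c a * f (bump a (δ a)) ≤ ∑ _a : Fin m, 2 * e * V / m := by
            refine Finset.sum_le_sum fun a _ => ?_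
            refine (mul_le_mul_of_nonneg_left (hδ2 a) (hcpos a).le).trans (le_of_eq ?_)
            have := (hc a).ne'
            simp only [hcdef]; field_simp
        _ = 2 * e * V := by
            simp only [Finset.sum_const, Finset.card_univ, Fintype.card_fin, nsmul_eq_mul]
            field_simp
    linarith
  have hx1 : ∀ i, 1 ≤ V / (lam i * unitCost f i) := fun i => by
    rw [le_div_iff₀ (mul_pos (hlam i) (hc i)), one_mul, hlamdef]
    simp only
    rw [max_mul_of_nonneg _ _ (hc i).le]
    refine max_le (mul_unitCost_le hf hs hL i) ?_
    have h1 : c i * unitCost f i = e / m * V := by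
      have := (hc i).ne'
      simp only [hcdef]; field_simp
    rw [h1]
    refine mul_le_of_le_one_left hV0.le ?_
    rw [div_le_one hm']; linarith
  have hx2 : ∀ i, V / (lam i * unitCost f i) ≤ m / e := fun i => by
    have h1 : c i * unitCost f i = e / m * V := by
      have := (hc i).ne'
      simp only [hcdef]; field_simp
    have h2 : e / m * V ≤ lam i * unitCost f i := by
      rw [← h1]
      exact mul_le_mul_of_nonneg_right (le_max_right _ _) (hc i).le
    rw [div_le_div_iff₀ (mul_pos (hlam i) (hc i)) he0]
    rw [div_mul_eq_mul_div, div_le_iff₀ hm'] at h2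
    linarith
  choose k hk using fun i => exists_nat_pow_near (hx1 i) (by linarith : 1 < 1 + η)
  refine ⟨k, fun i => ?_, fun i => ?_, ?_⟩
  · refine (pow_le_pow_iff_right₀ (by linarith : 1 < 1 + η)).1 ?_
    exact (hk i).1.trans ((hx2 i).trans hK)
  · have h1 := (hk i).1
    rw [le_div_iff₀ (mul_pos (hlam i) (hc i))] at h1
    rw [le_div_iff₀ (mul_pos (hc i) (pow_pos hθ _))]
    refine le_trans ?_ h1
    have : L i ≤ lam i := le_max_left _ _
    have h2 := mul_le_mul_of_nonneg_right this (mul_pos (hc i) (pow_pos hθ (k i))).le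
    linarith
  · have h1 : f (fun i => V / (unitCost f i * (1 + η) ^ k i)) ≤ f fun i => (1 + η) * lam i := by
      refine hf.mono _ _ (fun i => div_pos hV0 (mul_pos (hc i) (pow_pos hθ _))) fun i => ?_
      have h2 := (hk i).2.le
      rw [div_le_iff₀ (mul_pos (hlam i) (hc i)), pow_succ] at h2
      rw [div_le_iff₀ (mul_pos (hc i) (pow_pos hθ _))]
      linarith
    rw [hf.homog _ _ hθ hlam] at h1
    have h3 := mul_le_mul_of_nonneg_left hflam hθ.le
    have h4 : (1 + η) * (1 + 2 * e) ≤ 1 + 4 * e := by nlinarith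
    have h5 := mul_le_mul_of_nonneg_right h4 hV0.le
    linarith

end UnitCost

/-! ### The learner for minimization -/

theorem colMean_share_pos {D : Fin n → PMF (Fin m → ℝ)} {B : Fin m → ℝ} (hpos : PositiveWeights D)
    (hB : WeightsLE D B) (hn : 0 < n) {α : ℝ} {w : Fin m → ℝ} (hw : ∀ i, 0 < w i) (i : Fin m) :
    0 < colMean D fun p => share α w p i * p i := by
  have hb := (colBounded_share (α := α) hpos hB hw i).integrable
  rw [← integral_colSum hb]
  obtain ⟨P0, hP0⟩ := exists_inSupport D
  have hp : ∀ P, InSupport D P → 0 < ∑ j, share α w (P j) i * P j i := fun P hP =>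
    epAllocation_load_pos hpos hn hw hP i
  exact (mul_pos (law_singleton_pos hP0) (hp _ hP0)).trans_le
    (le_hasSum (law_hasSum (integrable_colSum hb)) ⟨P0, hP0⟩
      fun P _ => (mul_pos (law_singleton_pos P.2) (hp _ P.2)).le)

/-- The expected objective of an EP-allocation is at most the value of its expected loads, up to
an error relative to reference loads compared to which the items are small. -/
theorem Subadditive.integral_epValue_le {f : (Fin m → ℝ) → ℝ} (hf : WellBehaved f)
    (hs : Subadditive f) {D : Fin n → PMF (Fin m → ℝ)} {L : Fin m → ℝ} {z e : ℝ} (hz : 0 < z)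
    (hpos : PositiveWeights D) (hB : WeightsLE D fun i => L i / z) (hL : ∀ i, 0 < L i)
    (hm : 0 < m) (hn : 0 < n) {α : ℝ} {w : Fin m → ℝ} (hw : ∀ i, 0 < w i)
    (he : 0 < e) (he1 : e ≤ 1) (hlog : Real.log (m + 1) ≤ e ^ 2 * z) :
    ∫ P, epValue f α w P ∂(law D) ≤ f (fun i => colMean D fun p => share α w p i * p i)
      + 2 * e * (f L + f fun i => colMean D fun p => share α w p i * p i) := by
  set M : Fin m → ℝ := fun i => colMean D fun p => share α w p i * p i with hMdef
  have hM : ∀ i, 0 < M i := colMean_share_pos hpos hB hn hw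
  obtain ⟨Z, hZi, hZ, hZ0, hdev⟩ := exists_upper_deviation (D := D)
    (g := fun i p => share α w p i * p i) (A := M) (V := fun i => L i + M i) he he1 hz hlog
    (fun i => add_pos (hL i) (hM i))
    (fun i j p hp => by
      obtain ⟨h0, h1⟩ := colBounded_share (α := α) hpos hB hw i j p hp
      exact ⟨h0, h1.trans (div_le_div_of_nonneg_right (by linarith [hM i]) hz.le)⟩)
    (fun i => le_rfl) (fun i => by linarith [hL i])
  have hfL := hf.pos L hL
  have hfM := hf.pos M hM
  have hint : Integrable (fun P => f M + Z P * (f L + f M)) (law D) :=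
    (integrable_const _).add (hZi.mul_const _)
  calc ∫ P, epValue f α w P ∂(law D) ≤ ∫ P, (f M + Z P * (f L + f M)) ∂(law D) := by
        refine integral_law_mono (integrable_epValue hf hpos hB hm hn α hw) hint fun P hP => ?_
        have hlp := fun i => epAllocation_load_pos hpos hn (α := α) hw hP i
        have hup : ∀ i, load P (epAllocation α w P) i ≤ M i + Z P * (L i + M i) := fun i => by
          have := hdev P i
          rw [load_epAllocation]
          linarith
        -- Homogeneity excludes the factor `0`, which monotonicity handles.
        rcases (hZ0 P).eq_or_lt with h | h
        · rw [← h, zero_mul, add_zero]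
          exact hf.mono _ _ hlp fun i => by have := hup i; rwa [← h, zero_mul, add_zero] at this
        · have hLM : ∀ i, 0 < L i + M i := fun i => add_pos (hL i) (hM i)
          calc epValue f α w P ≤ f fun i => M i + Z P * (L i + M i) := hf.mono _ _ hlp hup
            _ ≤ f M + f fun i => Z P * (L i + M i) := hs _ _ hM fun i => mul_pos h (hLM i)
            _ = f M + Z P * f fun i => L i + M i := by rw [hf.homog _ _ h hLM]
            _ ≤ _ := by
                have := mul_le_mul_of_nonneg_left (hs _ _ hL hM) h.le
                linarith
    _ = f M + (∫ P, Z P ∂(law D)) * (f L + f M) := by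
        rw [integral_add (integrable_const _) (hZi.mul_const _), integral_mul_const]
        simp
    _ ≤ _ := by
        have := mul_le_mul_of_nonneg_right hZ (by linarith : 0 ≤ f L + f M)
        linarith

theorem Subadditive.le_integral_optMin {f : (Fin m → ℝ) → ℝ} (hf : WellBehaved f)
    (hs : Subadditive f) {D : Fin n → PMF (Fin m → ℝ)} {B : Fin m → ℝ}
    (hpos : PositiveWeights D) (hB : WeightsLE D B) {ε : ℝ} {X : Instance m n → Assignment m n}
    (hX : ∀ P, InSupport D P → IsFeasible (X P) ∧ (∀ i, 0 < load P (X P) i) ∧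
      f (load P (X P)) ≤ (1 + ε) * optMin f P)
    (hL : ∀ i, 0 < ∫ P, load P (X P) i ∂(law D)) :
    f (fun i => ∫ P, load P (X P) i ∂(law D)) ≤ (1 + ε) * ∫ P, optMin f P ∂(law D) := by
  have hfi := integrable_objective hf hpos hB (fun P hP => (hX P hP).1) fun P hP => (hX P hP).2.1
  have hi : Integrable (optMin f) (law D) := by
    refine hfi.mono' (law_aestronglyMeasurable D _) ?_
    filter_upwards [ae_inSupport D] with P hP
    rw [Real.norm_eq_abs, abs_of_nonneg (optMin_nonneg hf P)]
    exact optMin_le hf (hX P hP).1 (hX P hP).2.1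
  rw [← integral_const_mul]
  exact (hs.le_integral hf (fun P hP => (hX P hP).2.1)
    (fun i => integrable_load hpos hB (fun P hP => (hX P hP).1) i) hL hfi).trans
    (integral_law_mono hfi (hi.const_mul _) fun P hP => (hX P hP).2.2)

/-- Price vectors of the learner for minimization, in terms of positive unit costs `s`. -/
noncomputable def costWeights (α θ : ℝ) (s : Fin m → ℝ) (u : Fin m → ℕ) : Fin m → ℝ :=
  fun i => (θ ^ u i * s i) ^ α

theorem costWeights_pos {α θ : ℝ} {s : Fin m → ℝ} (hθ : 0 < θ) (hs : ∀ i, 0 < s i) (u : Fin m → ℕ)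
    (i : Fin m) : 0 < costWeights α θ s u i :=
  Real.rpow_pos_of_pos (mul_pos (pow_pos hθ _) (hs i)) _

/-- The unknown common value `V` cancels, and target and price exponents merge into one bounded
exponent. -/
theorem share_costWeights {α θ V : ℝ} {s : Fin m → ℝ} (hθ : 0 < θ) (hs : ∀ i, 0 < s i)
    (hV : 0 < V) (k l : Fin m → ℕ) (p : Fin m → ℝ) (i : Fin m) :
    share α (fun r => (θ ^ l r / (V / (s r * θ ^ k r))) ^ α) p i
      = share α (costWeights α θ s fun r => l r + k r) p i := by
  rw [← share_const_mul (c := (1 / V) ^ α)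
    (Real.rpow_pos_of_pos (by positivity) _).ne' (w := costWeights α θ s fun r => l r + k r)]
  congr 1
  ext r
  have h1 : 0 < θ ^ (l r + k r) * s r := mul_pos (pow_pos hθ _) (hs r)
  rw [costWeights, ← Real.mul_rpow (by positivity) h1.le]
  congr 1
  rw [pow_add]
  have := (hs r).ne'
  field_simp

theorem Subadditive.exists_learner {f : (Fin m → ℝ) → ℝ} (hf : WellBehaved f)
    (hs : Subadditive f) (n : ℕ) (hm : 2 ≤ m) {N : ℕ} (hN : 0 < N)
    {γ η e z ε : ℝ} {K : ℕ} (hz : 0 < z) (hγ : 1 ≤ γ) (hε : 0 < ε)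
    (hη : 0 < η) (he : γ * η ≤ e) (he1 : e ≤ 1 / 100)
    (hρ : (m : ℝ) ^ (1 / γ) ≤ 1 + 2 * e)
    (hK : 32 * (m : ℝ) ^ 2 / e ^ 2 ≤ (1 + η) ^ K) (hlog : Real.log (m + 1) ≤ e ^ 2 * z) :
    ∃ A : Learner m n N, (∀ S i, 0 < A S i) ∧
      ∀ D : Fin n → PMF (Fin m → ℝ), PositiveWeights D → SmallItemsMin f D ε z →
        1 - 4 * m * (2 * (K : ℝ) + 1) ^ (2 * m) * Real.exp (-(N * (e ^ 2 * z))) ≤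
          (sampleLaw N D).real {S | Integrable (epValue f (-γ - 1) (A S)) (law D) ∧
            ∫ P, epValue f (-γ - 1) (A S) P ∂(law D) ≤
              (1 + 23 * e) * ((1 + ε) * ∫ P, optMin f P ∂(law D))} := by
  have he0 : 0 < e := lt_of_lt_of_le (by positivity) he
  have hηe : η ≤ e := by nlinarith
  have hθ : 0 < 1 + η := by linarith
  have hm0 : 0 < m := by omega
  have hm' : (2:ℝ) ≤ m := by exact_mod_cast hm
  have hN' : (0:ℝ) < N := by exact_mod_cast hN
  have hme : (m:ℝ) / e ≤ 32 * (m : ℝ) ^ 2 / e ^ 2 := by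
    rw [div_le_div_iff₀ he0 (by positivity)]
    have h1 : (m:ℝ) * e * e ≤ m * e * 1 := mul_le_mul_of_nonneg_left (by linarith) (by positivity)
    have h2 : (m:ℝ) * e * 1 ≤ m * e * (32 * m) := mul_le_mul_of_nonneg_left (by linarith) (by positivity)
    nlinarith
  -- The default `1` only keeps the class well defined: under the small items assumption the optimum
  -- is positive, hence so are all unit costs.
  set s : Fin m → ℝ := fun i => if 0 < unitCost f i then unitCost f i else 1 with hsdef
  have hspos : ∀ i, 0 < s i := fun i => by
    simp only [hsdef]; split_ifs with h
    · exact h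
    · exact one_pos
  let W : (Fin m → Fin (2 * K + 1)) → Fin m → ℝ := fun u =>
    costWeights (-γ - 1) (1 + η) s fun i => u i
  have hW : ∀ u i, 0 < W u i := fun u i => costWeights_pos hθ hspos _ i
  let g : (Fin m → Fin (2 * K + 1)) → Fin m → (Fin m → ℝ) → ℝ := fun u i p =>
    share (-γ - 1) (W u) p i * p i
  have hmin : ∀ S : Fin N → Instance m n, ∃ u, ∀ u',
      f (fun i => total S (g u i)) ≤ f fun i => total S (g u' i) := fun S => by
    obtain ⟨u, -, hu⟩ := Finset.exists_min_image (Finset.univ : Finset (Fin m → Fin (2 * K + 1)))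
      (fun u => f fun i => total S (g u i)) ⟨fun _ => 0, Finset.mem_univ _⟩
    exact ⟨u, fun u' => hu u' (Finset.mem_univ _)⟩
  choose sel hsel using hmin
  refine ⟨fun S => W (sel S), fun S i => hW _ i, fun D hpos ⟨X, hX, hsmall⟩ => ?_⟩
  obtain ⟨P0, hP0⟩ := exists_inSupport D
  have hn : 0 < n := items_pos_of_load_pos ⟨0, hm0⟩ ((hX P0 hP0).2.1 _)
  have hXf : ∀ P, InSupport D P → IsFeasible (X P) := fun P hP => (hX P hP).1
  have hopt : 0 < optMin f P0 := by
    have h1 := (hf.pos _ (hX P0 hP0).2.1).trans_le (hX P0 hP0).2.2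
    exact (pos_iff_pos_of_mul_pos h1).1 (by linarith)
  have hc : ∀ i, 0 < unitCost f i := unitCost_pos hf hn (fun j => hpos j _ (hP0 j)) hopt
  have hsc : s = unitCost f := funext fun i => if_pos (hc i)
  have hL := hsmall.integral_pos hpos hn hz
  have hB : WeightsLE D fun i => (∫ P, load P (X P) i ∂(law D)) / z := hsmall
  set L : Fin m → ℝ := fun i => ∫ P, load P (X P) i ∂(law D) with hLdef
  have hfL := hf.pos L hL
  obtain ⟨k, hkK, hLk, hfk⟩ := exists_grid_inflation hf hs hm0 hc hL hη hηe he1 (hme.trans hK)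
  set lam : Fin m → ℝ := fun i => f L / (unitCost f i * (1 + η) ^ k i) with hlamdef
  have hlam : ∀ i, 0 < lam i := fun i => (hL i).trans_le (hLk i)
  obtain ⟨l, hlK, hl⟩ := exists_share_colMean_le hpos hB hlam hm0 hXf hLk (K := K) hγ hη he hρ (by
    have h1 : e * (32 * (m : ℝ) ^ 2 / e ^ 2) ≤ e * (1 + η) ^ K := mul_le_mul_of_nonneg_left hK he0.le
    refine lt_of_lt_of_le ?_ h1
    have h2 : e * (32 * (m : ℝ) ^ 2 / e ^ 2) = 32 * m ^ 2 / e := by field_simp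
    rw [h2, lt_div_iff₀ he0]
    have h3 : (1 + e) * m * e ≤ 2 * m * 1 := by
      have : (1 + e) * e ≤ 2 := by nlinarith
      nlinarith
    nlinarith)
  let us : Fin m → Fin (2 * K + 1) := fun i => ⟨l i + k i, by
    have := hlK i; have := hkK i; omega⟩
  have hus : ∀ i, colMean D (g us i) ≤ (1 + 5 * e) * lam i := fun i => by
    have h1 : ∀ p : Fin m → ℝ,
        share (-γ - 1) (fun r => ((1 + η) ^ l r / lam r) ^ (-γ - 1)) p i = share (-γ - 1) (W us) p i :=
      fun p => by
        have := share_costWeights (α := -γ - 1) hθ hspos hfL k l p i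
        rw [hsc] at this
        rw [hlamdef, this]
        simp only [W, us, hsc]
    have h2 := hl i
    simp only [h1] at h2
    refine h2.trans (mul_le_mul_of_nonneg_right ?_ (hlam i).le)
    nlinarith [mul_pos he0 he0, mul_pos (mul_pos he0 he0) he0]
  let M : (Fin m → Fin (2 * K + 1)) → Fin m → ℝ := fun u i => colMean D (g u i)
  have hM : ∀ u i, 0 < M u i := fun u i => colMean_share_pos hpos hB hn (hW u) i
  have hgb : ∀ u i (V : ℝ), L i ≤ V → ColBounded D (g u i) (V / z) := fun u i V hV j p hp => by
    obtain ⟨h0, h1⟩ := colBounded_share (α := -γ - 1) hpos hB (hW u) i j p hp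
    exact ⟨h0, h1.trans (div_le_div_of_nonneg_right hV hz.le)⟩
  -- All parameters need a lower tail, but only the good one an upper tail. The scale `L i + M u i`
  -- dominates both the mean and the load against which items are small. The null event of samples
  -- off the support is removed so that sampled loads are positive.
  let Bad : ((Fin m → Fin (2 * K + 1)) × Fin m) ⊕ Fin m ⊕ Unit → Set (Fin N → Instance m n) :=
    fun b => match b with
    | Sum.inl (u, i) => {S | total S (g u i) ≤ N * (M u i - 2 * e * (L i + M u i))}
    | Sum.inr (Sum.inl i) => {S | N * ((1 + 5 * e) * lam i + 2 * e * (2 * lam i)) ≤ total S (g us i)}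
    | Sum.inr (Sum.inr _) => {S | ¬ ∀ r, InSupport D (S r)}
  have hBad : ∀ b, (sampleLaw N D).real (Bad b) ≤ Real.exp (-(N * (e ^ 2 * z))) := by
    rintro (⟨u, i⟩ | i | _)
    · exact (hgb u i (L i + M u i) (by linarith [hM u i])).total_lower_tail hz
        (add_pos (hL i) (hM u i)) he0 (by linarith) le_rfl (by linarith [hL i])
    · refine (hgb us i (2 * lam i) (by linarith [hLk i, hlam i])).total_upper_tail hz
        (by linarith [hlam i]) he0 (by linarith) (hus i) ?_
      nlinarith [hlam i]
    · have h0 : sampleLaw N D {S | ¬ ∀ r, InSupport D (S r)} = 0 :=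
        ae_iff.1 (ae_sample_inSupport N D)
      have h1 : (sampleLaw N D).real (Bad (Sum.inr (Sum.inr ()))) = 0 := by
        rw [measureReal_def]
        exact (congrArg ENNReal.toReal h0)
      exact h1.le.trans (Real.exp_pos _).le
  have hcard : (Fintype.card (((Fin m → Fin (2 * K + 1)) × Fin m) ⊕ Fin m ⊕ Unit) : ℝ)
      ≤ 4 * m * (2 * (K : ℝ) + 1) ^ (2 * m) := by
    have hK1 : (1:ℝ) ≤ 2 * (K:ℝ) + 1 := by linarith [Nat.cast_nonneg (α := ℝ) K]
    have h1 : (1:ℝ) ≤ (2 * (K : ℝ) + 1) ^ (2 * m) := one_le_pow₀ hK1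
    have h2 : (2 * (K : ℝ) + 1) ^ m ≤ (2 * (K : ℝ) + 1) ^ (2 * m) :=
      pow_le_pow_right₀ hK1 (by omega)
    simp only [Fintype.card_sum, Fintype.card_prod, Fintype.card_fin, Fintype.card_fun,
      Fintype.card_unit]
    push_cast
    have h3 := mul_le_mul_of_nonneg_right h2 (by linarith : (0:ℝ) ≤ m)
    nlinarith
  have hgood := one_sub_card_mul_le (μ := sampleLaw N D) (G := {S |
      Integrable (epValue f (-γ - 1) (W (sel S))) (law D) ∧
            ∫ P, epValue f (-γ - 1) (W (sel S)) P ∂(law D) ≤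
              (1 + 23 * e) * ((1 + ε) * ∫ P, optMin f P ∂(law D))}) (B := Bad)
    (fun S hS => ?_) hBad
  · refine le_trans ?_ hgood
    have := mul_le_mul_of_nonneg_right hcard (Real.exp_pos (-(N * (e ^ 2 * z)))).le
    linarith
  change Integrable (epValue f (-γ - 1) (W (sel S))) _ ∧
    ∫ P, epValue f (-γ - 1) (W (sel S)) P ∂(law D) ≤ _
  refine ⟨integrable_epValue hf hpos hB hm0 hn _ (hW _), ?_⟩
  have hsupp : ∀ r, InSupport D (S r) := by
    by_contra h
    exact hS (Sum.inr (Sum.inr ())) h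
  have htot : ∀ u i, 0 < total S (g u i) := fun u i =>
    Finset.sum_pos (fun r _ => epAllocation_load_pos hpos hn (hW u) (hsupp r) i)
      ⟨⟨0, hN⟩, Finset.mem_univ _⟩
  set u := sel S with hu
  have h1 : f (fun i => total S (g us i)) ≤ N * (1 + 9 * e) * f lam := by
    rw [← hf.homog _ _ (by positivity) hlam]
    refine hf.mono _ _ (htot us) fun i => ?_
    have := not_le.1 (show ¬ N * ((1 + 5 * e) * lam i + 2 * e * (2 * lam i)) ≤ total S (g us i) from
      hS (Sum.inr (Sum.inl i)))
    linarith
  -- Subadditivity moves the part of the deviation proportional to `L` into a separate error term.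
  have h2 : N * (1 - 2 * e) * f (M u) ≤ f (fun i => total S (g u i)) + N * (2 * e) * f L := by
    have hc1 : 0 < N * (1 - 2 * e) := mul_pos hN' (by linarith)
    have hc2 : 0 < N * (2 * e) := by positivity
    rw [← hf.homog _ _ hc1 (hM u), ← hf.homog _ _ hc2 hL]
    refine (hf.mono _ _ (fun i => mul_pos hc1 (hM u i)) fun i => ?_).trans
      (hs _ _ (htot u) fun i => mul_pos hc2 (hL i))
    have := not_le.1 (show ¬ total S (g u i) ≤ N * (M u i - 2 * e * (L i + M u i)) from
      hS (Sum.inl (u, i)))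
    linarith
  have h3 : f (M u) ≤ (1 + 18 * e) * f L := by
    have h4 := hsel S us
    have h5 : N * (1 + 9 * e) * f lam ≤ N * (1 + 9 * e) * ((1 + 4 * e) * f L) :=
      mul_le_mul_of_nonneg_left hfk (by positivity)
    have h6 : N * ((1 - 2 * e) * f (M u)) ≤ N * (((1 + 9 * e) * (1 + 4 * e) + 2 * e) * f L) := by
      linarith
    have h7 := le_of_mul_le_mul_left h6 hN'
    have h8 : (1 + 9 * e) * (1 + 4 * e) + 2 * e ≤ (1 - 2 * e) * (1 + 18 * e) := by nlinarith
    have h9 := mul_le_mul_of_nonneg_right h8 hfL.le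
    refine le_of_mul_le_mul_left (?_ : (1 - 2 * e) * _ ≤ (1 - 2 * e) * _) (by linarith)
    linarith
  have h4 := hs.integral_epValue_le hf hz hpos hB hL hm0 hn (hW u) (α := -γ - 1) he0 (by linarith) hlog
  have h5 := hs.le_integral_optMin hf hpos hB hX hL
  have h6 : f (M u) + 2 * e * (f L + f (M u)) ≤ (1 + 23 * e) * f L := by
    have h7 := mul_le_mul_of_nonneg_left h3 (by linarith : 0 ≤ 1 + 2 * e)
    have h8 : (1 + 2 * e) * (1 + 18 * e) + 2 * e ≤ 1 + 23 * e := by nlinarith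
    have h9 := mul_le_mul_of_nonneg_right h8 hfL.le
    linarith
  exact h4.trans (h6.trans (mul_le_mul_of_nonneg_left h5 (by linarith)))

/-! ### Choice of parameters -/

theorem rpow_one_div_le {m : ℕ} {e γ : ℝ} (hm : 0 < m) (he : 0 < e) (he1 : e ≤ 1)
    (hγ : (m : ℝ) / e ≤ γ) : (m : ℝ) ^ (1 / γ) ≤ 1 + 2 * e := by
  have hm' : (1:ℝ) ≤ m := by exact_mod_cast hm
  have hm0 : (0:ℝ) < m := by linarith
  have hγ0 : 0 < (m:ℝ) / e := by positivity
  rw [Real.rpow_def_of_pos hm0]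
  have h1 : Real.log m * (1 / γ) ≤ e := by
    have h2 : Real.log m ≤ m := (Real.log_le_sub_one_of_pos hm0).trans (by linarith)
    rw [mul_one_div, div_le_iff₀ (hγ0.trans_le hγ)]
    rw [div_le_iff₀ he] at hγ
    linarith
  have h3 : Real.exp e ≤ 1 + e + e ^ 2 := exp_le_one_add_add_sq (by rw [abs_of_pos he]; exact he1)
  have h4 := Real.exp_le_exp.2 h1
  nlinarith

theorem grid_pow_ge {m : ℕ} {e η : ℝ} (hm : 0 < m) (he : 0 < e)
    (hη : e ^ 2 / (2 * m) ≤ η) :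
    32 * (m : ℝ) ^ 2 / e ^ 2 ≤ (1 + η) ^ ⌈64 * (m : ℝ) ^ 3 / e ^ 4⌉₊ := by
  have hm0 : (0:ℝ) < m := by exact_mod_cast hm
  have hη0 : 0 < η := lt_of_lt_of_le (by positivity) hη
  set K := ⌈64 * (m : ℝ) ^ 3 / e ^ 4⌉₊ with hK
  have h1 : 64 * (m : ℝ) ^ 3 / e ^ 4 ≤ K := Nat.le_ceil _
  have h2 : 1 + (K : ℝ) * η ≤ (1 + η) ^ K := one_add_mul_le_pow (by linarith) K
  have h3 : 64 * (m : ℝ) ^ 3 / e ^ 4 * (e ^ 2 / (2 * m)) ≤ K * η :=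
    mul_le_mul h1 hη (by positivity) (by positivity)
  have h4 : 64 * (m : ℝ) ^ 3 / e ^ 4 * (e ^ 2 / (2 * m)) = 32 * (m : ℝ) ^ 2 / e ^ 2 := by
    field_simp; norm_num
  linarith

/-- The grid is of order `(m / ε) ^ 4`; since `m / ε ≥ 2`, a further power `34` absorbs the
numerical constants. -/
theorem grid_card_le {m : ℕ} {ε : ℝ} (hm : 2 ≤ m) (hε : 0 < ε) (hε1 : ε < 1) :
    2 * (⌈64 * (m : ℝ) ^ 3 / (ε / 100) ^ 4⌉₊ : ℝ) + 1 ≤ ((m : ℝ) / ε) ^ 38 := by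
  have hm' : (2:ℝ) ≤ m := by exact_mod_cast hm
  set Q := (m : ℝ) / ε with hQ
  have hQ2 : 2 ≤ Q := by rw [hQ, le_div_iff₀ hε]; nlinarith
  have h1 : (⌈64 * (m : ℝ) ^ 3 / (ε / 100) ^ 4⌉₊ : ℝ) ≤ 64 * (m : ℝ) ^ 3 / (ε / 100) ^ 4 + 1 :=
    (Nat.ceil_lt_add_one (by positivity)).le
  have h2 : 64 * (m : ℝ) ^ 3 / (ε / 100) ^ 4 ≤ 64 * 10 ^ 8 * Q ^ 4 := by
    have h3 : 64 * (m : ℝ) ^ 3 / (ε / 100) ^ 4 = 64 * 10 ^ 8 * (m ^ 3 / ε ^ 4) := by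
      field_simp; norm_num
    rw [h3, hQ, div_pow]
    gcongr
    · linarith
    · norm_num
  have h4 : (2:ℝ) ^ 34 ≤ Q ^ 34 := pow_le_pow_left₀ (by norm_num) hQ2 34
  have h5 : (2:ℝ) ^ 4 ≤ Q ^ 4 := pow_le_pow_left₀ (by norm_num) hQ2 4
  have h6 : Q ^ 38 = Q ^ 34 * Q ^ 4 := by ring
  have h7 : (2:ℝ) ^ 34 * Q ^ 4 ≤ Q ^ 34 * Q ^ 4 := mul_le_mul_of_nonneg_right h4 (by positivity)
  rw [h6]
  norm_num at h5 h7
  linarith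

theorem log_add_one_le {m : ℕ} (hm : 2 ≤ m) : Real.log (m + 1) ≤ 2 * Real.log m := by
  have hm' : (2:ℝ) ≤ m := by exact_mod_cast hm
  rw [← Real.log_rpow (by linarith), ← Nat.cast_two, Real.rpow_natCast]
  exact Real.log_le_log (by linarith) (by nlinarith)

/-- In powers of `m / ε` the union bound has exponent at most `3 + 76 m`, and the tail `-(79 + κ)
m`; the sum is at most `-κ`. -/
theorem failure_probability_le {m K N : ℕ} {κ ε s : ℝ} (hm : 2 ≤ m) (hκ : 0 < κ) (hε : 0 < ε)
    (hε1 : ε < 1) (hK : 2 * (K : ℝ) + 1 ≤ ((m : ℝ) / ε) ^ 38)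
    (hs : (79 + κ) * (m * Real.log ((m : ℝ) / ε)) ≤ N * s) :
    4 * m * (2 * (K : ℝ) + 1) ^ (2 * m) * Real.exp (-(N * s)) ≤ (m : ℝ) ^ (-κ) := by
  have hm' : (2:ℝ) ≤ m := by exact_mod_cast hm
  set Q := (m : ℝ) / ε with hQ
  have hmQ : (m : ℝ) ≤ Q := by rw [hQ, le_div_iff₀ hε]; nlinarith
  have hQ0 : 0 < Q := by linarith
  have hlQ : 0 ≤ Real.log Q := Real.log_nonneg (by linarith)
  have h1 : 4 * (m : ℝ) ≤ Q ^ 3 := by nlinarith [mul_nonneg hQ0.le hQ0.le]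
  have h2 : (2 * (K : ℝ) + 1) ^ (2 * m) ≤ (Q ^ 38) ^ (2 * m) :=
    pow_le_pow_left₀ (by positivity) hK _
  have h3 : Q ^ (-κ) ≤ (m : ℝ) ^ (-κ) :=
    Real.rpow_le_rpow_of_nonpos (by linarith) hmQ (by linarith)
  refine le_trans ?_ h3
  have h4 : Real.exp (-(N * s)) ≤ Real.exp (-((79 + κ) * (m * Real.log Q))) :=
    Real.exp_le_exp.2 (neg_le_neg hs)
  calc 4 * m * (2 * (K : ℝ) + 1) ^ (2 * m) * Real.exp (-(N * s))
      ≤ Q ^ 3 * (Q ^ 38) ^ (2 * m) * Real.exp (-((79 + κ) * (m * Real.log Q))) := by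
        gcongr
    _ = Real.exp (Real.log Q * (3 + 76 * m) - (79 + κ) * (m * Real.log Q)) := by
        rw [← pow_mul, ← pow_add, ← Real.rpow_natCast, Real.rpow_def_of_pos hQ0, ← Real.exp_add]
        congr 1; push_cast; ring
    _ ≤ Real.exp (Real.log Q * -κ) := by
        refine Real.exp_le_exp.2 ?_
        have : 0 ≤ Real.log Q * ((m - 1) * (3 + κ)) :=
          mul_nonneg hlQ (mul_nonneg (by linarith) (by linarith))
        nlinarith
    _ = Q ^ (-κ) := (Real.rpow_def_of_pos hQ0 _).symm

theorem le_sampleSize {m : ℕ} {ε : ℝ} (hm : 2 ≤ m) (hε : 0 < ε) (hε1 : ε < 1) :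
    (m : ℝ) * Real.log ((m : ℝ) / ε) ≤
      2 * (⌊(m : ℝ) / Real.log m * Real.log ((m : ℝ) / ε)⌋₊ * Real.log m) := by
  have hm' : (2:ℝ) ≤ m := by exact_mod_cast hm
  have hlog : 0 < Real.log m := Real.log_pos (by linarith)
  have hmQ : (m : ℝ) ≤ m / ε := by rw [le_div_iff₀ hε]; nlinarith
  have h1 : Real.log m ≤ Real.log ((m : ℝ) / ε) := Real.log_le_log (by linarith) hmQ
  set x := (m : ℝ) / Real.log m * Real.log ((m : ℝ) / ε) with hx
  have hx2 : 2 ≤ x := by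
    have h2 : (m : ℝ) / Real.log m * Real.log m ≤ x := mul_le_mul_of_nonneg_left h1 (by positivity)
    rw [div_mul_cancel₀ _ hlog.ne'] at h2
    linarith
  -- Rounding down loses at most a factor two because `x ≥ 2`.
  have h3 : x ≤ 2 * ⌊x⌋₊ := by linarith [Nat.sub_one_lt_floor x]
  have h4 : x * Real.log m = m * Real.log ((m : ℝ) / ε) := by rw [hx]; field_simp
  have h5 := mul_le_mul_of_nonneg_right h3 hlog.le
  linarith

end OnlineAllocation

open OnlineAllocation in
theorem theorem7p3 (κ : ℝ) (hκ : 0 < κ) :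
    ∃ c₁ c₂ c₃ : ℝ, 0 < c₁ ∧ 0 < c₂ ∧ 0 < c₃ ∧
      ∀ (m : ℕ) (ε : ℝ), 2 ≤ m → 0 < ε → ε < 1 →
        ∃ (N : ℕ) (αmax αmin : ℝ),
          (N : ℝ) ≤ c₂ * ((m : ℝ) / Real.log m * Real.log ((m : ℝ) / ε)) ∧
          ∀ (f : (Fin m → ℝ) → ℝ) (n : ℕ), WellBehaved f →
            (OnlineAllocation.Superadditive f →
              ∃ A : Learner m n N, (∀ S i, 0 < A S i) ∧
                ∀ D : Fin n → PMF (Fin m → ℝ), PositiveWeights D →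
                  SmallItemsMax f D ε (c₁ * (Real.log m / ε ^ 2)) →
                  1 - (m : ℝ) ^ (-κ) ≤ (sampleLaw N D).real
                    {S | MeasureTheory.Integrable (epValue f αmax (A S)) (law D) ∧
                      (1 - c₃ * ε) * (∫ P, optMax f P ∂(law D)) ≤
                        ∫ P, epValue f αmax (A S) P ∂(law D)}) ∧
            (OnlineAllocation.Subadditive f →
              ∃ A : Learner m n N, (∀ S i, 0 < A S i) ∧
                ∀ D : Fin n → PMF (Fin m → ℝ), PositiveWeights D →
                  SmallItemsMin f D ε (c₁ * (Real.log m / ε ^ 2)) →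
                  1 - (m : ℝ) ^ (-κ) ≤ (sampleLaw N D).real
                    {S | MeasureTheory.Integrable (epValue f αmin (A S)) (law D) ∧
                      ∫ P, epValue f αmin (A S) P ∂(law D) ≤
                        (1 + c₃ * ε) * (∫ P, optMin f P ∂(law D))}) := by
  -- `80000 = 100² * 4 * 2`: from `e = ε / 100`, from the slack `4` in the maximization learner, and
  -- from the floor in the sample size. With this `e` the losses `14 e` and `23 e`, combined with
  -- the factors `1 - ε` and `1 + ε`, stay within `2 ε`.
  refine ⟨80000 * (79 + κ), 1, 2, by positivity, one_pos, two_pos, fun m ε hm hε hε1 => ?_⟩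
  have hm' : (2:ℝ) ≤ m := by exact_mod_cast hm
  have hm0 : 0 < m := by omega
  have hlogm : 0 < Real.log m := Real.log_pos (by linarith)
  set e := ε / 100 with hedef
  have he0 : 0 < e := by positivity
  have he1 : e ≤ 1 / 100 := by rw [hedef]; linarith
  set γ := (m : ℝ) / e with hγdef
  have hγ1 : 1 ≤ γ := by rw [hγdef, le_div_iff₀ he0]; linarith
  set η := e / (γ + 1) with hηdef
  have hη0 : 0 < η := by positivity
  have hγη : (γ + 1) * η = e := by rw [hηdef]; field_simp
  have hη2 : e ^ 2 / (2 * m) ≤ η := by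
    have : η = e ^ 2 / (m + e) := by rw [hηdef, hγdef]; field_simp
    rw [this]
    gcongr
    linarith
  set K := ⌈64 * (m : ℝ) ^ 3 / e ^ 4⌉₊ with hKdef
  have hK := grid_pow_ge hm0 he0 hη2
  set N := ⌊(m : ℝ) / Real.log m * Real.log ((m : ℝ) / ε)⌋₊ with hNdef
  have hN := le_sampleSize hm hε hε1
  have hmQ : (1 : ℝ) < m / ε := by rw [lt_div_iff₀ hε]; linarith
  have hNpos : 0 < N := by
    refine Nat.pos_of_ne_zero fun h0 => ?_
    rw [← hNdef, h0] at hN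
    have : 0 < (m : ℝ) * Real.log ((m : ℝ) / ε) := mul_pos (by linarith) (Real.log_pos hmQ)
    simp only [Nat.cast_zero, zero_mul, mul_zero] at hN
    linarith
  set ζ := 80000 * (79 + κ) * (Real.log m / ε ^ 2) with hζdef
  have hζ0 : 0 < ζ := by positivity
  have hζ4 : ζ = 4 * (ζ / 4) := by ring
  have heζ : e ^ 2 * (ζ / 4) = 2 * (79 + κ) * Real.log m := by
    rw [hζdef, hedef]; field_simp; norm_num
  have hlog4 : Real.log (m + 1) ≤ e ^ 2 * (ζ / 4) := by
    rw [heζ]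
    have := log_add_one_le hm
    nlinarith
  have hfail : 4 * m * (2 * (K : ℝ) + 1) ^ (2 * m) * Real.exp (-(N * (e ^ 2 * (ζ / 4))))
      ≤ (m : ℝ) ^ (-κ) := by
    refine failure_probability_le hm hκ hε hε1 (grid_card_le hm hε hε1) ?_
    rw [heζ]
    have := mul_le_mul_of_nonneg_left hN (by linarith : 0 ≤ 79 + κ)
    linarith
  refine ⟨N, γ, -γ - 1, ?_, fun f n hf => ⟨fun hs => ?_, fun hs => ?_⟩⟩
  · rw [one_mul]
    exact Nat.floor_le (mul_nonneg (by positivity) (Real.log_nonneg hmQ.le))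
  · obtain ⟨A, hA, hgood⟩ := hs.exists_learner hf n hm hNpos (ε := ε) (by positivity : 0 < ζ / 4)
      (by linarith : 0 < γ) hη0 hγη.le he1
      (rpow_one_div_le hm0 he0 (by linarith) (by rw [← hγdef]; linarith)) hK hlog4
    refine ⟨A, hA, fun D hpos hsmall => ?_⟩
    rw [hζ4] at hsmall
    have h1 := hgood D hpos hsmall
    have h2 : 4 * m * ((K : ℝ) + 1) ^ (2 * m) * Real.exp (-(N * (e ^ 2 * (ζ / 4))))
        ≤ (m : ℝ) ^ (-κ) := by
      refine le_trans ?_ hfail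
      gcongr
      linarith [Nat.cast_nonneg (α := ℝ) K]
    refine le_trans (by linarith) (h1.trans (MeasureTheory.measureReal_mono fun S hS => ?_))
    refine ⟨hS.1, le_trans ?_ hS.2⟩
    have hT : 0 ≤ ∫ P, optMax f P ∂(law D) := MeasureTheory.integral_nonneg (optMax_nonneg hf)
    rw [← mul_assoc]
    refine mul_le_mul_of_nonneg_right ?_ hT
    rw [hedef]
    nlinarith
  · obtain ⟨A, hA, hgood⟩ := hs.exists_learner hf n hm hNpos (z := ζ) hζ0
      hγ1 hε hη0 (by linarith) he1 (rpow_one_div_le hm0 he0 (by linarith) le_rfl) hK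
      (hlog4.trans (by gcongr; linarith))
    refine ⟨A, hA, fun D hpos hsmall => ?_⟩
    have h1 := hgood D hpos hsmall
    have h2 : 4 * m * (2 * (K : ℝ) + 1) ^ (2 * m) * Real.exp (-(N * (e ^ 2 * ζ)))
        ≤ (m : ℝ) ^ (-κ) := by
      refine le_trans ?_ hfail
      gcongr
      linarith
    refine le_trans (by linarith) (h1.trans (MeasureTheory.measureReal_mono fun S hS => ?_))
    refine ⟨hS.1, hS.2.trans ?_⟩
    have hT : 0 ≤ ∫ P, optMin f P ∂(law D) := MeasureTheory.integral_nonneg (optMin_nonneg hf)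
    rw [← mul_assoc]
    refine mul_le_mul_of_nonneg_right ?_ hT
    rw [hedef]
    nlinarith
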